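/- **Setting.** For $0\le x<1$ write $X\sim\mathrm{Geom}(x)$ if $\mathbb P(X=k)=(1-x)x^k$, $k=0,1,2,\dots$. Let $0\le a\le 1$, $0\le q<1$, $\eta,\theta\ge 0$ be real with $a\,q^{(\eta+\theta)/2}<1$, and put $Q=q^\eta$, $\tilde Q=q^\theta$. At each point $(i,j)$, $i,j\ge 1$, of the quadrant place, independently, a random weight $\mathrm{Geom}(aQ^{i-1/2}\tilde Q^{\,j-1/2})$ (so that the anti-diagonal $i+j=k+1$ carries the weights $\mathrm{Geom}(aQ^{i-1/2}\tilde Q^{\,k-i+1/2})$). The length of a path is the sum of the weights on it. Let $L_1\in[0,\infty]$ be the supremum of the lengths of all down-left paths from $(1,1)$ to $(\infty,\infty)$ (each step is $(i,j)\to(i+1,j)$ or $(i,j)\to(i,j+1)$), and let $L_2\in[0,\infty]$ be the supremum of the lengths of all down-right paths from $(\infty,1)$ to $(1,\infty)$ (bi-infinite paths with steps $(i,j)\to(i-1,j)$ or $(i,j)\to(i,j+1)$ that arrive along the points $(i,1)$, $i\to\infty$, and leave along the points $(1,j)$, $j\to\infty$). **Theorem.** (1) $L_1$ and $L_2$ are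 equal in distribution; if $\eta,\theta>0$, both are almost surely finite. (2) Fix $\alpha\ge 0$ and $\eta,\theta>0$, let $q=e^{-\epsilon}$, $a=e^{-\alpha\epsilon}$, and let $L\in\{L_1,L_2\}$. For every $s\in\mathbb R$, $$\lim_{\epsilon\to0+}\mathbb P\left(\epsilon L+\frac{\log(\epsilon\eta)}{\eta}+\frac{\log(\epsilon\theta)}{\theta}<s\right)=\det(1-\tilde K_{he})_{L^2(s,\infty)},\qquad \tilde K_{he}(x,y)=e^{-\frac x2-\frac y2}K_{he}(0,e^{-x};0,e^{-y}),$$ where, for $x,y>0$, $$K_{he}(0,x;0,y)=\frac1{\sqrt{xy}}\int\frac{d\zeta}{2\pi i}\int\frac{d\omega}{2\pi i}\,\frac{F_{he}(\zeta)}{F_{he}(\omega)}\,\frac{x^\zeta}{y^\omega}\,\frac1{\zeta-\omega},\qquad F_{he}(\zeta)=\frac{\Gamma\left(\frac\alpha{2\eta}-\frac\zeta\eta+\frac12\right)}{\Gamma\left(\frac\alpha{2\theta}+\frac\zeta\theta+\frac12\right)}.$$ Here, for any $0<\delta<\min\left(\frac{\alpha+\eta}2,\frac{\alpha+\theta}2\right)$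 and any $h>0$, $\zeta$ runs over the Hankel contour that goes in straight lines from $+\infty-ih$ to $\delta-ih$, to $\delta+ih$, to $+\infty+ih$, and $\omega$ over the one from $-\infty-ih$ to $-\delta-ih$, to $-\delta+ih$, to $-\infty+ih$. The determinant is the Fredholm determinant $$\det(1-K)_{L^2(s,\infty)}=\sum_{n\ge0}\frac{(-1)^n}{n!}\int_{(s,\infty)^n}\det\left[K(x_i,x_j)\right]_{i,j=1}^n\,dx_1\cdots dx_n .$$ The double contour integral, and the integrals and the series of the Fredholm determinant, converge absolutely. -/

import Mathlib

open MeasureTheory ProbabilityTheory Filter Topology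
open scoped ENNReal Nat

noncomputable section

/-! ### The weights

Lattice points of the quadrant are indexed from zero: the pair `(i, j) : ℕ × ℕ` stands for the
lattice point with coordinates `(i + 1, j + 1)`. -/

/-- The parameter `a Q^(i - 1/2) Q̃^(j - 1/2)`, with `Q = q^η` and `Q̃ = q^θ`, of the weight at the
lattice point with (one-based) coordinates `(i, j) = (p.1 + 1, p.2 + 1)`.  On the anti-diagonal
`i + j = k + 1` one has `j - 1/2 = k - i + 1/2`. -/
def geoParam (a q η θ : ℝ) (p : ℕ × ℕ) : ℝ :=
  a * (q ^ η) ^ ((p.1 : ℝ) + 1 - 1 / 2) * (q ^ θ) ^ ((p.2 : ℝ) + 1 - 1 / 2)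

/-- `X` is geometric of parameter `x`: `ℙ(X = k) = (1 - x) x^k` for `k = 0, 1, 2, …`. -/
def IsGeom {Ω : Type*} [MeasurableSpace Ω] (P : Measure Ω) (X : Ω → ℕ) (x : ℝ) : Prop :=
  ∀ k : ℕ, P {ω | X ω = k} = ENNReal.ofReal ((1 - x) * x ^ k)

/-- `w` is a field of independent geometric weights on the quadrant, with parameters
`geoParam a q η θ`. -/
structure IsGeoField {Ω : Type*} [MeasurableSpace Ω] (P : Measure Ω) (w : ℕ × ℕ → Ω → ℕ)
    (a q η θ : ℝ) : Prop where
  measurable : ∀ p, Measurable (w p)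
  indep : iIndepFun w P
  law : ∀ p, IsGeom P (w p) (geoParam a q η θ p)

/-! ### Paths and last passage times -/

/-- A down-left path from `(1, 1)` to `(∞, ∞)`: every step increases one coordinate by one. -/
structure DownLeftPath where
  pt : ℕ → ℕ × ℕ
  start : pt 0 = (0, 0)
  step : ∀ n, pt (n + 1) = ((pt n).1 + 1, (pt n).2) ∨ pt (n + 1) = ((pt n).1, (pt n).2 + 1)
  stop_at : Tendsto pt atTop (atTop ×ˢ atTop)

/-- A down-right path from `(∞, 1)` to `(1, ∞)`: it is indexed by `ℤ`, every step either decreases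
the first coordinate by one or increases the second one by one; it comes in along the points
`(i, 1)`, `i → ∞`, and leaves along the points `(1, j)`, `j → ∞`. -/
structure DownRightPath where
  pt : ℤ → ℕ × ℕ
  step : ∀ n, pt n = ((pt (n + 1)).1 + 1, (pt (n + 1)).2) ∨ pt (n + 1) = ((pt n).1, (pt n).2 + 1)
  start : Tendsto pt atBot (atTop ×ˢ pure 0)
  stop_at : Tendsto pt atTop (pure 0 ×ˢ atTop)

/-- The length of the longest down-left path from `(1, 1)` to `(∞, ∞)`, for the weights `v`. -/
def lppDownLeft (v : ℕ × ℕ → ℕ) : ℝ≥0∞ :=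
  ⨆ π : DownLeftPath, ∑' n : ℕ, (v (π.pt n) : ℝ≥0∞)

/-- The length of the longest down-right path from `(∞, 1)` to `(1, ∞)`, for the weights `v`. -/
def lppDownRight (v : ℕ × ℕ → ℕ) : ℝ≥0∞ :=
  ⨆ π : DownRightPath, ∑' n : ℤ, (v (π.pt n) : ℝ≥0∞)

/-- `ℙ(ε L + log (ε η) / η + log (ε θ) / θ < s)` for a random variable `L` with values in
`[0, ∞]`; the inequality fails where `L = ∞`. -/
def scaledLppProb {Ω : Type*} [MeasurableSpace Ω] (P : Measure Ω) (L : Ω → ℝ≥0∞)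
    (ε η θ s : ℝ) : ℝ :=
  P.real {ω | L ω ≠ ∞ ∧
    ε * (L ω).toReal + Real.log (ε * η) / η + Real.log (ε * θ) / θ < s}

/-! ### The hard-edge kernel -/

/-- `F_he(0, ζ) = Γ(α/(2η) - ζ/η + 1/2) / Γ(α/(2θ) + ζ/θ + 1/2)`. -/
def hardEdgeF (α η θ : ℝ) (ζ : ℂ) : ℂ :=
  Complex.Gamma (α / (2 * η) - ζ / η + 1 / 2) / Complex.Gamma (α / (2 * θ) + ζ / θ + 1 / 2)

/-- The Hankel contour of the variable `ζ`: from `+∞ - i h` along the horizontal ray to `δ - i h`,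
up the vertical segment to `δ + i h`, and along the horizontal ray to `+∞ + i h`
(parametrized by arc length). -/
def hankelRight (δ h t : ℝ) : ℂ := ⟨δ + max (|t| - h) 0, max (-h) (min t h)⟩

/-- The velocity of `hankelRight`. -/
def hankelRightVel (h t : ℝ) : ℂ := if |t| < h then Complex.I else if 0 < t then 1 else -1

/-- The Hankel contour of the variable `ω`, the mirror image of that of `ζ`: from `-∞ - i h` to
`-δ - i h`, up to `-δ + i h`, and back to `-∞ + i h`. -/
def hankelLeft (δ h t : ℝ) : ℂ := ⟨-δ - max (|t| - h) 0, max (-h) (min t h)⟩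

/-- The velocity of `hankelLeft`. -/
def hankelLeftVel (h t : ℝ) : ℂ := if |t| < h then Complex.I else if 0 < t then -1 else 1

/-- The integrand of the double contour integral
`∫ dζ/(2πi) ∫ dω/(2πi) F_he(0, ζ) / F_he(0, ω) * x^ζ / y^ω * 1 / (ζ - ω)`
in terms of the parameters `p = (t, u)` of the two contours. -/
def hardEdgeIntegrand (α η θ δ h x y : ℝ) (p : ℝ × ℝ) : ℂ :=
  hardEdgeF α η θ (hankelRight δ h p.1) / hardEdgeF α η θ (hankelLeft δ h p.2)
    * ((x : ℂ) ^ hankelRight δ h p.1 / (y : ℂ) ^ hankelLeft δ h p.2)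
    * (1 / (hankelRight δ h p.1 - hankelLeft δ h p.2))
    * (hankelRightVel h p.1 / (2 * Real.pi * Complex.I))
    * (hankelLeftVel h p.2 / (2 * Real.pi * Complex.I))

/-- The hard-edge kernel `K_he(0, x; 0, y)`, for `x, y > 0`. -/
def hardEdgeKernel (α η θ δ h x y : ℝ) : ℂ :=
  1 / (Real.sqrt (x * y) : ℂ) * ∫ p : ℝ × ℝ, hardEdgeIntegrand α η θ δ h x y p

/-- `K̃_he(x, y) = e^(-x/2 - y/2) K_he(0, e^(-x); 0, e^(-y))`, for real `x, y`. -/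
def hardEdgeKernelTilde (α η θ δ h x y : ℝ) : ℂ :=
  (Real.exp (-x / 2 - y / 2) : ℂ) * hardEdgeKernel α η θ δ h (Real.exp (-x)) (Real.exp (-y))

/-! ### Fredholm determinants -/

/-- The term `(-1)^n / n! ∫_{S^n} det [K(x_i, x_j)] dx_1 ⋯ dx_n` of the Fredholm series. -/
def fredholmTerm (K : ℝ → ℝ → ℂ) (S : Set ℝ) (n : ℕ) : ℂ :=
  (-1) ^ n / (n ! : ℂ) *
    ∫ x in Set.univ.pi (fun _ : Fin n => S), (Matrix.of fun i j => K (x i) (x j)).det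

/-- The Fredholm determinant `det(1 - K)` on `L²(S)`. -/
def fredholmDet (K : ℝ → ℝ → ℂ) (S : Set ℝ) : ℂ := ∑' n, fredholmTerm K S n

/-- The integrals and the series that define `fredholmDet K S` converge absolutely. -/
def FredholmConverges (K : ℝ → ℝ → ℂ) (S : Set ℝ) : Prop :=
  (∀ n : ℕ, IntegrableOn (fun x : Fin n → ℝ => (Matrix.of fun i j => K (x i) (x j)).det)
    (Set.univ.pi fun _ => S)) ∧
  Summable (fredholmTerm K S)

end

/-!
For finite squares the law of the last passage time is explicit. The local growth rule of the
Robinson–Schensted–Knuth correspondence is a bijection: for fixed partitions `λ`, `μ` at two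
opposite corners of a cell, it replaces the pairs of a weight and a partition `ν ≺ λ, μ` by the
partitions `κ ≻ λ, μ` (`tsum_grow`). The first parts of the partitions follow the recursion of last
passage times. So for weights `Geom(x_i y_j)` the last passage time through an `N × N` square is
distributed as the first part of a partition `κ` under the Schur measure, whose density is
proportional to `s_κ(x) s_κ(y)` (`rowIter_eq`, `measure_lpp_le`).

*Equality in law.* Both suprema over infinite paths are increasing limits of last passage times
through squares, between the two pairs of opposite corners (`lppDownLeft_eq_iSup`,
`lppDownRight_eq_iSup`). Exchanging the pairs means to reverse the order of the variables `x_i`,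
and Schur polynomials are symmetric (`schurFin_rev`). If `η, θ > 0`, then only finitely many
weights are nonzero by the Borel–Cantelli lemma, which gives finiteness.

*Determinants.* By the bialternant formula and Cauchy–Binet the distribution function is
`det(C - X^m C Y^m) / det C`, where `C = (1 / (1 - x_i y_j))` is a Cauchy matrix, `X` and `Y` are
the diagonal matrices of the parameters, and `m = N + n` (`measureReal_lpp_le_eq_det`). Lagrange
interpolation inverts `C` (`sum_resCoeff_mul`). As powers of a parameter sum to integrals of a step
function over a half line (`integral_pow_floor`), the finite determinant is the Fredholm
determinant of a step kernel of finite rank (`fredholmDet_finite_rank`,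
`measureReal_lpp_le_eq_fredholmDet`), whose lattice spacing can be chosen to be `ε`.

*Limits.* Fredholm determinants are continuous under dominated pointwise convergence, by Hadamard's
inequality (`tendsto_fredholmDet`). This is used twice. As `N → ∞`, the inverse of the Cauchy
matrix for geometric progressions converges to an expression in `q`-Pochhammer symbols
(`measureReal_lppDownLeft_le_eq`). As `ε → 0`, these symbols, as reciprocals of `q`-Gamma
functions, converge to reciprocals of Gamma functions and are bounded by `2`; both facts come from
logarithmic convexity (`tendsto_qGammaInv`, `qGammaInv_le_two`). The logarithmic centering absorbs
the powers of `ε`, and the limit kernel is a double series (`tendsto_scaledLppProb`).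

*The contour integral.* That series is the sum of the residues of the hard-edge kernel
(`hardEdgeKernelTilde_eq`). As `Γ` is the sum of its principal parts, a convergent series, and an
entire function which is bounded on left half planes (`Gamma_eq_polar_add_entire`), the integral
over a Hankel contour is found by applying Cauchy's theorem to every term separately
(`hasSum_integral_hankel_Gamma`), and no contours have to be moved past infinitely many poles.
-/

noncomputable section

/-! ### Interlacing partitions and the local growth rule -/

/-- `ν ≺ κ`: the sequences interlace, `κ₀ ≥ ν₀ ≥ κ₁ ≥ ν₁ ≥ ⋯`. -/
def Interlace (ν κ : ℕ →₀ ℕ) : Prop := ∀ a, κ (a + 1) ≤ ν a ∧ ν a ≤ κ a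

open Classical in
/-- The one-variable skew Schur function `s_{κ/ν}(z)`: it is `z^(|κ| - |ν|)` if `ν ≺ κ`,
and zero otherwise. -/
def skewWt (z : ℝ≥0∞) (ν κ : ℕ →₀ ℕ) : ℝ≥0∞ :=
  if Interlace ν κ then z ^ (κ.degree - ν.degree) else 0

/-- The local growth rule of the Robinson–Schensted–Knuth correspondence: the partition at the
north-east corner of a cell with entry `k`, given those at the three other corners. -/
def grow (ν lam μ : ℕ →₀ ℕ) (k : ℕ) : ℕ →₀ ℕ :=
  Finsupp.ofSupportFinite
    (fun a => match a with
      | 0 => max (lam 0) (μ 0) + k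
      | a + 1 => max (lam (a + 1)) (μ (a + 1)) + min (lam a) (μ a) - ν a) <| by
    refine (Finset.range (lam.support.sup id + μ.support.sup id + 2)).finite_toSet.subset ?_
    intro a ha
    by_contra hlt
    simp only [Finset.coe_range, Set.mem_Iio, not_lt] at hlt
    have key : ∀ (f : ℕ →₀ ℕ) b, f.support.sup id < b → f b = 0 := fun f b hb => by
      by_contra h
      exact absurd (Finset.le_sup (f := id) (Finsupp.mem_support_iff.2 h)) (not_le.2 hb)
    obtain ⟨b, rfl⟩ : ∃ b, a = b + 1 := ⟨a - 1, by omega⟩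
    apply ha
    simp [key lam (b + 1) (by omega), key μ (b + 1) (by omega), key lam b (by omega)]

theorem grow_zero (ν lam μ : ℕ →₀ ℕ) (k : ℕ) : grow ν lam μ k 0 = max (lam 0) (μ 0) + k := rfl

theorem grow_succ (ν lam μ : ℕ →₀ ℕ) (k a : ℕ) :
    grow ν lam μ k (a + 1) = max (lam (a + 1)) (μ (a + 1)) + min (lam a) (μ a) - ν a := rfl

/-- The inverse of the growth rule: the partition at the south-west corner. -/
def shrink (lam μ κ : ℕ →₀ ℕ) : ℕ →₀ ℕ :=
  Finsupp.ofSupportFinite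
    (fun a => max (lam (a + 1)) (μ (a + 1)) + min (lam a) (μ a) - κ (a + 1)) <| by
    refine (Finset.range (lam.support.sup id + μ.support.sup id + 2)).finite_toSet.subset ?_
    intro a ha
    by_contra hlt
    simp only [Finset.coe_range, Set.mem_Iio, not_lt] at hlt
    have key : ∀ (f : ℕ →₀ ℕ) b, f.support.sup id < b → f b = 0 := fun f b hb => by
      by_contra h
      exact absurd (Finset.le_sup (f := id) (Finsupp.mem_support_iff.2 h)) (not_le.2 hb)
    apply ha
    simp [key lam (a + 1) (by omega), key μ (a + 1) (by omega), key lam a (by omega)]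

theorem shrink_apply (lam μ κ : ℕ →₀ ℕ) (a : ℕ) :
    shrink lam μ κ a = max (lam (a + 1)) (μ (a + 1)) + min (lam a) (μ a) - κ (a + 1) := rfl

theorem Finsupp.degree_eq_sum_range {f : ℕ →₀ ℕ} {R : ℕ} (h : ∀ a, R ≤ a → f a = 0) :
    f.degree = ∑ a ∈ Finset.range R, f a := by
  rw [Finsupp.degree_apply]
  refine Finset.sum_subset (fun a ha => ?_) (fun a _ ha => by simpa using ha)
  by_contra hlt
  exact Finsupp.mem_support_iff.1 ha (h a (by simpa using hlt))

theorem Finsupp.exists_bound (f : ℕ →₀ ℕ) : ∃ R, ∀ a, R ≤ a → f a = 0 := by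
  refine ⟨f.support.sup id + 1, fun a ha => ?_⟩
  by_contra h
  have := Finset.le_sup (f := id) (Finsupp.mem_support_iff.2 h)
  simp only [id] at this
  omega

theorem interlace_grow {ν lam μ : ℕ →₀ ℕ} (h₁ : Interlace ν lam) (h₂ : Interlace ν μ) (k : ℕ) :
    Interlace lam (grow ν lam μ k) ∧ Interlace μ (grow ν lam μ k) := by
  constructor <;> intro a <;> have := h₁ a <;> have := h₂ a <;> rw [grow_succ] <;>
    refine ⟨by omega, ?_⟩ <;> rcases a with _ | a <;> simp only [grow_zero, grow_succ] <;>
    [skip; have := h₁ a; skip; have := h₁ a] <;> try have := h₂ a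
  all_goals omega

theorem interlace_shrink {lam μ κ : ℕ →₀ ℕ} (h₁ : Interlace lam κ) (h₂ : Interlace μ κ) :
    Interlace (shrink lam μ κ) lam ∧ Interlace (shrink lam μ κ) μ := by
  constructor <;> intro a <;> have := h₁ a <;> have := h₂ a <;> have := h₁ (a + 1) <;>
    have := h₂ (a + 1) <;> rw [shrink_apply] <;> omega

theorem grow_shrink {lam μ κ : ℕ →₀ ℕ} (h₁ : Interlace lam κ) (h₂ : Interlace μ κ) :
    grow (shrink lam μ κ) lam μ (κ 0 - max (lam 0) (μ 0)) = κ := by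
  ext a
  rcases a with _ | a
  · have := h₁ 0; have := h₂ 0
    rw [grow_zero]; omega
  · have := h₁ a; have := h₂ a; have := h₁ (a + 1); have := h₂ (a + 1)
    rw [grow_succ, shrink_apply]; omega

theorem shrink_grow {ν lam μ : ℕ →₀ ℕ} (h₁ : Interlace ν lam) (h₂ : Interlace ν μ) (k : ℕ) :
    shrink lam μ (grow ν lam μ k) = ν := by
  ext a
  have := h₁ a; have := h₂ a
  rw [shrink_apply, grow_succ]; omega

theorem Interlace.degree_le {ν κ : ℕ →₀ ℕ} (h : Interlace ν κ) : ν.degree ≤ κ.degree := by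
  obtain ⟨R, hR⟩ := κ.exists_bound
  rw [Finsupp.degree_eq_sum_range hR,
    Finsupp.degree_eq_sum_range (f := ν) (R := R) fun a ha => by
      have := (h a).2; have := hR a ha; omega]
  exact Finset.sum_le_sum fun a _ => (h a).2

/-- The growth rule preserves the total size. -/
theorem degree_grow {ν lam μ : ℕ →₀ ℕ} (h₁ : Interlace ν lam) (h₂ : Interlace ν μ) (k : ℕ) :
    (grow ν lam μ k).degree + ν.degree = lam.degree + μ.degree + k := by
  obtain ⟨R₁, hR₁⟩ := lam.exists_bound
  obtain ⟨R₂, hR₂⟩ := μ.exists_bound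
  set R := R₁ + R₂
  have hl : ∀ a, R ≤ a → lam a = 0 := fun a ha => hR₁ a (by omega)
  have hm : ∀ a, R ≤ a → μ a = 0 := fun a ha => hR₂ a (by omega)
  have hn : ∀ a, R ≤ a → ν a = 0 := fun a ha => by have := (h₁ a).2; have := hl a ha; omega
  have hg : ∀ a, R + 1 ≤ a → grow ν lam μ k a = 0 := fun a ha => by
    obtain ⟨b, rfl⟩ : ∃ b, a = b + 1 := ⟨a - 1, by omega⟩
    rw [grow_succ, hl (b + 1) (by omega), hm (b + 1) (by omega), hl b (by omega)]
    simp
  rw [Finsupp.degree_eq_sum_range hg, Finsupp.degree_eq_sum_range hn,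
    Finsupp.degree_eq_sum_range hl, Finsupp.degree_eq_sum_range hm, Finset.sum_range_succ',
    grow_zero, add_right_comm, ← Finset.sum_add_distrib]
  have e₁ : ∀ a ∈ Finset.range R, grow ν lam μ k (a + 1) + ν a =
      max (lam (a + 1)) (μ (a + 1)) + min (lam a) (μ a) := fun a _ => by
    have := h₁ a; have := h₂ a
    rw [grow_succ]; omega
  rw [Finset.sum_congr rfl e₁, Finset.sum_add_distrib]
  have e₂ : ∑ a ∈ Finset.range R, max (lam (a + 1)) (μ (a + 1)) + max (lam 0) (μ 0) =
      ∑ a ∈ Finset.range R, max (lam a) (μ a) := by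
    rw [← Finset.sum_range_succ' (fun a => max (lam a) (μ a)), Finset.sum_range_succ,
      hl R le_rfl, hm R le_rfl]
    simp
  have e₃ : ∑ a ∈ Finset.range R, max (lam a) (μ a) + ∑ a ∈ Finset.range R, min (lam a) (μ a) =
      ∑ a ∈ Finset.range R, lam a + ∑ a ∈ Finset.range R, μ a := by
    rw [← Finset.sum_add_distrib, ← Finset.sum_add_distrib]
    exact Finset.sum_congr rfl fun a _ => max_add_min _ _
  omega

open Classical in
/-- The local Cauchy identity, in bijective form: for fixed `λ, μ, κ`, there is at
most one pair `(ν, k)` that the growth rule sends to `κ`. -/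
theorem tsum_grow (x y : ℝ≥0∞) (lam μ κ : ℕ →₀ ℕ) :
    (∑' ν, ∑' k, if grow ν lam μ k = κ then skewWt y ν lam * (x * y) ^ k * skewWt x ν μ else 0) =
      skewWt x lam κ * skewWt y μ κ := by
  by_cases h : Interlace lam κ ∧ Interlace μ κ
  · obtain ⟨h₁, h₂⟩ := h
    obtain ⟨g₁, g₂⟩ := interlace_shrink h₁ h₂
    have hg := grow_shrink h₁ h₂
    have hd := degree_grow g₁ g₂ (κ 0 - max (lam 0) (μ 0))
    rw [hg] at hd
    have := g₁.degree_le; have := g₂.degree_le; have := h₁.degree_le; have := h₂.degree_le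
    -- the only pair that contributes, as the growth rule is a bijection
    rw [tsum_eq_single (shrink lam μ κ), tsum_eq_single (κ 0 - max (lam 0) (μ 0)), if_pos hg]
    · simp only [skewWt, if_pos h₁, if_pos h₂, if_pos g₁, if_pos g₂]
      rw [show κ.degree - lam.degree = (κ 0 - max (lam 0) (μ 0)) +
          (μ.degree - (shrink lam μ κ).degree) by omega,
        show κ.degree - μ.degree = (κ 0 - max (lam 0) (μ 0)) +
          (lam.degree - (shrink lam μ κ).degree) by omega]
      ring
    · intro k hk
      rw [if_neg]
      intro he
      have h0 := grow_zero (shrink lam μ κ) lam μ k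
      rw [he] at h0
      omega
    · intro ν hν
      refine ENNReal.tsum_eq_zero.2 fun k => ?_
      split_ifs with hk
      · by_cases i₁ : Interlace ν lam
        · by_cases i₂ : Interlace ν μ
          · exact absurd (by rw [← hk, shrink_grow i₁ i₂]) hν
          · simp [skewWt, i₂]
        · simp [skewWt, i₁]
      · rfl
  · have : skewWt x lam κ * skewWt y μ κ = 0 := by
      rw [not_and_or] at h
      rcases h with h | h <;> simp [skewWt, h]
    rw [this]
    refine ENNReal.tsum_eq_zero.2 fun ν => ENNReal.tsum_eq_zero.2 fun k => ?_
    split_ifs with hk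
    · by_cases i₁ : Interlace ν lam
      · by_cases i₂ : Interlace ν μ
        · exact absurd (hk ▸ interlace_grow i₁ i₂ k) h
        · simp [skewWt, i₂]
      · simp [skewWt, i₁]
    · rfl

/-- The sum over the chains `∅ = κ⁰ ≺ κ¹ ≺ ⋯ ≺ κᴺ = κ`, with weights `∏ y_j^(|κʲ⁺¹| - |κʲ|)`, of a
function of the vector of first rows `(κ¹₀, …, κᴺ₀)`; this vector is stored at the places
`1, …, N` of a sequence that is zero elsewhere. -/
def chainSum (y : ℕ → ℝ≥0∞) : ℕ → ((ℕ → ℕ) → ℝ≥0∞) → (ℕ →₀ ℕ) → ℝ≥0∞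
  | 0, F, κ => open Classical in if κ = 0 then F (fun _ => 0) else 0
  | N + 1, F, κ => ∑' ν, skewWt (y N) ν κ *
      chainSum y N (fun g => F (Function.update g (N + 1) (κ 0))) ν

/-- The sum over a chain ending in `lam` and the entries of one row, such that the growth rule
produces a chain ending in `κ`, of a function of the first rows of the new chain. -/
def pairSum (x : ℝ≥0∞) (y : ℕ → ℝ≥0∞) :
    ℕ → ((ℕ → ℕ) → ℝ≥0∞) → (ℕ →₀ ℕ) → (ℕ →₀ ℕ) → ℝ≥0∞
  | 0, F, lam, κ => open Classical in if lam = 0 ∧ κ = 0 then F (fun _ => 0) else 0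
  | N + 1, F, lam, κ => open Classical in ∑' μ, ∑' ν, ∑' k : ℕ, if grow ν lam μ k = κ then
      skewWt (y N) ν lam * (x * y N) ^ k *
        pairSum x y N (fun g => F (Function.update g (N + 1) (κ 0))) ν μ else 0

/-- The effect of one more row of geometric weights (without the normalization) on a function of
the vector of last passage times to the points of a row. -/
def rowStep (x : ℝ≥0∞) (y : ℕ → ℝ≥0∞) : ℕ → ((ℕ → ℕ) → ℝ≥0∞) → (ℕ → ℕ) → ℝ≥0∞
  | 0, F, _ => F (fun _ => 0)
  | N + 1, F, g => rowStep x y N (fun g' => ∑' k : ℕ, (x * y N) ^ k *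
      F (Function.update g' (N + 1) (max (g (N + 1)) (g' N) + k))) g

theorem skewWt_zero_right (z : ℝ≥0∞) (ν : ℕ →₀ ℕ) :
    skewWt z ν 0 = open Classical in if ν = 0 then 1 else 0 := by
  classical
  unfold skewWt
  have : Interlace ν 0 ↔ ν = 0 := by
    refine ⟨fun h => ?_, fun h => by simp [h, Interlace]⟩
    ext a
    simpa using (h a).2
  simp only [this]
  split_ifs with h <;> simp [h]

/-- Reversing the growth rule cell by cell turns the sum over a chain and a row of weights into a
sum over the chain produced by them. -/
theorem pairSum_eq (x : ℝ≥0∞) (y : ℕ → ℝ≥0∞) (N : ℕ) (F : (ℕ → ℕ) → ℝ≥0∞) (lam κ : ℕ →₀ ℕ) :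
    pairSum x y N F lam κ = skewWt x lam κ * chainSum y N F κ := by
  classical
  induction N generalizing F lam κ with
  | zero =>
    simp only [pairSum, chainSum]
    by_cases hk : κ = 0
    · subst hk
      rw [skewWt_zero_right]
      by_cases hl : lam = 0 <;> simp [hl]
    · simp [hk]
  | succ N ih =>
    simp only [pairSum, chainSum, ih]
    rw [← ENNReal.tsum_mul_left]
    refine tsum_congr fun μ => ?_
    rw [← mul_assoc, ← tsum_grow, ← ENNReal.tsum_mul_right]
    refine tsum_congr fun ν => ?_
    rw [← ENNReal.tsum_mul_right]
    refine tsum_congr fun k => ?_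
    rw [ite_mul, zero_mul, mul_assoc _ (skewWt x ν μ)]

theorem pairSum_tsum (x : ℝ≥0∞) (y : ℕ → ℝ≥0∞) (N : ℕ) (c : ℕ → ℝ≥0∞)
    (F : ℕ → (ℕ → ℕ) → ℝ≥0∞) (lam κ : ℕ →₀ ℕ) :
    pairSum x y N (fun g => ∑' k, c k * F k g) lam κ =
      ∑' k, c k * pairSum x y N (F k) lam κ := by
  classical
  induction N generalizing F lam κ with
  | zero => simp only [pairSum]; split_ifs <;> simp
  | succ N ih =>
    simp only [pairSum, ih]
    simp_rw [← ENNReal.tsum_mul_left]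
    symm
    rw [ENNReal.tsum_comm]
    refine tsum_congr fun μ => ?_
    rw [ENNReal.tsum_comm]
    refine tsum_congr fun ν => ?_
    rw [ENNReal.tsum_comm]
    refine tsum_congr fun k => ?_
    split_ifs
    · exact tsum_congr fun j => by ring
    · simp

theorem rowStep_congr (x : ℝ≥0∞) (y : ℕ → ℝ≥0∞) (N : ℕ) (F : (ℕ → ℕ) → ℝ≥0∞) {g g' : ℕ → ℕ}
    (h : ∀ j ≤ N, g j = g' j) : rowStep x y N F g = rowStep x y N F g' := by
  induction N generalizing F with
  | zero => rfl
  | succ N ih => simp only [rowStep, h (N + 1) le_rfl]; exact ih _ fun j hj => h j (by omega)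

/-- The first rows of the chain follow the recursion of last passage times, since the growth rule
makes the new first row the larger of its two neighbours plus the weight of the cell. -/
theorem tsum_pairSum (x : ℝ≥0∞) (y : ℕ → ℝ≥0∞) (N : ℕ) (H : ℕ → (ℕ → ℕ) → ℝ≥0∞)
    (lam : ℕ →₀ ℕ) :
    ∑' κ, pairSum x y N (H (κ 0)) lam κ =
      chainSum y N (rowStep x y N fun g => H (g N) g) lam := by
  classical
  induction N generalizing H lam with
  | zero =>
    simp only [pairSum, chainSum, rowStep]
    rw [tsum_eq_single 0 (fun κ hκ => by simp [hκ])]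
    simp
  | succ N ih =>
    have e : ∀ ν : ℕ →₀ ℕ,
        chainSum y N (fun g => rowStep x y (N + 1) (fun g => H (g (N + 1)) g)
          (Function.update g (N + 1) (lam 0))) ν =
        ∑' μ, ∑' k : ℕ, (x * y N) ^ k * pairSum x y N (fun g =>
          H (max (lam 0) (μ 0) + k) (Function.update g (N + 1) (max (lam 0) (μ 0) + k))) ν μ := by
      intro ν
      simp_rw [← pairSum_tsum x y N _ (fun k g => H (max (lam 0) _ + k)
        (Function.update g (N + 1) (max (lam 0) _ + k)))]
      rw [ih (fun m g => ∑' k : ℕ, (x * y N) ^ k *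
        H (max (lam 0) m + k) (Function.update g (N + 1) (max (lam 0) m + k))) ν]
      congr 1
      funext g
      simp only [rowStep, Function.update_self]
      exact rowStep_congr _ _ _ _ fun j hj => Function.update_of_ne (by omega) _ _
    simp only [chainSum, e, pairSum]
    rw [ENNReal.tsum_comm]
    simp_rw [← ENNReal.tsum_mul_left]
    rw [ENNReal.tsum_comm (f := fun ν μ => ∑' k : ℕ, skewWt (y N) ν lam * ((x * y N) ^ k * _))]
    refine tsum_congr fun μ => ?_
    rw [ENNReal.tsum_comm]
    refine tsum_congr fun ν => ?_
    rw [ENNReal.tsum_comm]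
    refine tsum_congr fun k => ?_
    rw [tsum_eq_single (grow ν lam μ k) (fun κ hκ => if_neg hκ.symm), if_pos rfl, grow_zero,
      mul_assoc]

/-- The Schur function `s_κ(x₀, …, x_{M-1})`, as a sum over Gelfand–Tsetlin patterns. -/
def gtSum (x : ℕ → ℝ≥0∞) : ℕ → (ℕ →₀ ℕ) → ℝ≥0∞
  | 0, κ => open Classical in if κ = 0 then 1 else 0
  | M + 1, κ => ∑' ν, skewWt (x M) ν κ * gtSum x M ν

/-- The unnormalized expectation of a function of the last passage times to the row `M`. -/
def rowIter (x y : ℕ → ℝ≥0∞) (N : ℕ) : ℕ → ((ℕ → ℕ) → ℝ≥0∞) → ℝ≥0∞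
  | 0, F => F (fun _ => 0)
  | M + 1, F => rowIter x y N M (rowStep (x M) y N F)

theorem chainSum_zero_right (y : ℕ → ℝ≥0∞) (N : ℕ) (F : (ℕ → ℕ) → ℝ≥0∞) :
    chainSum y N F 0 = F fun _ => 0 := by
  classical
  induction N generalizing F with
  | zero => simp [chainSum]
  | succ N ih =>
    simp only [chainSum, skewWt_zero_right]
    rw [tsum_eq_single 0 (fun κ hκ => by simp [hκ]), ih]
    simp only [if_true, one_mul]
    congr 1
    exact Function.update_eq_self (N + 1) fun _ => 0

/-- The Robinson–Schensted–Knuth correspondence: the joint law of the last passage times to the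
points of a row is that of the first rows in a Schur process. -/
theorem rowIter_eq (x y : ℕ → ℝ≥0∞) (N M : ℕ) (F : (ℕ → ℕ) → ℝ≥0∞) :
    rowIter x y N M F = ∑' κ, gtSum x M κ * chainSum y N F κ := by
  classical
  induction M generalizing F with
  | zero =>
    simp only [rowIter, gtSum]
    rw [tsum_eq_single 0 (fun κ hκ => by simp [hκ]), chainSum_zero_right]
    simp
  | succ M ih =>
    simp only [rowIter, ih, gtSum]
    simp_rw [← tsum_pairSum (x M) y N (fun _ => F), pairSum_eq, ← ENNReal.tsum_mul_left,
      ← ENNReal.tsum_mul_right]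
    rw [ENNReal.tsum_comm]
    exact tsum_congr fun κ => tsum_congr fun ν => by ring

theorem chainSum_const (y : ℕ → ℝ≥0∞) (N : ℕ) (c : ℝ≥0∞) (κ : ℕ →₀ ℕ) :
    chainSum y N (fun _ => c) κ = c * gtSum y N κ := by
  induction N generalizing κ with
  | zero => simp [chainSum, gtSum]
  | succ N ih =>
    simp only [chainSum, gtSum, ih, ← ENNReal.tsum_mul_left]
    exact tsum_congr fun ν => by ring

/-- The (unnormalized) distribution function of the last passage time to `(M, N)` is that of the
first row under the Schur measure. -/
theorem rowIter_le (x y : ℕ → ℝ≥0∞) (N M n : ℕ) :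
    rowIter x y N M (fun g => if g N ≤ n then 1 else 0) =
      ∑' κ : ℕ →₀ ℕ, if κ 0 ≤ n then gtSum x M κ * gtSum y N κ else 0 := by
  rw [rowIter_eq]
  refine tsum_congr fun κ => ?_
  rcases N with _ | N
  · simp only [chainSum, gtSum]
    split_ifs <;> simp_all
  · simp only [chainSum, Function.update_self, chainSum_const]
    simp only [gtSum]
    split_ifs <;> simp

/-! ### Schur polynomials and alternants -/

/-- The Schur polynomial of the partition with parts `u (M - 1) ≥ ⋯ ≥ u 0` in the variables
`x 0, …, x (M - 1)`, over any commutative semiring: the parts are listed in increasing order. -/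
def schurFin {R : Type*} [CommSemiring R] (x : ℕ → R) : (M : ℕ) → (Fin M → ℕ) → R
  | 0, _ => 1
  | M + 1, u => ∑ v ∈ Fintype.piFinset (fun b : Fin M => Finset.Icc (u b.castSucc) (u b.succ)),
      x M ^ (∑ b, u b - ∑ b, v b) * schurFin x M v

/-- The alternant `det [x_r^(u_b + b)]`. -/
def alternant {R : Type*} [CommRing R] (x : ℕ → R) (M : ℕ) (u : Fin M → ℕ) : R :=
  (Matrix.of fun r b : Fin M => x r ^ (u b + (b : ℕ))).det

theorem map_schurFin {R S : Type*} [CommSemiring R] [CommSemiring S] (f : R →+* S) (x : ℕ → R)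
    (M : ℕ) (u : Fin M → ℕ) : f (schurFin x M u) = schurFin (fun i => f (x i)) M u := by
  induction M with
  | zero => simp [schurFin]
  | succ M ih => simp [schurFin, ih]

/-- One variable is split off an alternant by subtracting multiples of adjacent columns. -/
theorem alternant_succ {R : Type*} [CommRing R] (x : ℕ → R) (M : ℕ) (u : Fin (M + 1) → ℕ)
    (hu : Monotone u) :
    alternant x (M + 1) u = ((-1) ^ M * ∏ r : Fin M, (x r - x M)) *
      ∑ v ∈ Fintype.piFinset (fun b : Fin M => Finset.Icc (u b.castSucc) (u b.succ)),
        x M ^ (∑ b, u b - ∑ b, v b) * alternant x M v := by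
  set z := x M with hz
  -- column `b + 1` minus `z ^ (u (b + 1) - u b + 1)` times column `b`; the geometric sum produces
  -- the interval of the branching rule, and the last row becomes `(z ^ u 0, 0, …, 0)`
  set B : Matrix (Fin (M + 1)) (Fin (M + 1)) R := Matrix.of fun r b =>
    Fin.cases (motive := fun _ => R) (x r ^ u 0) (fun b => (x r - z) *
      ∑ v ∈ Finset.Icc (u b.castSucc) (u b.succ), z ^ (u b.succ - v) * x r ^ (v + (b : ℕ))) b
    with hB
  have hAB : alternant x (M + 1) u = B.det := by
    refine Matrix.det_eq_of_forall_col_eq_smul_add_pred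
      (fun b : Fin M => z ^ (u b.succ - u b.castSucc + 1)) (fun r => by simp [hB]) fun r b => ?_
    have hle : u b.castSucc ≤ u b.succ := hu (Fin.castSucc_le_succ b)
    obtain ⟨d, hd⟩ := Nat.exists_eq_add_of_le hle
    simp only [hB, Matrix.of_apply, Fin.cases_succ, Fin.val_succ, Fin.val_castSucc]
    have hs : ∑ v ∈ Finset.Icc (u b.castSucc) (u b.succ), z ^ (u b.succ - v) * x r ^ (v + (b : ℕ)) =
        x r ^ (u b.castSucc + (b : ℕ)) *
          ∑ i ∈ Finset.range (d + 1), x r ^ i * z ^ (d + 1 - 1 - i) := by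
      rw [hd, ← Finset.Ico_add_one_right_eq_Icc, Finset.sum_Ico_eq_sum_range, Finset.mul_sum,
        show u b.castSucc + d + 1 - u b.castSucc = d + 1 by omega]
      refine Finset.sum_congr rfl fun i hi => ?_
      rw [show u b.castSucc + d - (u b.castSucc + i) = d + 1 - 1 - i by omega]
      ring
    rw [hs]
    have hg := geom_sum₂_mul (x r) z (d + 1)
    rw [show (x r - z) * (x r ^ (u b.castSucc + (b : ℕ)) *
        ∑ i ∈ Finset.range (d + 1), x r ^ i * z ^ (d + 1 - 1 - i)) =
        x r ^ (u b.castSucc + (b : ℕ)) *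
        ((∑ i ∈ Finset.range (d + 1), x r ^ i * z ^ (d + 1 - 1 - i)) * (x r - z)) by ring, hg, hd,
      show u b.castSucc + d - u b.castSucc + 1 = d + 1 by omega]
    ring
  rw [hAB, Matrix.det_succ_row B (Fin.last M), Fin.sum_univ_succ]
  have h0 : ∀ j : Fin M, B (Fin.last M) j.succ = 0 := fun j => by simp [hB, hz]
  simp only [h0, mul_zero, zero_mul, Finset.sum_const_zero, add_zero]
  have h1 : B (Fin.last M) 0 = z ^ u 0 := by simp [hB, hz]
  have h2 : (B.submatrix (Fin.last M).succAbove (Fin.succAbove 0)).det =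
      (∏ r : Fin M, (x r - z)) * ∑ v ∈ Fintype.piFinset
        (fun b : Fin M => Finset.Icc (u b.castSucc) (u b.succ)),
        (∏ b, z ^ (u b.succ - v b)) * alternant x M v := by
    have e : B.submatrix (Fin.last M).succAbove (Fin.succAbove 0) = Matrix.of fun r b : Fin M =>
        (x r - z) * (Matrix.of fun b r : Fin M => ∑ v ∈ Finset.Icc (u b.castSucc) (u b.succ),
          z ^ (u b.succ - v) * x r ^ (v + (b : ℕ))).transpose r b := by
      ext r b
      simp [hB]
    rw [e, Matrix.det_mul_column, Matrix.det_transpose]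
    congr 1
    have := (Matrix.detRowAlternating (R := R) (n := Fin M)).toMultilinearMap.map_sum_finset
      (fun (b : Fin M) (v : ℕ) => fun r : Fin M => z ^ (u b.succ - v) * x r ^ (v + (b : ℕ)))
      (fun b : Fin M => Finset.Icc (u b.castSucc) (u b.succ))
    simp only [AlternatingMap.coe_multilinearMap] at this
    refine Eq.trans ?_ (this.trans (Finset.sum_congr rfl fun v _ => ?_))
    · congr 1
      ext b r
      simp
    · rw [alternant, ← Matrix.det_transpose (Matrix.of _), ← Matrix.det_mul_column]
      rfl
  rw [h1, h2]
  simp only [Fin.val_last, Fin.val_zero, add_zero]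
  rw [mul_assoc, mul_assoc, ← mul_assoc (z ^ u 0), mul_comm (z ^ u 0), mul_assoc (∏ r : Fin M, _)]
  congr 2
  rw [Finset.mul_sum]
  refine Finset.sum_congr rfl fun v hv => ?_
  rw [Fintype.mem_piFinset] at hv
  rw [← mul_assoc, Finset.prod_pow_eq_pow_sum, ← pow_add]
  congr 2
  have : ∑ b : Fin M, (u b.succ - v b) + ∑ b, v b = ∑ b : Fin M, u b.succ := by
    rw [← Finset.sum_add_distrib]
    refine Finset.sum_congr rfl fun b _ => ?_
    have := Finset.mem_Icc.1 (hv b)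
    omega
  rw [Fin.sum_univ_succ u]
  omega

/-- The bialternant formula for Schur polynomials. -/
theorem schurFin_mul_vandermonde {R : Type*} [CommRing R] (x : ℕ → R) (M : ℕ) (u : Fin M → ℕ)
    (hu : Monotone u) :
    schurFin x M u * alternant x M 0 = alternant x M u := by
  induction M with
  | zero => simp [schurFin, alternant]
  | succ M ih =>
    have h0 := alternant_succ x M 0 fun _ _ _ => le_rfl
    have hs : Fintype.piFinset (fun b : Fin M => Finset.Icc ((0 : Fin (M + 1) → ℕ) b.castSucc)
        ((0 : Fin (M + 1) → ℕ) b.succ)) = {0} := by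
      ext v
      simp [funext_iff]
    rw [hs, Finset.sum_singleton] at h0
    rw [h0, alternant_succ x M u hu, schurFin, Finset.sum_mul, Finset.mul_sum]
    refine Finset.sum_congr rfl fun v hv => ?_
    rw [Fintype.mem_piFinset] at hv
    have hv' : Monotone v := by
      intro b c hbc
      rcases hbc.lt_or_eq with h | rfl
      · exact (Finset.mem_Icc.1 (hv b)).2.trans ((hu (by
          rw [Fin.le_def, Fin.val_succ, Fin.val_castSucc]; exact h)).trans
            (Finset.mem_Icc.1 (hv c)).1)
      · rfl
    rw [← ih v hv']
    simp
    ring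

theorem alternant_zero_eq_vandermonde {R : Type*} [CommRing R] (x : ℕ → R) (M : ℕ) :
    alternant x M 0 = (Matrix.vandermonde fun r : Fin M => x r).det := by
  simp [alternant, Matrix.vandermonde]

/-- Schur polynomials do not change when the order of the variables is reversed. -/
theorem schurFin_rev {R : Type*} [CommRing R] (x : ℕ → R) (M : ℕ) (u : Fin M → ℕ)
    (hu : Monotone u) :
    schurFin (fun i => x (M - 1 - i)) M u = schurFin x M u := by
  -- The universal case: the variables of a polynomial ring, a domain.
  have key : schurFin (fun i => (MvPolynomial.X (M - 1 - i) : MvPolynomial ℕ ℤ)) M u =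
      schurFin (fun i => MvPolynomial.X i) M u := by
    have e : ∀ v : Fin M → ℕ,
        alternant (fun i => (MvPolynomial.X (M - 1 - i) : MvPolynomial ℕ ℤ)) M v =
        ((Equiv.Perm.sign (Fin.revPerm (n := M)) : ℤ) : MvPolynomial ℕ ℤ) *
          alternant (fun i => MvPolynomial.X i) M v := by
      intro v
      unfold alternant
      rw [← Matrix.det_permute]
      congr 1
      ext1 r b
      simp only [Matrix.of_apply, Matrix.submatrix_apply, Fin.revPerm_apply, Fin.val_rev, id]
      rw [show M - 1 - (r : ℕ) = M - (r + 1) by omega]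
    have h1 := schurFin_mul_vandermonde
      (fun i => (MvPolynomial.X (M - 1 - i) : MvPolynomial ℕ ℤ)) M u hu
    have h2 := schurFin_mul_vandermonde (fun i => (MvPolynomial.X i : MvPolynomial ℕ ℤ)) M u hu
    rw [e, e, ← h2] at h1
    have hne : alternant (fun i => (MvPolynomial.X i : MvPolynomial ℕ ℤ)) M 0 ≠ 0 := by
      rw [alternant_zero_eq_vandermonde, Matrix.det_vandermonde_ne_zero_iff]
      exact fun i j h => Fin.ext (MvPolynomial.X_injective h)
    have hs : ((Equiv.Perm.sign (Fin.revPerm (n := M)) : ℤ) : MvPolynomial ℕ ℤ) ≠ 0 := by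
      rcases Int.units_eq_one_or (Equiv.Perm.sign (Fin.revPerm (n := M))) with h | h <;> simp [h]
    refine mul_right_cancel₀ (mul_ne_zero hs hne) ?_
    rw [h1]
    ring
  have := congrArg (MvPolynomial.eval₂Hom (Int.castRingHom R) x) key
  rw [map_schurFin, map_schurFin] at this
  simpa using this

/-! ### The Cauchy–Binet formula and the truncated Cauchy sum -/

/-- The first `N` terms of a sequence, in reverse order. -/
def revTake (N : ℕ) (κ : ℕ →₀ ℕ) (b : Fin N) : ℕ := κ (N - 1 - b)

/-- The sequence of length `N` whose terms are listed in reverse order by `u`. -/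
def revExtend (N : ℕ) (u : Fin N → ℕ) : ℕ →₀ ℕ :=
  Finsupp.ofSupportFinite (fun a => if h : a < N then u ⟨N - 1 - a, by omega⟩ else 0) <| by
    refine (Finset.range N).finite_toSet.subset fun a ha => ?_
    by_contra h
    simp at h
    simp [h] at ha

theorem revExtend_apply (N : ℕ) (u : Fin N → ℕ) (a : ℕ) :
    revExtend N u a = if h : a < N then u ⟨N - 1 - a, by omega⟩ else 0 := rfl

theorem revTake_revExtend (N : ℕ) (u : Fin N → ℕ) : revTake N (revExtend N u) = u := by
  ext b
  rw [revTake, revExtend_apply, dif_pos (by omega)]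
  congr 1
  ext
  simp only
  omega

theorem revExtend_revTake {N : ℕ} {κ : ℕ →₀ ℕ} (h : ∀ a, N ≤ a → κ a = 0) :
    revExtend N (revTake N κ) = κ := by
  ext a
  rw [revExtend_apply]
  split_ifs with ha
  · simp only [revTake]
    congr 1
    omega
  · exact (h a (by omega)).symm

theorem revExtend_eq_zero {N : ℕ} (u : Fin N → ℕ) : ∀ a, N ≤ a → revExtend N u a = 0 :=
  fun a ha => by rw [revExtend_apply, dif_neg (by omega)]

theorem revExtend_injective (N : ℕ) : Function.Injective (revExtend N) :=
  fun u v h => by rw [← revTake_revExtend N u, h, revTake_revExtend]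

theorem degree_eq_sum_revTake {N : ℕ} {κ : ℕ →₀ ℕ} (h : ∀ a, N ≤ a → κ a = 0) :
    κ.degree = ∑ b, revTake N κ b := by
  rw [Finsupp.degree_eq_sum_range h, Finset.sum_range, ← Equiv.sum_comp Fin.revPerm]
  refine Finset.sum_congr rfl fun b _ => ?_
  simp only [revTake, Fin.revPerm_apply, Fin.val_rev]
  congr 1
  omega

theorem tsum_eq_tsum_revExtend (N : ℕ) (F : (ℕ →₀ ℕ) → ℝ≥0∞)
    (hF : ∀ κ, (¬∀ a, N ≤ a → κ a = 0) → F κ = 0) :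
    ∑' κ, F κ = ∑' u, F (revExtend N u) := by
  refine ((revExtend_injective N).tsum_eq fun κ hκ => ?_).symm
  by_contra h
  refine hκ (hF κ fun h' => h ⟨revTake N κ, revExtend_revTake h'⟩)

open Classical in
/-- The Schur function, as a sum over Gelfand–Tsetlin patterns of `ℕ →₀ ℕ`, is the Schur polynomial
in as many variables; it vanishes if `κ` has more than `M` parts. -/
theorem gtSum_eq (x : ℕ → ℝ≥0∞) (M : ℕ) (κ : ℕ →₀ ℕ) :
    gtSum x M κ = if ∀ a, M ≤ a → κ a = 0 then schurFin x M (revTake M κ) else 0 := by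
  induction M generalizing κ with
  | zero =>
    have : κ = 0 ↔ ∀ a, 0 ≤ a → κ a = 0 := by simp [Finsupp.ext_iff]
    simp only [gtSum, schurFin, this]
  | succ M ih =>
    simp only [gtSum, ih]
    split_ifs with h
    · rw [tsum_eq_tsum_revExtend M _ fun ν hν => by rw [if_neg hν, mul_zero], schurFin]
      have hpi : ∀ v : Fin M → ℕ, v ∈ Fintype.piFinset (fun b : Fin M =>
          Finset.Icc (revTake (M + 1) κ b.castSucc) (revTake (M + 1) κ b.succ)) ↔
          Interlace (revExtend M v) κ := by
        intro v
        simp only [Fintype.mem_piFinset, Finset.mem_Icc, revTake, Fin.val_castSucc, Fin.val_succ]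
        constructor
        · intro hv a
          by_cases ha : a < M
          · have := hv ⟨M - 1 - a, by omega⟩
            rw [revExtend_apply, dif_pos ha]
            simpa only [show M + 1 - 1 - (M - 1 - a) = a + 1 by omega,
              show M + 1 - 1 - (M - 1 - a + 1) = a by omega] using this
          · rw [revExtend_apply, dif_neg ha, h (a + 1) (by omega)]
            simp
        · intro hv b
          have := hv (M - 1 - b)
          rw [revExtend_apply, dif_pos (by omega)] at this
          simpa only [show M + 1 - 1 - (b : ℕ) = M - 1 - b + 1 by omega,
            show M + 1 - 1 - (b + 1 : ℕ) = M - 1 - b by omega,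
            show M - 1 - (M - 1 - (b : ℕ)) = b by omega, Fin.eta] using this
      rw [tsum_eq_sum (s := Fintype.piFinset (fun b : Fin M =>
          Finset.Icc (revTake (M + 1) κ b.castSucc) (revTake (M + 1) κ b.succ)))
        fun v hv => by rw [skewWt, if_neg (fun hi => hv ((hpi v).2 hi)), zero_mul]]
      refine Finset.sum_congr rfl fun v hv => ?_
      rw [if_pos (revExtend_eq_zero v), revTake_revExtend, skewWt, if_pos ((hpi v).1 hv),
        degree_eq_sum_revTake h, degree_eq_sum_revTake (revExtend_eq_zero v), revTake_revExtend]
    · refine ENNReal.tsum_eq_zero.2 fun ν => ?_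
      split_ifs with hν
      · rw [skewWt, if_neg, zero_mul]
        intro hi
        refine h fun a ha => ?_
        obtain ⟨b, rfl⟩ : ∃ b, a = b + 1 := ⟨a - 1, by omega⟩
        have := (hi b).1
        rw [hν b (by omega)] at this
        omega
      · rw [mul_zero]

theorem schurFin_eq_zero {R : Type*} [CommSemiring R] (x : ℕ → R) (M : ℕ) {u : Fin M → ℕ}
    (hu : ¬Monotone u) : schurFin x M u = 0 := by
  rcases M with _ | M
  · exact absurd (fun a => a.elim0) hu
  · rw [Fin.monotone_iff_le_succ] at hu
    push Not at hu
    obtain ⟨b, hb⟩ := hu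
    refine Finset.sum_eq_zero fun v hv => ?_
    have := Finset.mem_Icc.1 (Fintype.mem_piFinset.1 hv b)
    omega

/-- A sum over all tuples which vanishes off the injective ones is a sum over increasing tuples
and permutations. -/
theorem sum_eq_sum_strictMono_perm {R α : Type*} [AddCommMonoid R] [LinearOrder α] [Fintype α]
    {n : ℕ} (F : (Fin n → α) → R) (hF : ∀ f, ¬Function.Injective f → F f = 0) :
    ∑ f, F f = open Classical in ∑ l : Fin n → α with StrictMono l,
      ∑ σ : Equiv.Perm (Fin n), F (l ∘ σ) := by
  classical
  rw [← Finset.sum_product', ← Finset.sum_filter_add_sum_filter_not _ Function.Injective,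
    Finset.sum_eq_zero (s := Finset.univ.filter fun f : Fin n → α => ¬Function.Injective f)
      fun f hf => hF f (Finset.mem_filter.1 hf).2, add_zero]
  symm
  refine Finset.sum_nbij (fun p => p.1 ∘ p.2) ?_ ?_ ?_ (fun _ _ => rfl)
  · rintro ⟨l, σ⟩ h
    simp only [Finset.mem_product, Finset.mem_filter, Finset.mem_univ, true_and, and_true] at h ⊢
    exact h.injective.comp σ.injective
  · rintro ⟨l, σ⟩ h ⟨l', σ'⟩ h' e
    simp only [Finset.coe_product, Finset.coe_filter, Finset.mem_univ, true_and, Set.mem_prod,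
      Set.mem_ofPred_eq, Finset.coe_univ, Set.mem_univ, and_true] at h h' e
    have hl : l = l' := by
      refine (StrictMono.range_inj h h').1 ?_
      rw [← σ.surjective.range_comp l, e, σ'.surjective.range_comp]
    subst hl
    refine Prod.ext rfl (Equiv.ext fun i => h.injective (congrFun e i))
  · intro f hf
    simp only [Finset.coe_filter, Finset.mem_univ, true_and, Set.mem_ofPred_eq] at hf
    refine ⟨(f ∘ Tuple.sort f, (Tuple.sort f)⁻¹), ?_, ?_⟩
    · simp only [Finset.coe_product, Finset.coe_filter, Finset.mem_univ, true_and, Set.mem_prod,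
        Set.mem_ofPred_eq, Finset.coe_univ, Set.mem_univ, and_true]
      exact (Tuple.monotone_sort f).strictMono_of_injective (hf.comp (Tuple.sort f).injective)
    · ext i
      simp

theorem det_mul_transpose_eq_sum_prod {R : Type*} [CommRing R] {n m : ℕ}
    (A B : Matrix (Fin n) (Fin m) R) :
    (A * B.transpose).det = ∑ f : Fin n → Fin m, (∏ i, A i (f i)) * (B.submatrix id f).det := by
  classical
  have := (Matrix.detRowAlternating (R := R) (n := Fin n)).toMultilinearMap.map_sum_finset
    (fun (i : Fin n) (k : Fin m) => fun j : Fin n => A i k * B j k) (fun _ => Finset.univ)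
  simp only [AlternatingMap.coe_multilinearMap, Fintype.piFinset_univ] at this
  refine Eq.trans ?_ (this.trans (Finset.sum_congr rfl fun f _ => ?_))
  · congr 1
    ext i j
    simp [Matrix.mul_apply]
  · rw [← Matrix.det_transpose (B.submatrix id f), ← Matrix.det_mul_column]
    rfl

/-- The **Cauchy–Binet formula**. -/
theorem det_mul_transpose_eq_sum {R : Type*} [CommRing R] {n m : ℕ}
    (A B : Matrix (Fin n) (Fin m) R) :
    (A * B.transpose).det = open Classical in ∑ l : Fin n → Fin m with StrictMono l,
      (A.submatrix id l).det * (B.submatrix id l).det := by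
  classical
  rw [det_mul_transpose_eq_sum_prod, sum_eq_sum_strictMono_perm]
  · refine Finset.sum_congr rfl fun l _ => ?_
    rw [← Matrix.det_transpose (A.submatrix id l), Matrix.det_apply', Finset.sum_mul]
    refine Finset.sum_congr rfl fun σ _ => ?_
    have : B.submatrix id (l ∘ σ) = (B.submatrix id l).submatrix id σ := rfl
    rw [this, Matrix.det_permute']
    simp only [Matrix.transpose_apply, Matrix.submatrix_apply, id, Function.comp]
    ring
  · intro f hf
    rw [Function.Injective] at hf
    push Not at hf
    obtain ⟨i, j, hij, hne⟩ := hf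
    rw [Matrix.det_zero_of_column_eq hne fun k => by simp [hij], mul_zero]

theorem StrictMono.add_sub_le {N : ℕ} {l : Fin N → ℕ} (hl : StrictMono l) {b c : Fin N}
    (h : b ≤ c) : l b + (c - b) ≤ l c := by
  obtain ⟨d, hd⟩ := Nat.exists_eq_add_of_le (Fin.le_def.1 h)
  induction d generalizing c with
  | zero =>
    have : b = c := Fin.ext (by omega)
    subst this
    omega
  | succ d ih =>
    have h1 := ih (c := ⟨b + d, by omega⟩) (Fin.le_def.2 (by simp)) rfl
    have h2 : l ⟨b + d, by omega⟩ < l c := hl (Fin.lt_def.2 (by simp only; omega))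
    simp only at h1
    omega

/-- The sum of `s_κ(x) s_κ(y)` over the partitions `κ` with at most `N` parts, all at most `n`. -/
def schurPairSum {R : Type*} [CommSemiring R] (x y : ℕ → R) (N n : ℕ) : R :=
  open Classical in ∑ u ∈ Fintype.piFinset (fun _ : Fin N => Finset.range (n + 1)) with Monotone u,
    schurFin x N u * schurFin y N u

theorem map_schurPairSum {R S : Type*} [CommSemiring R] [CommSemiring S] (f : R →+* S)
    (x y : ℕ → R) (N n : ℕ) :
    f (schurPairSum x y N n) = schurPairSum (fun i => f (x i)) (fun i => f (y i)) N n := by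
  simp [schurPairSum, map_schurFin]

theorem schurPairSum_rev {R : Type*} [CommRing R] (x y : ℕ → R) (N n : ℕ) :
    schurPairSum (fun i => x (N - 1 - i)) y N n = schurPairSum x y N n := by
  classical
  refine Finset.sum_congr rfl fun u hu => ?_
  rw [schurFin_rev x N u (Finset.mem_filter.1 hu).2]

/-- The truncated Cauchy sum is a determinant, by the bialternant formula and Cauchy–Binet; the
strictly increasing tuples below `n + N` are the partitions in the sum, shifted by a staircase. -/
theorem schurPairSum_mul_vandermonde {R : Type*} [CommRing R] (x y : ℕ → R) (N n : ℕ) :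
    schurPairSum x y N n * (alternant x N 0 * alternant y N 0) =
      (Matrix.of fun i j : Fin N => ∑ l ∈ Finset.range (n + N), (x i * y j) ^ l).det := by
  classical
  have hm : (Matrix.of fun i j : Fin N => ∑ l ∈ Finset.range (n + N), (x i * y j) ^ l) =
      (Matrix.of fun (i : Fin N) (l : Fin (n + N)) => x i ^ (l : ℕ)) *
        (Matrix.of fun (i : Fin N) (l : Fin (n + N)) => y i ^ (l : ℕ)).transpose := by
    ext i j
    simp [Matrix.mul_apply, Finset.sum_range, mul_pow]
  rw [hm, det_mul_transpose_eq_sum, schurPairSum, Finset.sum_mul]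
  symm
  -- the subtraction does not truncate, since `l b ≥ b` for strictly increasing `l`
  refine Finset.sum_bij' (fun l _ => fun b => (l b : ℕ) - b)
    (fun u hu => fun b => ⟨u b + b, ?_⟩) ?_ ?_ ?_ ?_ ?_
  · have := Fintype.mem_piFinset.1 (Finset.mem_filter.1 hu).1 b
    rw [Finset.mem_range] at this
    omega
  · intro l hl
    have hl' : StrictMono fun b => (l b : ℕ) := fun b c h =>
      Fin.lt_def.1 ((Finset.mem_filter.1 hl).2 h)
    refine Finset.mem_filter.2 ⟨Fintype.mem_piFinset.2 fun b => Finset.mem_range.2 ?_, ?_⟩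
    · have := hl'.add_sub_le (b := b) (c := ⟨N - 1, Nat.sub_lt b.pos one_pos⟩)
        (Fin.le_def.2 (by simp only; omega))
      have h2 := (l ⟨N - 1, Nat.sub_lt b.pos one_pos⟩).2
      simp only at this
      omega
    · intro b c h
      have := hl'.add_sub_le h
      rw [Fin.le_def] at h
      simp only at this ⊢
      omega
  · intro u hu
    refine Finset.mem_filter.2 ⟨Finset.mem_univ _, fun b c h => ?_⟩
    have := (Finset.mem_filter.1 hu).2 h.le
    rw [Fin.lt_def] at h ⊢
    simp only
    omega
  · intro l hl
    have hl' : StrictMono fun b => (l b : ℕ) := fun b c h =>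
      Fin.lt_def.1 ((Finset.mem_filter.1 hl).2 h)
    ext b
    have := hl'.add_sub_le (b := ⟨0, b.pos⟩) (c := b) (Fin.le_def.2 (by simp))
    simp only at this ⊢
    omega
  · intro u hu
    ext b
    simp
  · intro l hl
    have hl' : StrictMono fun b => (l b : ℕ) := fun b c h =>
      Fin.lt_def.1 ((Finset.mem_filter.1 hl).2 h)
    have hm : Monotone fun b : Fin N => (l b : ℕ) - (b : ℕ) := by
      intro b c h
      have := hl'.add_sub_le h
      rw [Fin.le_def] at h
      simp only at this ⊢
      omega
    have e : ∀ z : ℕ → R, alternant z N (fun b => (l b : ℕ) - (b : ℕ)) =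
        ((Matrix.of fun (i : Fin N) (l : Fin (n + N)) => z i ^ (l : ℕ)).submatrix id l).det := by
      intro z
      unfold alternant
      congr 1
      ext r b
      have := hl'.add_sub_le (b := ⟨0, b.pos⟩) (c := b) (Fin.le_def.2 (by simp))
      simp only at this
      simp only [Matrix.of_apply, Matrix.submatrix_apply, id]
      congr 1
      omega
    rw [← e, ← e, ← schurFin_mul_vandermonde x N _ hm, ← schurFin_mul_vandermonde y N _ hm]
    ring

/-- The unnormalized distribution function of the last passage time through a square is a finite
sum. -/
theorem rowIter_eq_schurPairSum (x y : ℕ → ℝ≥0∞) (N n : ℕ) :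
    rowIter x y N N (fun g => if g N ≤ n then 1 else 0) = schurPairSum x y N n := by
  classical
  rw [rowIter_le, tsum_eq_tsum_revExtend N]
  · simp only [gtSum_eq, if_pos (revExtend_eq_zero _), revTake_revExtend]
    rw [schurPairSum, tsum_eq_sum (s := (Fintype.piFinset (fun _ : Fin N =>
      Finset.range (n + 1))).filter Monotone)]
    · refine Finset.sum_congr rfl fun u hu => if_pos ?_
      rw [revExtend_apply]
      split_ifs with h
      · have := Fintype.mem_piFinset.1 (Finset.mem_filter.1 hu).1 ⟨N - 1 - 0, by omega⟩
        rw [Finset.mem_range] at this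
        omega
      · omega
    · intro u hu
      split_ifs with h
      · by_cases hm : Monotone u
        · refine absurd (Finset.mem_filter.2 ⟨Fintype.mem_piFinset.2 fun b =>
            Finset.mem_range.2 ?_, hm⟩) hu
          rw [revExtend_apply, dif_pos b.pos] at h
          have : u b ≤ u ⟨N - 1 - 0, Nat.sub_lt b.pos one_pos⟩ :=
            hm (Fin.le_def.2 (by simp only; omega))
          omega
        · rw [schurFin_eq_zero x N hm, zero_mul]
      · rfl
  · intro κ hκ
    simp [gtSum_eq, hκ]

/-! ### Last passage times and the Schur measure -/

/-- The last passage time from `(0, 0)` to `(i - 1, j - 1)`: it is the length of the longest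
directed path, and zero if `i = 0` or `j = 0`. -/
def lpp (v : ℕ × ℕ → ℕ) : ℕ → ℕ → ℕ
  | 0 => fun _ => 0
  | i + 1 => Nat.rec 0 fun j r => max (lpp v i (j + 1)) r + v (i, j)

@[simp] theorem lpp_zero_left (v : ℕ × ℕ → ℕ) (j : ℕ) : lpp v 0 j = 0 := rfl

@[simp] theorem lpp_zero_right (v : ℕ × ℕ → ℕ) (i : ℕ) : lpp v i 0 = 0 := by cases i <;> rfl

theorem lpp_succ (v : ℕ × ℕ → ℕ) (i j : ℕ) :
    lpp v (i + 1) (j + 1) = max (lpp v i (j + 1)) (lpp v (i + 1) j) + v (i, j) := rfl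

theorem lpp_congr {v v' : ℕ × ℕ → ℕ} {M N : ℕ} (h : ∀ a < M, ∀ b < N, v (a, b) = v' (a, b)) :
    lpp v M N = lpp v' M N := by
  induction M generalizing N with
  | zero => rfl
  | succ M ihM =>
    induction N with
    | zero => rfl
    | succ N ihN =>
      rw [lpp_succ, lpp_succ, ihN fun a ha b hb => h a ha b (by omega),
        ihM fun a ha b hb => h a (by omega) b hb, h M (by omega) N (by omega)]

theorem measurable_lpp {Ω : Type*} [MeasurableSpace Ω] {w : ℕ × ℕ → Ω → ℕ}
    (hw : ∀ p, Measurable (w p)) (i j : ℕ) : Measurable fun ω => lpp (fun p => w p ω) i j := by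
  induction i generalizing j with
  | zero => exact measurable_const
  | succ i ihi =>
    induction j with
    | zero => exact measurable_const
    | succ j ihj =>
      simp only [lpp_succ]
      exact ((ihi _).max ihj).add (hw _)

/-- The terms of index at most `k` of a sequence. -/
def truncSeq (k : ℕ) (g : ℕ → ℕ) (j : ℕ) : ℕ := if j ≤ k then g j else 0

/-- Integrating out a geometric random variable that is independent of the others. -/
theorem lintegral_indep_geom {Ω β : Type*} [MeasurableSpace Ω] {P : Measure Ω}
    [IsProbabilityMeasure P] [MeasurableSpace β] [Countable β] [MeasurableSingletonClass β]
    {X : Ω → ℕ} {Y : Ω → β} (hX : Measurable X) (hY : Measurable Y) (h : IndepFun Y X P) {p : ℝ}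
    (hp : IsGeom P X p) (H : β → ℕ → ℝ≥0∞) :
    ∫⁻ ω, H (Y ω) (X ω) ∂P = ∫⁻ ω, ∑' r : ℕ, ENNReal.ofReal ((1 - p) * p ^ r) * H (Y ω) r ∂P := by
  have h1 : ∫⁻ ω, H (Y ω) (X ω) ∂P = ∫⁻ z, H z.1 z.2 ∂(P.map fun ω => (Y ω, X ω)) := by
    rw [lintegral_map (f := fun z : β × ℕ => H z.1 z.2) (measurable_of_countable _)
      (hY.prodMk hX)]
  have h2 : ∫⁻ ω, ∑' r : ℕ, ENNReal.ofReal ((1 - p) * p ^ r) * H (Y ω) r ∂P =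
      ∫⁻ z, ∑' r : ℕ, ENNReal.ofReal ((1 - p) * p ^ r) * H z r ∂(P.map Y) := by
    rw [lintegral_map (f := fun z : β => ∑' r : ℕ, ENNReal.ofReal ((1 - p) * p ^ r) * H z r)
      (measurable_of_countable _) hY]
  have : IsProbabilityMeasure (P.map X) := Measure.isProbabilityMeasure_map hX.aemeasurable
  have : IsProbabilityMeasure (P.map Y) := Measure.isProbabilityMeasure_map hY.aemeasurable
  rw [h1, h2, (indepFun_iff_map_prod_eq_prod_map_map hY.aemeasurable hX.aemeasurable).1 h,
    lintegral_prod (fun z : β × ℕ => H z.1 z.2) (measurable_of_countable _).aemeasurable]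
  refine lintegral_congr fun z => ?_
  rw [lintegral_countable']
  refine tsum_congr fun r => ?_
  rw [Measure.map_apply hX (measurableSet_singleton r), mul_comm]
  congr 1
  exact hp r

/-- A field of independent geometric weights with parameters `x_i y_j`. -/
structure IsProductGeoField {Ω : Type*} [MeasurableSpace Ω] (P : Measure Ω) (w : ℕ × ℕ → Ω → ℕ)
    (x y : ℕ → ℝ) : Prop where
  measurable : ∀ p, Measurable (w p)
  indep : iIndepFun w P
  law : ∀ i j, IsGeom P (w (i, j)) (x i * y j)

section Law

variable {Ω : Type*} [MeasurableSpace Ω] {P : Measure Ω} [IsProbabilityMeasure P]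
  {w : ℕ × ℕ → Ω → ℕ} {x y : ℕ → ℝ}

/-- The weights of one row, up to column `k`, are integrated out one after another, from right to
left. -/
theorem lintegral_lpp_row (hw : IsProductGeoField P w x y) (hx : ∀ i, 0 ≤ x i) (hy : ∀ j, 0 ≤ y j)
    (hxy : ∀ i j, x i * y j < 1) (M N k : ℕ) (hk : k ≤ N) (H : (ℕ → ℕ) → (ℕ → ℕ) → ℝ≥0∞) :
    ∫⁻ ω, H (truncSeq N (lpp (fun p => w p ω) M)) (truncSeq k (lpp (fun p => w p ω) (M + 1))) ∂P =
      (∏ j ∈ Finset.range k, ENNReal.ofReal (1 - x M * y j)) *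
      ∫⁻ ω, rowStep (ENNReal.ofReal (x M)) (fun j => ENNReal.ofReal (y j)) k
        (H (truncSeq N (lpp (fun p => w p ω) M))) (truncSeq N (lpp (fun p => w p ω) M)) ∂P := by
  classical
  induction k generalizing H with
  | zero =>
    simp only [rowStep, Finset.range_zero, Finset.prod_empty, one_mul]
    refine lintegral_congr fun ω => ?_
    congr 1
    funext j
    unfold truncSeq
    split_ifs with h
    · rw [Nat.le_zero.1 h, lpp_zero_right]
    · rfl
  | succ k ih =>
    -- the cells that determine the other last passage times, without the cell `(M, k)`
    set S : Finset (ℕ × ℕ) := Finset.range M ×ˢ Finset.range N ∪ {M} ×ˢ Finset.range k with hS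
    set Y : Ω → (S → ℕ) := fun ω p => w p ω with hY
    set ext : (S → ℕ) → ℕ × ℕ → ℕ := fun u p => if h : p ∈ S then u ⟨p, h⟩ else 0 with hext
    have hYm : Measurable Y := measurable_pi_lambda _ fun p => hw.measurable p
    have hind : IndepFun Y (w (M, k)) P := by
      have := hw.indep.indepFun_finset S {(M, k)} (by simp [hS]) hw.measurable
      exact this.comp measurable_id (measurable_pi_apply
        (⟨(M, k), Finset.mem_singleton_self _⟩ : ({(M, k)} : Finset (ℕ × ℕ))))
    have hr : ∀ ω, truncSeq N (lpp (fun p => w p ω) M) = truncSeq N (lpp (ext (Y ω)) M) := by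
      intro ω
      funext j
      unfold truncSeq
      split_ifs with h
      · refine lpp_congr fun a ha b hb => ?_
        have : (a, b) ∈ S := by simp [hS]; omega
        simp [hext, hY, this]
      · rfl
    have hr' : ∀ ω, truncSeq k (lpp (fun p => w p ω) (M + 1)) =
        truncSeq k (lpp (ext (Y ω)) (M + 1)) := by
      intro ω
      funext j
      unfold truncSeq
      split_ifs with h
      · refine lpp_congr fun a ha b hb => ?_
        have : (a, b) ∈ S := by simp [hS]; omega
        simp [hext, hY, this]
      · rfl
    have hstep : ∀ ω, truncSeq (k + 1) (lpp (fun p => w p ω) (M + 1)) =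
        Function.update (truncSeq k (lpp (fun p => w p ω) (M + 1))) (k + 1)
          (max (truncSeq N (lpp (fun p => w p ω) M) (k + 1))
            (truncSeq k (lpp (fun p => w p ω) (M + 1)) k) + w (M, k) ω) := by
      intro ω
      funext j
      by_cases hj : j = k + 1
      · subst hj
        simp [truncSeq, lpp_succ, hk]
      · rw [Function.update_of_ne hj]
        unfold truncSeq
        have : j ≤ k + 1 ↔ j ≤ k := by omega
        simp [this]
    have hstep2 := lintegral_indep_geom (hw.measurable (M, k)) hYm hind (hw.law M k)
      (fun u r => H (truncSeq N (lpp (ext u) M))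
        (Function.update (truncSeq k (lpp (ext u) (M + 1))) (k + 1)
          (max (truncSeq N (lpp (ext u) M) (k + 1))
            (truncSeq k (lpp (ext u) (M + 1)) k) + r)))
    simp only [← hr, ← hr', ← hstep] at hstep2
    rw [hstep2]
    have hgeo : ∀ r : ℕ, ENNReal.ofReal ((1 - x M * y k) * (x M * y k) ^ r) =
        ENNReal.ofReal (1 - x M * y k) * (ENNReal.ofReal (x M) * ENNReal.ofReal (y k)) ^ r := by
      intro r
      rw [ENNReal.ofReal_mul (by linarith [hxy M k]), ENNReal.ofReal_pow (mul_nonneg (hx M) (hy k)),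
        ENNReal.ofReal_mul (hx M)]
    simp only [hgeo, mul_assoc]
    simp only [ENNReal.tsum_mul_left]
    rw [lintegral_const_mul' _ _ ENNReal.ofReal_ne_top, ih (by omega) fun g g' => ∑' r : ℕ,
      (ENNReal.ofReal (x M) * ENNReal.ofReal (y k)) ^ r *
        H g (Function.update g' (k + 1) (max (g (k + 1)) (g' k) + r)), Finset.prod_range_succ]
    simp only [rowStep]
    ring

/-- The expectation of a function of the last passage times to a row, as an iterated sum. -/
theorem lintegral_lpp (hw : IsProductGeoField P w x y) (hx : ∀ i, 0 ≤ x i) (hy : ∀ j, 0 ≤ y j)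
    (hxy : ∀ i j, x i * y j < 1) (M N : ℕ) (F : (ℕ → ℕ) → ℝ≥0∞) :
    ∫⁻ ω, F (truncSeq N (lpp (fun p => w p ω) M)) ∂P =
      (∏ i ∈ Finset.range M, ∏ j ∈ Finset.range N, ENNReal.ofReal (1 - x i * y j)) *
      rowIter (fun i => ENNReal.ofReal (x i)) (fun j => ENNReal.ofReal (y j)) N M F := by
  induction M generalizing F with
  | zero =>
    have : truncSeq N (fun _ => 0) = fun _ => 0 := by funext j; simp [truncSeq]
    simp [rowIter, lpp, this]
  | succ M ih =>
    rw [lintegral_lpp_row hw hx hy hxy M N N le_rfl fun _ => F, ih, rowIter,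
      Finset.prod_range_succ]
    ring

/-- The distribution function of the last passage time through a square. -/
theorem measure_lpp_le (hw : IsProductGeoField P w x y) (hx : ∀ i, 0 ≤ x i) (hy : ∀ j, 0 ≤ y j)
    (hxy : ∀ i j, x i * y j < 1) (N n : ℕ) :
    P {ω | lpp (fun p => w p ω) N N ≤ n} = ENNReal.ofReal
      ((∏ i ∈ Finset.range N, ∏ j ∈ Finset.range N, (1 - x i * y j)) * schurPairSum x y N n) := by
  classical
  have h1 := lintegral_lpp hw hx hy hxy N N fun g => if g N ≤ n then 1 else 0
  rw [rowIter_eq_schurPairSum] at h1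
  have hm := measurable_lpp hw.measurable N N
  have h2 : ∫⁻ ω, (if truncSeq N (lpp (fun p => w p ω) N) N ≤ n then 1 else 0) ∂P =
      P {ω | lpp (fun p => w p ω) N N ≤ n} := by
    rw [← lintegral_indicator_one (measurableSet_le hm measurable_const)]
    refine lintegral_congr fun ω => ?_
    simp [Set.indicator_apply, truncSeq]
  have h0 : ∀ i j, 0 ≤ 1 - x i * y j := fun i j => by linarith [hxy i j]
  have hS : ENNReal.ofReal (schurPairSum x y N n) =
      schurPairSum (fun i => ENNReal.ofReal (x i)) (fun j => ENNReal.ofReal (y j)) N n := by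
    have e1 := map_schurPairSum ENNReal.ofNNRealHom (fun i => (x i).toNNReal)
      (fun i => (y i).toNNReal) N n
    have e2 := map_schurPairSum NNReal.toRealHom (fun i => (x i).toNNReal)
      (fun i => (y i).toNNReal) N n
    simp only [NNReal.coe_toRealHom, Real.coe_toNNReal _ (hx _), Real.coe_toNNReal _ (hy _)] at e2
    rw [← e2, ENNReal.ofReal_coe_nnreal]
    exact e1
  rw [← h2, h1,
    ENNReal.ofReal_mul (Finset.prod_nonneg fun i _ => Finset.prod_nonneg fun j _ => h0 i j),
    hS, ENNReal.ofReal_prod_of_nonneg fun i _ => Finset.prod_nonneg fun j _ => h0 i j]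
  congr 1
  exact Finset.prod_congr rfl fun i _ => (ENNReal.ofReal_prod_of_nonneg fun j _ => h0 i j).symm

end Law

/-! ### Infinite paths -/

theorem lpp_le_succ_left (v : ℕ × ℕ → ℕ) (i j : ℕ) : lpp v i j ≤ lpp v (i + 1) j := by
  cases j with
  | zero => simp
  | succ j => rw [lpp_succ]; omega

theorem lpp_le_succ_right (v : ℕ × ℕ → ℕ) (i j : ℕ) : lpp v i j ≤ lpp v i (j + 1) := by
  cases i with
  | zero => simp
  | succ i => rw [lpp_succ]; omega

theorem lpp_mono (v : ℕ × ℕ → ℕ) {i i' j j' : ℕ} (hi : i ≤ i') (hj : j ≤ j') :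
    lpp v i j ≤ lpp v i' j' :=
  (monotone_nat_of_le_succ (f := fun i => lpp v i j) (fun i => lpp_le_succ_left v i j) hi).trans
    (monotone_nat_of_le_succ (f := fun j => lpp v i' j) (fun j => lpp_le_succ_right v i' j) hj)

/-- The elementary steps of a directed path. -/
def IsStep (p p' : ℕ × ℕ) : Prop := p' = (p.1 + 1, p.2) ∨ p' = (p.1, p.2 + 1)

theorem sum_path_le_lpp (v : ℕ × ℕ → ℕ) (p : ℕ → ℕ × ℕ) (K : ℕ)
    (hp : ∀ n < K, IsStep (p n) (p (n + 1))) :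
    ∑ m ∈ Finset.range (K + 1), v (p m) ≤ lpp v ((p K).1 + 1) ((p K).2 + 1) := by
  induction K with
  | zero => simp [lpp_succ]
  | succ K ih =>
    rw [Finset.sum_range_succ]
    have h1 := ih fun n hn => hp n (by omega)
    rcases hp K (by omega) with h | h <;> rw [h, lpp_succ] <;> simp only at * <;> omega

/-- The maximum in the definition of the last passage time is attained by a directed path. -/
theorem exists_path_eq_lpp (v : ℕ × ℕ → ℕ) (i j : ℕ) : ∃ p : ℕ → ℕ × ℕ, p 0 = (0, 0) ∧
    (∀ n < i + j, IsStep (p n) (p (n + 1))) ∧ p (i + j) = (i, j) ∧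
    ∑ m ∈ Finset.range (i + j + 1), v (p m) = lpp v (i + 1) (j + 1) := by
  obtain ⟨K, hK⟩ : ∃ K, i + j = K := ⟨_, rfl⟩
  induction K generalizing i j with
  | zero =>
    obtain ⟨rfl, rfl⟩ : i = 0 ∧ j = 0 := by omega
    exact ⟨fun _ => (0, 0), rfl, by simp, rfl, by simp [lpp_succ]⟩
  | succ K ih =>
    have key : ∀ i' j', i' + j' = K → IsStep (i', j') (i, j) →
        lpp v (i + 1) (j + 1) = lpp v (i' + 1) (j' + 1) + v (i, j) →
        ∃ p : ℕ → ℕ × ℕ, p 0 = (0, 0) ∧ (∀ n < i + j, IsStep (p n) (p (n + 1))) ∧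
          p (i + j) = (i, j) ∧ ∑ m ∈ Finset.range (i + j + 1), v (p m) = lpp v (i + 1) (j + 1) := by
      intro i' j' h1 h2 h3
      obtain ⟨p, hp0, hps, hpe, hsum⟩ := ih i' j' h1
      refine ⟨Function.update p (K + 1) (i, j), ?_, fun n hn => ?_, ?_, ?_⟩
      · rw [Function.update_of_ne (by omega), hp0]
      · rw [Function.update_of_ne (by omega)]
        rcases Nat.lt_or_ge n K with h | h
        · rw [Function.update_of_ne (by omega)]
          exact hps n (by omega)
        · obtain rfl : n = K := by omega
          rw [Function.update_self, ← h1, hpe]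
          exact h2
      · rw [hK, Function.update_self]
      · rw [hK, Finset.sum_range_succ, Function.update_self, h3, ← hsum, h1]
        congr 1
        refine Finset.sum_congr rfl fun m hm => ?_
        rw [Function.update_of_ne]
        have := Finset.mem_range.1 hm
        omega
    rcases le_total (lpp v i (j + 1)) (lpp v (i + 1) j) with h | h
    · rcases j with _ | j
      · obtain ⟨i', rfl⟩ : ∃ i', i = i' + 1 := ⟨i - 1, by omega⟩
        exact key i' 0 (by omega) (Or.inl rfl) (by rw [lpp_succ]; simp)
      · exact key i j (by omega) (Or.inr rfl) (by rw [lpp_succ, max_eq_right h])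
    · rcases i with _ | i
      · obtain ⟨j', rfl⟩ : ∃ j', j = j' + 1 := ⟨j - 1, by omega⟩
        exact key 0 j' (by omega) (Or.inr rfl) (by rw [lpp_succ]; simp)
      · exact key i j (by omega) (Or.inl rfl) (by rw [lpp_succ, max_eq_left h])

/-- The longest infinite down-left path is the limit of corner-to-corner paths through squares, as
every path to the corner of a square extends to an infinite path. -/
theorem lppDownLeft_eq_iSup (v : ℕ × ℕ → ℕ) : lppDownLeft v = ⨆ N : ℕ, (lpp v N N : ℝ≥0∞) := by
  refine le_antisymm (iSup_le fun π => ?_) (iSup_le fun N => ?_)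
  · rw [ENNReal.tsum_eq_iSup_nat]
    refine iSup_le fun K => ?_
    refine le_trans (Finset.sum_le_sum_of_subset (Finset.range_mono K.le_succ)) ?_
    have h := sum_path_le_lpp v π.pt K fun n _ => π.step n
    refine le_iSup_of_le (max ((π.pt K).1 + 1) ((π.pt K).2 + 1)) ?_
    exact_mod_cast h.trans (lpp_mono v (le_max_left _ _) (le_max_right _ _))
  · rcases N with _ | N
    · simp
    obtain ⟨p, hp0, hps, hpe, hsum⟩ := exists_path_eq_lpp v N N
    -- an optimal finite path is continued by a staircase
    let π : DownLeftPath :=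
      { pt := fun n => if n ≤ N + N then p n else
          (N + (n - (N + N) + 1) / 2, N + (n - (N + N)) / 2)
        start := by simp [hp0]
        step := fun n => by
          rcases Nat.lt_trichotomy n (N + N) with h | h | h
          · rw [if_pos h.le, if_pos (by omega)]
            exact hps n h
          · subst h
            rw [if_pos le_rfl, if_neg (by omega), hpe]
            left
            ext <;> simp
          · rw [if_neg (by omega), if_neg (by omega)]
            obtain ⟨d, rfl⟩ := Nat.exists_eq_add_of_lt h
            rcases Nat.even_or_odd' d with ⟨e, he | he⟩
            · right; ext <;> simp only <;> omega
            · left; ext <;> simp only <;> omega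
        stop_at := by
          refine tendsto_prod_iff'.2 ⟨?_, ?_⟩
          · refine tendsto_atTop.2 fun b => eventually_atTop.2 ⟨N + N + 2 * b + 1, fun n hn => ?_⟩
            rw [if_neg (by omega)]
            simp only
            omega
          · refine tendsto_atTop.2 fun b => eventually_atTop.2 ⟨N + N + 2 * b + 1, fun n hn => ?_⟩
            rw [if_neg (by omega)]
            simp only
            omega }
    refine le_iSup_of_le π ?_
    rw [← hsum]
    refine le_trans (le_of_eq ?_) (ENNReal.sum_le_tsum (Finset.range (N + N + 1)))
    push_cast
    refine Finset.sum_congr rfl fun m hm => ?_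
    have : m ≤ N + N := by have := Finset.mem_range.1 hm; omega
    simp [π, this]

/-- The reflection of the first `N` natural numbers. -/
def flipIdx (N i : ℕ) : ℕ := if i < N then N - 1 - i else i

theorem flipIdx_flipIdx (N i : ℕ) : flipIdx N (flipIdx N i) = i := by
  unfold flipIdx
  split_ifs <;> omega

/-- The weights, with the order of the first `N` rows reversed. -/
def flipRows (N : ℕ) (v : ℕ × ℕ → ℕ) (p : ℕ × ℕ) : ℕ := v (flipIdx N p.1, p.2)

theorem path_le_path {p : ℕ → ℕ × ℕ} {K : ℕ} (hp : ∀ n < K, IsStep (p n) (p (n + 1))) {m n : ℕ}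
    (hmn : m ≤ n) (hn : n ≤ K) : (p m).1 ≤ (p n).1 ∧ (p m).2 ≤ (p n).2 := by
  induction n, hmn using Nat.le_induction with
  | base => exact ⟨le_rfl, le_rfl⟩
  | succ n hmn ih =>
    have := ih (by omega)
    rcases hp n (by omega) with h | h <;> rw [h] <;> simp only <;> omega

/-- The longest bi-infinite down-right path is the limit of paths through squares between the other
pair of corners: reversing the order of the rows of the square turns them into directed paths. -/
theorem lppDownRight_eq_iSup (v : ℕ × ℕ → ℕ) :
    lppDownRight v = ⨆ N : ℕ, (lpp (flipRows N v) N N : ℝ≥0∞) := by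
  refine le_antisymm (iSup_le fun π => ?_) (iSup_le fun N => ?_)
  · rw [ENNReal.tsum_eq_iSup_sum]
    refine iSup_le fun s => ?_
    obtain ⟨K, hK⟩ : ∃ K : ℕ, ∀ m ∈ s, -(K : ℤ) ≤ m ∧ m ≤ K := by
      refine ⟨∑ m ∈ s, m.natAbs, fun m hm => ?_⟩
      have := Finset.single_le_sum (f := Int.natAbs) (fun _ _ => Nat.zero_le _) hm
      omega
    have hmono : ∀ m : ℕ, (π.pt (m - K)).1 ≤ (π.pt (-K)).1 := by
      intro m
      induction m with
      | zero => simp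
      | succ m ih =>
        have := π.step (m - K)
        rw [show (m : ℤ) - K + 1 = (m + 1 : ℕ) - K by push_cast; ring] at this
        rcases this with h | h
        · rw [h] at ih; simp only at ih; omega
        · rw [h]; exact ih
    -- a square that contains the piece of the path with times in `[-K, K]`
    set N := max ((π.pt (-K)).1 + 1) ((π.pt ((K + K : ℕ) - K : ℤ)).2 + 1) with hN
    have hlt : ∀ m : ℕ, (π.pt (m - K)).1 < N := fun m => by have := hmono m; omega
    have hs := sum_path_le_lpp (flipRows N v)
      (fun m => (N - 1 - (π.pt (m - K)).1, (π.pt (m - K)).2)) (K + K) (by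
        intro n _
        have := π.step (n - K)
        have h1 := hlt n
        have h2 := hlt (n + 1)
        rw [show (n : ℤ) - K + 1 = (n + 1 : ℕ) - K by push_cast; ring] at this
        rcases this with h | h
        · left
          have e1 := congrArg Prod.fst h
          have e2 := congrArg Prod.snd h
          ext <;> simp only at * <;> omega
        · right
          rw [h])
    have he : ∀ m : ℕ, flipRows N v (N - 1 - (π.pt (m - K)).1, (π.pt (m - K)).2) =
        v (π.pt (m - K)) := by
      intro m
      have := hlt m
      simp only [flipRows, flipIdx]
      rw [if_pos (by omega)]
      congr 1
      ext <;> simp only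
      omega
    simp only [he] at hs
    have hle : ∑ m ∈ s, (v (π.pt m) : ℝ≥0∞) ≤
        ∑ m ∈ Finset.range (K + K + 1), (v (π.pt (m - K)) : ℝ≥0∞) := by
      rw [← Finset.sum_image (s := Finset.range (K + K + 1)) (g := fun m : ℕ => (m : ℤ) - K)
        (f := fun m => (v (π.pt m) : ℝ≥0∞)) (fun a _ b _ h => by simpa using h)]
      refine Finset.sum_le_sum_of_subset fun m hm => Finset.mem_image.2 ⟨(m + K).toNat, ?_, ?_⟩
      · have := hK m hm
        rw [Finset.mem_range]
        omega
      · have := hK m hm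
        omega
    refine hle.trans (le_iSup_of_le N ?_)
    have h3 := hs.trans (lpp_mono (flipRows N v) (i' := N) (j' := N)
      (by have := hlt (K + K); omega) (le_max_right _ _))
    exact_mod_cast h3
  · rcases N with _ | k
    · simp
    obtain ⟨p, hp0, hps, hpe, hsum⟩ := exists_path_eq_lpp (flipRows (k + 1) v) k k
    have hle : ∀ m ≤ k + k, (p m).1 ≤ k ∧ (p m).2 ≤ k := fun m hm => by
      have := path_le_path hps hm le_rfl
      rwa [hpe] at this
    -- an optimal finite path is continued by rays along the two axes
    obtain ⟨f, hneg, hmid, hbig⟩ : ∃ f : ℤ → ℕ × ℕ, (∀ n : ℕ, f (-n) = (k + n, 0)) ∧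
        (∀ n : ℕ, n ≤ k + k → f n = (k - (p n).1, (p n).2)) ∧
        ∀ n : ℕ, k + k ≤ n → f n = (0, k + (n - (k + k))) := by
      refine ⟨fun m => if m < 0 then (k + (-m).toNat, 0) else if m ≤ k + k then
        (k - (p m.toNat).1, (p m.toNat).2) else (0, k + (m - (k + k)).toNat), fun n => ?_,
        fun n hn => ?_, fun n hn => ?_⟩ <;> dsimp only
      · rcases Nat.eq_zero_or_pos n with rfl | h
        · simp [hp0]
        · rw [if_pos (by omega)]
          ext <;> simp
      · rw [if_neg (by omega), if_pos (by omega), Int.toNat_natCast]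
      · rw [if_neg (by omega)]
        split_ifs with h
        · obtain rfl : n = k + k := by omega
          rw [Int.toNat_natCast, hpe]
          simp
        · ext <;> simp only
          omega
    let π : DownRightPath :=
      { pt := f
        step := fun m => by
          rcases lt_or_ge m 0 with h | h
          · left
            obtain ⟨n, rfl⟩ : ∃ n : ℕ, m = -((n + 1 : ℕ) : ℤ) := ⟨(-m - 1).toNat, by omega⟩
            rw [hneg, show -((n + 1 : ℕ) : ℤ) + 1 = -(n : ℤ) by push_cast; ring, hneg]
            rfl
          obtain ⟨n, rfl⟩ : ∃ n : ℕ, m = n := ⟨m.toNat, by omega⟩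
          rw [← Nat.cast_succ]
          rcases Nat.lt_or_ge n (k + k) with h | h
          · rw [hmid n h.le, hmid _ h]
            have h1 := hle n (by omega)
            have h2 := hle (n + 1) (by omega)
            rcases hps n h with h | h
            · left
              rw [h] at h2 ⊢
              ext <;> simp only at *
              omega
            · right; rw [h]
          · rw [hbig n h, hbig _ (by omega)]
            right
            ext <;> simp only
            omega
        start := by
          refine tendsto_prod_iff'.2 ⟨?_, ?_⟩
          · refine tendsto_atTop.2 fun b => eventually_atBot.2 ⟨-b, fun m hm => ?_⟩
            obtain ⟨n, rfl⟩ : ∃ n : ℕ, m = -(n : ℤ) := ⟨(-m).toNat, by omega⟩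
            rw [hneg]
            simp only
            omega
          · refine tendsto_pure.2 (eventually_atBot.2 ⟨0, fun m hm => ?_⟩)
            obtain ⟨n, rfl⟩ : ∃ n : ℕ, m = -(n : ℤ) := ⟨(-m).toNat, by omega⟩
            rw [hneg]
        stop_at := by
          refine tendsto_prod_iff'.2 ⟨?_, ?_⟩
          · refine tendsto_pure.2 (eventually_atTop.2 ⟨(k + k : ℕ), fun m hm => ?_⟩)
            obtain ⟨n, rfl⟩ : ∃ n : ℕ, m = n := ⟨m.toNat, by omega⟩
            rw [hbig n (by omega)]
          · refine tendsto_atTop.2 fun b => eventually_atTop.2 ⟨(k + k + b : ℕ), fun m hm => ?_⟩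
            obtain ⟨n, rfl⟩ : ∃ n : ℕ, m = n := ⟨m.toNat, by omega⟩
            rw [hbig n (by omega)]
            simp only
            omega }
    refine le_iSup_of_le π ?_
    refine le_trans ?_ (ENNReal.tsum_comp_le_tsum_of_injective (f := fun n : ℕ => (n : ℤ))
      Nat.cast_injective _)
    refine le_trans (le_of_eq ?_) (ENNReal.sum_le_tsum (Finset.range (k + k + 1)))
    rw [← hsum]
    push_cast
    refine Finset.sum_congr rfl fun m hm => ?_
    have hm' : m ≤ k + k := by have := Finset.mem_range.1 hm; omega
    have h1 := hle m hm'
    have h2 : π.pt m = (k - (p m).1, (p m).2) := hmid m hm'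
    rw [h2, flipRows, flipIdx, if_pos (by omega)]
    rfl

theorem lpp_flipRows_mono (v : ℕ × ℕ → ℕ) : Monotone fun N => lpp (flipRows N v) N N := by
  refine monotone_nat_of_le_succ fun N => ?_
  have key : ∀ i ≤ N, ∀ j, lpp (flipRows N v) i j ≤ lpp (flipRows (N + 1) v) (i + 1) j := by
    intro i
    induction i with
    | zero => simp
    | succ i ihi =>
      intro hi j
      induction j with
      | zero => simp
      | succ j ihj =>
        rw [lpp_succ, lpp_succ]
        have h1 := ihi (by omega) (j + 1)
        have h2 : flipRows N v (i, j) = flipRows (N + 1) v (i + 1, j) := by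
          simp only [flipRows, flipIdx]
          rw [if_pos (by omega), if_pos (by omega)]
          congr 2
          omega
        omega
  exact (key N le_rfl N).trans (lpp_le_succ_right _ _ _)

/-! ### Equality in law and finiteness -/

theorem schurFin_congr {R : Type*} [CommSemiring R] {x x' : ℕ → R} {M : ℕ}
    (h : ∀ i < M, x i = x' i) (u : Fin M → ℕ) : schurFin x M u = schurFin x' M u := by
  induction M with
  | zero => rfl
  | succ M ih =>
    simp only [schurFin, h M (by omega)]
    exact Finset.sum_congr rfl fun v _ => by rw [ih fun i hi => h i (by omega)]

theorem schurPairSum_flipIdx {R : Type*} [CommRing R] (x y : ℕ → R) (N n : ℕ) :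
    schurPairSum (fun i => x (flipIdx N i)) y N n = schurPairSum x y N n := by
  rw [← schurPairSum_rev x]
  refine Finset.sum_congr rfl fun u _ => ?_
  rw [schurFin_congr fun i hi => ?_]
  rw [flipIdx, if_pos hi]

section Law

variable {Ω : Type*} [MeasurableSpace Ω] {P : Measure Ω} {w : ℕ × ℕ → Ω → ℕ} {x y : ℕ → ℝ}

theorem IsProductGeoField.flip (hw : IsProductGeoField P w x y) (N : ℕ) :
    IsProductGeoField P (fun p => w (flipIdx N p.1, p.2)) (fun i => x (flipIdx N i)) y where
  measurable p := hw.measurable _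
  indep := hw.indep.precomp (g := fun p : ℕ × ℕ => (flipIdx N p.1, p.2)) fun p p' h => by
    simp only [Prod.mk.injEq] at h
    refine Prod.ext ?_ h.2
    rw [← flipIdx_flipIdx N p.1, h.1, flipIdx_flipIdx]
  law i j := hw.law _ _

variable [IsProbabilityMeasure P]

/-- Last passage times through a square from corner to corner have the same law for both pairs of
opposite corners. -/
theorem measure_lpp_flipRows_le (hw : IsProductGeoField P w x y) (hx : ∀ i, 0 ≤ x i)
    (hy : ∀ j, 0 ≤ y j) (hxy : ∀ i j, x i * y j < 1) (N n : ℕ) :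
    P {ω | lpp (flipRows N fun p => w p ω) N N ≤ n} = P {ω | lpp (fun p => w p ω) N N ≤ n} := by
  rw [measure_lpp_le hw hx hy hxy, ← schurPairSum_flipIdx]
  refine (measure_lpp_le (hw.flip N) (fun i => hx _) hy (fun i j => hxy _ j) N n).trans ?_
  congr 2
  rw [← Finset.prod_range_reflect]
  refine Finset.prod_congr rfl fun i hi => ?_
  have : N - 1 - i < N := by have := Finset.mem_range.1 hi; omega
  simp only [flipIdx, if_pos this]
  have : N - 1 - (N - 1 - i) = i := by have := Finset.mem_range.1 hi; omega
  rw [this]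

theorem measurable_lpp_flipRows (hw : ∀ p, Measurable (w p)) (N i j : ℕ) :
    Measurable fun ω => lpp (flipRows N fun p => w p ω) i j :=
  measurable_lpp (w := fun p => w (flipIdx N p.1, p.2)) (fun _ => hw _) i j

theorem measurable_lppDownLeft (hw : ∀ p, Measurable (w p)) :
    Measurable fun ω => lppDownLeft fun p => w p ω := by
  simp only [lppDownLeft_eq_iSup]
  exact .iSup fun N => (measurable_of_countable _).comp (measurable_lpp hw N N)

theorem measurable_lppDownRight (hw : ∀ p, Measurable (w p)) :
    Measurable fun ω => lppDownRight fun p => w p ω := by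
  simp only [lppDownRight_eq_iSup]
  exact .iSup fun N => (measurable_of_countable _).comp (measurable_lpp_flipRows hw N N N)

theorem tendsto_measure_iSup_le {X : ℕ → Ω → ℕ} (hX : ∀ N, Measurable (X N))
    (hmono : ∀ ω, Monotone fun N => X N ω) (n : ℕ) :
    Tendsto (fun N => P {ω | X N ω ≤ n}) atTop (𝓝 (P {ω | ⨆ N, (X N ω : ℝ≥0∞) ≤ n})) := by
  have h : {ω | ⨆ N, (X N ω : ℝ≥0∞) ≤ n} = ⋂ N, {ω | X N ω ≤ n} := by
    ext ω
    simp
  rw [h]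
  refine tendsto_measure_iInter_atTop
    (fun N => (measurableSet_le (hX N) measurable_const).nullMeasurableSet) ?_
    ⟨0, measure_ne_top _ _⟩
  intro N N' hN ω hω
  exact (hmono ω hN).trans hω

theorem tendsto_measure_lpp_le (hw : ∀ p, Measurable (w p)) (n : ℕ) :
    Tendsto (fun N => P {ω | lpp (fun p => w p ω) N N ≤ n}) atTop
      (𝓝 (P {ω | (lppDownLeft fun p => w p ω) ≤ n})) := by
  simp only [lppDownLeft_eq_iSup]
  exact tendsto_measure_iSup_le (fun N => measurable_lpp hw N N)
    (fun ω N N' h => lpp_mono _ h h) n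

theorem measure_lppDownRight_le (hw : IsProductGeoField P w x y) (hx : ∀ i, 0 ≤ x i)
    (hy : ∀ j, 0 ≤ y j) (hxy : ∀ i j, x i * y j < 1) (n : ℕ) :
    P {ω | (lppDownRight fun p => w p ω) ≤ n} = P {ω | (lppDownLeft fun p => w p ω) ≤ n} := by
  have h := tendsto_measure_iSup_le (P := P)
    (fun N => measurable_lpp_flipRows hw.measurable N N N)
    (fun ω => lpp_flipRows_mono fun p => w p ω) n
  simp only [← lppDownRight_eq_iSup, measure_lpp_flipRows_le hw hx hy hxy] at h
  exact tendsto_nhds_unique h (tendsto_measure_lpp_le hw.measurable n)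

theorem iSup_natCast_le_iff (X : ℕ → ℕ) {t : ℝ≥0∞} (ht : t ≠ ∞) :
    ⨆ N, (X N : ℝ≥0∞) ≤ t ↔ ⨆ N, (X N : ℝ≥0∞) ≤ (⌊t.toNNReal⌋₊ : ℕ) := by
  simp only [iSup_le_iff, Nat.cast_le]
  refine forall_congr' fun N => ?_
  rw [Nat.le_floor_iff zero_le]
  lift t to NNReal using ht
  rw [ENNReal.toNNReal_coe]
  exact_mod_cast Iff.rfl

/-- The longest down-left and the longest down-right path have the same law: this holds in every
square, and passes to the limit. -/
theorem identDistrib_lpp (hw : IsProductGeoField P w x y) (hx : ∀ i, 0 ≤ x i)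
    (hy : ∀ j, 0 ≤ y j) (hxy : ∀ i j, x i * y j < 1) :
    IdentDistrib (fun ω => lppDownLeft fun p => w p ω) (fun ω => lppDownRight fun p => w p ω)
      P P := by
  have h1 := measurable_lppDownLeft hw.measurable
  have h2 := measurable_lppDownRight hw.measurable
  refine ⟨h1.aemeasurable, h2.aemeasurable, ?_⟩
  have := Measure.isProbabilityMeasure_map (μ := P) h1.aemeasurable
  refine Measure.ext_of_Iic _ _ fun t => ?_
  rw [Measure.map_apply h1 measurableSet_Iic, Measure.map_apply h2 measurableSet_Iic]
  by_cases ht : t = ∞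
  · simp [ht]
  · have e := measure_lppDownRight_le hw hx hy hxy ⌊t.toNNReal⌋₊
    simp only [lppDownLeft_eq_iSup, lppDownRight_eq_iSup, ← iSup_natCast_le_iff _ ht] at e
    simp only [lppDownLeft_eq_iSup, lppDownRight_eq_iSup]
    exact e.symm

/-- The last passage time is bounded by the sum of all weights. -/
theorem lpp_le_tsum (v : ℕ × ℕ → ℕ) (i j : ℕ) : (lpp v i j : ℝ≥0∞) ≤ ∑' p, (v p : ℝ≥0∞) := by
  have key : lpp v i j ≤ ∑ a ∈ Finset.range i, ∑ b ∈ Finset.range j, v (a, b) := by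
    induction i generalizing j with
    | zero => simp
    | succ i ihi =>
      induction j with
      | zero => simp
      | succ j ihj =>
        rw [lpp_succ]
        have h1 := ihi (j + 1)
        have h2 : ∑ b ∈ Finset.range j, v (i, b) + v (i, j) =
          ∑ b ∈ Finset.range (j + 1), v (i, b) := (Finset.sum_range_succ _ _).symm
        have h3 : ∑ a ∈ Finset.range (i + 1), ∑ b ∈ Finset.range j, v (a, b) + v (i, j) ≤
            ∑ a ∈ Finset.range (i + 1), ∑ b ∈ Finset.range (j + 1), v (a, b) := by
          rw [Finset.sum_range_succ, Finset.sum_range_succ, add_assoc, h2]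
          exact Nat.add_le_add_right (Finset.sum_le_sum fun a _ =>
            Finset.sum_le_sum_of_subset (Finset.range_mono j.le_succ)) _
        have h4 : ∑ a ∈ Finset.range i, ∑ b ∈ Finset.range (j + 1), v (a, b) + v (i, j) ≤
            ∑ a ∈ Finset.range (i + 1), ∑ b ∈ Finset.range (j + 1), v (a, b) := by
          rw [Finset.sum_range_succ, ← h2]
          omega
        omega
  rw [← Finset.sum_product'] at key
  exact le_trans (by exact_mod_cast key) (ENNReal.sum_le_tsum (Finset.range i ×ˢ Finset.range j))

/-- By the Borel–Cantelli lemma only finitely many weights are nonzero. -/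
theorem ae_lppDownLeft_ne_top (hw : IsProductGeoField P w x y)
    (hsum : ∑' p : ℕ × ℕ, ENNReal.ofReal (x p.1 * y p.2) ≠ ∞) :
    ∀ᵐ ω ∂P, (lppDownLeft fun p => w p ω) ≠ ∞ := by
  have hP : ∀ p : ℕ × ℕ, P {ω | w p ω ≠ 0} ≤ ENNReal.ofReal (x p.1 * y p.2) := by
    intro p
    have h0 := hw.law p.1 p.2 0
    simp only [Prod.mk.eta, pow_zero, mul_one] at h0
    have hc : {ω | w p ω ≠ 0} = {ω | w p ω = 0}ᶜ := rfl
    have hm : MeasurableSet {ω | w p ω = 0} := hw.measurable p (measurableSet_singleton 0)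
    rw [hc, measure_compl hm (measure_ne_top _ _), h0, measure_univ, tsub_le_iff_right,
      ← ENNReal.ofReal_one]
    refine le_trans (le_of_eq ?_) ENNReal.ofReal_add_le
    congr 1
    ring
  have hfin := ae_finite_setOfPred_mem (μ := P) (s := fun p : ℕ × ℕ => {ω | w p ω ≠ 0})
    (ne_top_of_le_ne_top hsum (ENNReal.tsum_le_tsum hP))
  filter_upwards [hfin] with ω hω
  rw [lppDownLeft_eq_iSup]
  refine ne_top_of_le_ne_top ?_ (iSup_le fun N => lpp_le_tsum _ N N)
  rw [tsum_eq_sum (s := hω.toFinset) fun p hp => by simpa using hp]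
  exact ENNReal.sum_ne_top.2 fun p _ => ENNReal.natCast_ne_top _

end Law

/-- The row parameters `√a Q^(i + 1/2)`; for `Q̃` in place of `Q` they are the column parameters. -/
def rowParam (a q η : ℝ) (i : ℕ) : ℝ := √a * (q ^ η) ^ ((i : ℝ) + 1 - 1 / 2)

theorem rowParam_nonneg {a q : ℝ} (hq : 0 ≤ q) (η : ℝ) (i : ℕ) : 0 ≤ rowParam a q η i := by
  unfold rowParam
  positivity

theorem geoParam_eq {a : ℝ} (ha : 0 ≤ a) (q η θ : ℝ) (i j : ℕ) :
    geoParam a q η θ (i, j) = rowParam a q η i * rowParam a q θ j := by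
  have := Real.mul_self_sqrt ha
  simp only [geoParam, rowParam]
  linear_combination (-(q ^ η) ^ ((i : ℝ) + 1 - 1 / 2) * (q ^ θ) ^ ((j : ℝ) + 1 - 1 / 2)) * this

theorem IsGeoField.isProductGeoField {Ω : Type*} [MeasurableSpace Ω] {P : Measure Ω}
    {w : ℕ × ℕ → Ω → ℕ} {a q η θ : ℝ} (hw : IsGeoField P w a q η θ) (ha : 0 ≤ a) :
    IsProductGeoField P w (rowParam a q η) (rowParam a q θ) where
  measurable := hw.measurable
  indep := hw.indep
  law i j := by rw [← geoParam_eq ha]; exact hw.law (i, j)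

theorem rowParam_le_pow {a q η : ℝ} (ha : a ≤ 1) (hq : 0 ≤ q) (hq1 : q < 1) (hη : 0 < η) (i : ℕ) :
    rowParam a q η i ≤ (q ^ η) ^ i := by
  have h1 : √a ≤ 1 := Real.sqrt_le_one.2 ha
  have h2 : (q ^ η) ^ ((i : ℝ) + 1 - 1 / 2) ≤ (q ^ η) ^ (i : ℝ) :=
    Real.rpow_le_rpow_of_exponent_ge' (by positivity) (Real.rpow_lt_one hq hq1 hη).le
      (by positivity) (by linarith)
  rw [Real.rpow_natCast] at h2
  calc rowParam a q η i ≤ 1 * (q ^ η) ^ i := mul_le_mul h1 h2 (by positivity) (by positivity)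
    _ = _ := one_mul _

theorem tsum_geoParam_ne_top {a q η θ : ℝ} (ha : a ≤ 1) (hq : 0 ≤ q) (hq1 : q < 1)
    (hη : 0 < η) (hθ : 0 < θ) :
    ∑' p : ℕ × ℕ, ENNReal.ofReal (rowParam a q η p.1 * rowParam a q θ p.2) ≠ ∞ := by
  have h : ∀ p : ℕ × ℕ, ENNReal.ofReal (rowParam a q η p.1 * rowParam a q θ p.2) ≤
      ENNReal.ofReal (q ^ η) ^ p.1 * ENNReal.ofReal (q ^ θ) ^ p.2 := by
    intro p
    rw [ENNReal.ofReal_mul (rowParam_nonneg hq _ _), ← ENNReal.ofReal_pow (by positivity),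
      ← ENNReal.ofReal_pow (by positivity)]
    gcongr
    · exact rowParam_le_pow ha hq hq1 hη _
    · exact rowParam_le_pow ha hq hq1 hθ _
  refine ne_top_of_le_ne_top ?_ (ENNReal.tsum_le_tsum h)
  rw [ENNReal.tsum_prod']
  simp only [ENNReal.tsum_mul_left, ENNReal.tsum_mul_right, ENNReal.tsum_geometric]
  have e : ∀ ξ : ℝ, 0 < ξ → (1 - ENNReal.ofReal (q ^ ξ))⁻¹ ≠ ∞ := fun ξ hξ => by
    rw [ENNReal.inv_ne_top, ← ENNReal.ofReal_one, ← ENNReal.ofReal_sub _ (by positivity)]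
    exact (ENNReal.ofReal_pos.2 (by linarith [Real.rpow_lt_one hq hq1 hξ])).ne'
  exact ENNReal.mul_ne_top (e η hη) (e θ hθ)

/-! ### Fredholm determinants -/

/-- **Hadamard's inequality**, for matrices with entries in `[-1, 1]`. -/
theorem abs_det_le_sqrt_pow {n : ℕ} (A : Matrix (Fin n) (Fin n) ℝ) (hA : ∀ i j, |A i j| ≤ 1) :
    |A.det| ≤ √n ^ n := by
  set b := EuclideanSpace.basisFun (Fin n) ℝ
  have : Fact (Module.finrank ℝ (EuclideanSpace ℝ (Fin n)) = n) := ⟨by simp⟩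
  set v : Fin n → EuclideanSpace ℝ (Fin n) := fun i => WithLp.toLp 2 (A i) with hv
  have h1 := b.toBasis.orientation.abs_volumeForm_apply_le v
  rw [b.toBasis.orientation.volumeForm_robust' b] at h1
  have h2 : b.toBasis.det v = A.det := by
    rw [Module.Basis.det_apply, ← Matrix.det_transpose]
    congr 1
  rw [h2] at h1
  refine h1.trans ((Finset.prod_le_prod (fun _ _ => norm_nonneg _) (g := fun _ => √n)
    fun i _ => ?_).trans (by simp))
  rw [EuclideanSpace.norm_eq]
  refine Real.sqrt_le_sqrt ?_
  calc ∑ j, ‖v i j‖ ^ 2 ≤ ∑ _j : Fin n, (1 : ℝ) := by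
        refine Finset.sum_le_sum fun j _ => ?_
        rw [hv, Real.norm_eq_abs]
        exact pow_le_one₀ (abs_nonneg _) (hA i j)
    _ = n := by simp

/-- Hadamard's inequality after scaling the rows and the columns. -/
theorem abs_det_le_of_abs_le_mul {n : ℕ} (A : Matrix (Fin n) (Fin n) ℝ) (f : Fin n → ℝ)
    (hf : ∀ i, 0 ≤ f i) (hA : ∀ i j, |A i j| ≤ f i * f j) :
    |A.det| ≤ √n ^ n * ∏ i, f i ^ 2 := by
  set B : Matrix (Fin n) (Fin n) ℝ := Matrix.of fun i j => A i j / (f i * f j) with hB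
  have hAB : A = Matrix.of fun i j => f i * (Matrix.of fun i j => f j * B i j) i j := by
    ext i j
    simp only [hB, Matrix.of_apply]
    by_cases h : f i * f j = 0
    · have := hA i j
      rw [h] at this
      have h0 : A i j = 0 := abs_nonpos_iff.1 this
      simp [h0]
    · rw [← mul_assoc, mul_div_cancel₀ _ h]
  have hB1 : |B.det| ≤ √n ^ n := by
    refine abs_det_le_sqrt_pow B fun i j => ?_
    simp only [hB, Matrix.of_apply]
    rw [abs_div, abs_of_nonneg (mul_nonneg (hf i) (hf j))]
    exact div_le_one_of_le₀ (hA i j) (mul_nonneg (hf i) (hf j))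
  have h0 : 0 ≤ ∏ i, f i := Finset.prod_nonneg fun i _ => hf i
  rw [hAB, Matrix.det_mul_column, Matrix.det_mul_row, abs_mul, abs_mul, abs_of_nonneg h0,
    Finset.prod_pow]
  calc (∏ i, f i) * ((∏ i, f i) * |B.det|) = |B.det| * (∏ i, f i) ^ 2 := by ring
    _ ≤ _ := mul_le_mul_of_nonneg_right hB1 (by positivity)

/-- The series that majorizes the Fredholm series by Hadamard's inequality; it converges since
`n ! ≥ (n / e)^n`. -/
theorem summable_hadamard (c : ℝ) (hc : 0 ≤ c) :
    Summable fun n : ℕ => √n ^ n / n ! * c ^ n := by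
  -- `a ≤ 2 ^ n a ^ 2 + 2 ^ (-n)` removes the square root
  have hs : Summable fun n : ℕ => (2 * Real.exp 1 * c ^ 2) ^ n / n ! + (1 / 2 : ℝ) ^ n :=
    (Real.summable_pow_div_factorial _).add summable_geometric_two
  refine Summable.of_nonneg_of_le (fun n => by positivity) (fun n => ?_) hs
  set a : ℝ := √n ^ n / n ! * c ^ n with ha
  have h1 : (n : ℝ) ^ n / n ! ≤ Real.exp n := Real.pow_div_factorial_le_exp _ (by positivity) _
  have h2 : a ^ 2 ≤ (Real.exp 1 * c ^ 2) ^ n / n ! := by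
    have e1 : a ^ 2 = ((n : ℝ) ^ n / n !) * ((c ^ 2) ^ n / n !) := by
      rw [ha, mul_pow, div_pow, ← pow_mul, mul_comm n 2, pow_mul, Real.sq_sqrt (by positivity)]
      ring
    rw [e1, mul_pow, ← Real.exp_nat_mul, mul_one, mul_div_assoc]
    exact mul_le_mul_of_nonneg_right h1 (by positivity)
  have h3 : (2 * Real.exp 1 * c ^ 2) ^ n / n ! = 2 ^ n * ((Real.exp 1 * c ^ 2) ^ n / n !) := by
    rw [mul_assoc, mul_pow 2]; ring
  have h4 : (2 : ℝ) ^ n * (1 / 2) ^ n = 1 := by rw [← mul_pow]; norm_num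
  have h5 : 2 * a ≤ 2 ^ n * a ^ 2 + (1 / 2) ^ n := by
    nlinarith [sq_nonneg (2 ^ n * a - 1), pow_pos (half_pos (one_pos : (0 : ℝ) < 1)) n,
      mul_nonneg (pow_pos (half_pos (one_pos : (0 : ℝ) < 1)) n).le (sq_nonneg (2 ^ n * a - 1))]
  have h6 : (2 : ℝ) ^ n * a ^ 2 ≤ 2 ^ n * ((Real.exp 1 * c ^ 2) ^ n / n !) := by gcongr
  have ha0 : 0 ≤ a := by positivity
  rw [h3]
  linarith

section Fredholm

variable {S : Set ℝ} {k : ℝ → ℝ → ℝ} {f : ℝ → ℝ}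

/-- The determinant in the Fredholm series. -/
def kernelDet (k : ℝ → ℝ → ℝ) (n : ℕ) (x : Fin n → ℝ) : ℝ :=
  (Matrix.of fun i j => k (x i) (x j)).det

theorem ofReal_kernelDet (k : ℝ → ℝ → ℝ) (n : ℕ) (x : Fin n → ℝ) :
    ((kernelDet k n x : ℝ) : ℂ) = (Matrix.of fun i j => (k (x i) (x j) : ℂ)).det := by
  rw [kernelDet, ← Complex.ofRealHom_eq_coe, RingHom.map_det]
  congr 1

theorem fredholmTerm_ofReal (k : ℝ → ℝ → ℝ) (S : Set ℝ) (n : ℕ) :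
    fredholmTerm (fun x y => (k x y : ℂ)) S n =
      (((-1) ^ n / n ! * ∫ x in Set.univ.pi fun _ : Fin n => S, kernelDet k n x : ℝ) : ℂ) := by
  rw [fredholmTerm]
  push_cast
  rw [← integral_complex_ofReal]
  simp only [ofReal_kernelDet]

theorem abs_kernelDet_le (hf : ∀ x ∈ S, 0 ≤ f x) (hk : ∀ x ∈ S, ∀ y ∈ S, |k x y| ≤ f x * f y)
    {n : ℕ} {x : Fin n → ℝ} (hx : x ∈ Set.univ.pi fun _ : Fin n => S) :
    |kernelDet k n x| ≤ √n ^ n * ∏ i, f (x i) ^ 2 :=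
  abs_det_le_of_abs_le_mul _ (fun i => f (x i)) (fun i => hf _ (hx i trivial))
    fun i j => hk _ (hx i trivial) _ (hx j trivial)

theorem volume_restrict_pi (S : Set ℝ) (n : ℕ) :
    (volume : Measure (Fin n → ℝ)).restrict (Set.univ.pi fun _ => S) =
      Measure.pi fun _ => volume.restrict S := by
  rw [volume_pi, Measure.restrict_pi_pi]

theorem integrableOn_prod_sq (hf : IntegrableOn (fun x => f x ^ 2) S) (n : ℕ) :
    IntegrableOn (fun x : Fin n → ℝ => √n ^ n * ∏ i, f (x i) ^ 2)
      (Set.univ.pi fun _ : Fin n => S) := by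
  rw [IntegrableOn, volume_restrict_pi]
  exact (Integrable.fintype_prod (f := fun _ x => f x ^ 2) fun _ => hf).const_mul _

theorem integral_prod_sq (f : ℝ → ℝ) (S : Set ℝ) (n : ℕ) :
    ∫ x in Set.univ.pi fun _ : Fin n => S, √n ^ n * ∏ i, f (x i) ^ 2 =
      √n ^ n * (∫ x in S, f x ^ 2) ^ n := by
  rw [volume_restrict_pi, integral_const_mul, integral_fintype_prod_eq_pow (fun x => f x ^ 2),
    Fintype.card_fin]

theorem measurable_kernelDet (hk : Measurable (Function.uncurry k)) (n : ℕ) :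
    Measurable (kernelDet k n) := by
  unfold kernelDet
  simp only [Matrix.det_apply]
  refine Finset.measurable_sum _ fun σ _ => Measurable.const_smul ?_ _
  refine Finset.measurable_prod _ fun i _ => ?_
  exact hk.comp (f := fun x : Fin n → ℝ => (x (σ i), x i))
    ((measurable_pi_apply _).prodMk (measurable_pi_apply _))

theorem integrableOn_kernelDet (hS : MeasurableSet S) (hf : ∀ x ∈ S, 0 ≤ f x)
    (hf2 : IntegrableOn (fun x => f x ^ 2) S)
    (hk : ∀ x ∈ S, ∀ y ∈ S, |k x y| ≤ f x * f y) (hm : Measurable (Function.uncurry k)) (n : ℕ) :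
    IntegrableOn (kernelDet k n) (Set.univ.pi fun _ : Fin n => S) := by
  refine (integrableOn_prod_sq hf2 n).mono' (measurable_kernelDet hm n).aestronglyMeasurable ?_
  filter_upwards [ae_restrict_mem (MeasurableSet.univ_pi fun _ => hS)] with x hx
  exact abs_kernelDet_le hf hk hx

theorem norm_fredholmTerm_le (hS : MeasurableSet S) (hf : ∀ x ∈ S, 0 ≤ f x)
    (hf2 : IntegrableOn (fun x => f x ^ 2) S)
    (hk : ∀ x ∈ S, ∀ y ∈ S, |k x y| ≤ f x * f y) (n : ℕ) :
    ‖fredholmTerm (fun x y => (k x y : ℂ)) S n‖ ≤ √n ^ n / n ! * (∫ x in S, f x ^ 2) ^ n := by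
  rw [fredholmTerm_ofReal, Complex.norm_real, norm_mul, norm_div, norm_pow, norm_neg, norm_one,
    one_pow, Real.norm_natCast, one_div_mul_eq_div, div_mul_eq_mul_div]
  gcongr
  rw [← integral_prod_sq f S n]
  refine norm_integral_le_of_norm_le (integrableOn_prod_sq hf2 n) ?_
  filter_upwards [ae_restrict_mem (MeasurableSet.univ_pi fun _ => hS)] with x hx
  exact abs_kernelDet_le hf hk hx

theorem fredholmConverges_ofReal (hS : MeasurableSet S) (hf : ∀ x ∈ S, 0 ≤ f x)
    (hf2 : IntegrableOn (fun x => f x ^ 2) S)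
    (hk : ∀ x ∈ S, ∀ y ∈ S, |k x y| ≤ f x * f y) (hm : Measurable (Function.uncurry k)) :
    FredholmConverges (fun x y => (k x y : ℂ)) S := by
  refine ⟨fun n => ?_, Summable.of_norm_bounded
    (summable_hadamard _ (setIntegral_nonneg hS fun x _ => sq_nonneg _))
    (norm_fredholmTerm_le hS hf hf2 hk)⟩
  have := (integrableOn_kernelDet hS hf hf2 hk hm n).ofReal (𝕜 := ℂ)
  exact this.congr (Eventually.of_forall fun x => ofReal_kernelDet k n x)

/-- Fredholm determinants are continuous under dominated pointwise convergence of the kernels. -/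
theorem tendsto_fredholmDet {ι : Type*} {l : Filter ι} [l.IsCountablyGenerated]
    {K : ι → ℝ → ℝ → ℝ} (hS : MeasurableSet S) (hf : ∀ x ∈ S, 0 ≤ f x)
    (hf2 : IntegrableOn (fun x => f x ^ 2) S)
    (hK : ∀ᶠ t in l, ∀ x ∈ S, ∀ y ∈ S, |K t x y| ≤ f x * f y)
    (hm : ∀ᶠ t in l, Measurable (Function.uncurry (K t)))
    (hlim : ∀ x ∈ S, ∀ y ∈ S, Tendsto (fun t => K t x y) l (𝓝 (k x y))) :
    Tendsto (fun t => fredholmDet (fun x y => (K t x y : ℂ)) S) l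
      (𝓝 (fredholmDet (fun x y => (k x y : ℂ)) S)) := by
  unfold fredholmDet
  refine tendsto_tsum_of_dominated_convergence
    (summable_hadamard (∫ x in S, f x ^ 2) (setIntegral_nonneg hS fun x _ => sq_nonneg _)) ?_
    (hK.mono fun t ht n => norm_fredholmTerm_le hS hf hf2 ht n)
  intro n
  simp only [fredholmTerm_ofReal]
  refine ((Complex.continuous_ofReal.tendsto _).comp (Tendsto.const_mul _ ?_))
  refine tendsto_integral_filter_of_dominated_convergence _
    (hm.mono fun t ht => (measurable_kernelDet ht n).aestronglyMeasurable) ?_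
    (integrableOn_prod_sq hf2 n) ?_
  · filter_upwards [hK] with t ht
    filter_upwards [ae_restrict_mem (MeasurableSet.univ_pi fun _ => hS)] with x hx
    exact abs_kernelDet_le hf ht hx
  · filter_upwards [ae_restrict_mem (MeasurableSet.univ_pi fun _ => hS)] with x hx
    have hc : Continuous fun A : Matrix (Fin n) (Fin n) ℝ => A.det := continuous_id.matrix_det
    refine (hc.tendsto (Matrix.of fun i j => k (x i) (x j))).comp ?_
    refine tendsto_pi_nhds.2 fun i => tendsto_pi_nhds.2 fun j => ?_
    exact hlim _ (hx i trivial) _ (hx j trivial)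

end Fredholm

/-- A sum of minors over tuples of indices counts every set of indices `n !` times. -/
theorem sum_det_submatrix_eq {R : Type*} [CommRing R] {N : ℕ} (G : Matrix (Fin N) (Fin N) R)
    (n : ℕ) : ∑ f : Fin n → Fin N, (G.submatrix f f).det = (n ! : R) *
      ∑ s ∈ Finset.univ.powersetCard n,
        (G.submatrix (Subtype.val : s → Fin N) (Subtype.val : s → Fin N)).det := by
  classical
  rw [sum_eq_sum_strictMono_perm]
  · have h1 : ∀ l : Fin n → Fin N, ∑ σ : Equiv.Perm (Fin n),
        (G.submatrix (l ∘ σ) (l ∘ σ)).det = (n ! : R) * (G.submatrix l l).det := by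
      intro l
      have : ∀ σ : Equiv.Perm (Fin n), (G.submatrix (l ∘ σ) (l ∘ σ)).det =
          (G.submatrix l l).det := fun σ => by
        rw [← Matrix.det_submatrix_equiv_self σ (G.submatrix l l)]
        rfl
      simp [this, Fintype.card_perm]
    simp only [h1]
    rw [← Finset.mul_sum]
    congr 1
    refine Finset.sum_bij' (fun l _ => Finset.univ.image l)
      (fun s hs => s.orderEmbOfFin (Finset.mem_powersetCard.1 hs).2) ?_ ?_ ?_ ?_ ?_
    · intro l hl
      refine Finset.mem_powersetCard.2 ⟨Finset.subset_univ _, ?_⟩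
      rw [Finset.card_image_of_injective _ (Finset.mem_filter.1 hl).2.injective, Finset.card_fin]
    · intro s hs
      exact Finset.mem_filter.2 ⟨Finset.mem_univ _, OrderEmbedding.strictMono _⟩
    · intro l hl
      refine (Finset.orderEmbOfFin_unique _ (fun i => ?_) (Finset.mem_filter.1 hl).2).symm
      exact Finset.mem_image_of_mem _ (Finset.mem_univ _)
    · intro s hs
      ext a
      rw [← Finset.mem_coe, Finset.coe_image, Finset.coe_univ, Set.image_univ,
        Finset.range_orderEmbOfFin, Finset.mem_coe]
    · intro l hl
      have hi := (Finset.mem_filter.1 hl).2.injective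
      set e : Fin n ≃ (Finset.univ.image l : Finset (Fin N)) :=
        Equiv.ofBijective (fun i => ⟨l i, Finset.mem_image_of_mem _ (Finset.mem_univ _)⟩)
          ⟨fun i j h => hi (congrArg Subtype.val h), fun ⟨a, ha⟩ => by
            obtain ⟨i, _, rfl⟩ := Finset.mem_image.1 ha
            exact ⟨i, rfl⟩⟩
      rw [← Matrix.det_submatrix_equiv_self e]
      rfl
  · intro f hf
    rw [Function.Injective] at hf
    push Not at hf
    obtain ⟨i, j, hij, hne⟩ := hf
    exact Matrix.det_zero_of_row_eq hne (by ext b; simp [hij])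

/-- The determinant of `1 - G` as an alternating sum of principal minors. -/
theorem sum_minors_eq_det {R : Type*} [CommRing R] {N : ℕ} (G : Matrix (Fin N) (Fin N) R) :
    ∑ n ∈ Finset.range (N + 1), (-1) ^ n * ∑ s ∈ Finset.univ.powersetCard n,
      (G.submatrix (Subtype.val : s → Fin N) (Subtype.val : s → Fin N)).det = (1 - G).det := by
  have hd : (1 + (Polynomial.X : Polynomial R) • G.map Polynomial.C).det.natDegree < N + 1 := by
    rw [Nat.lt_succ_iff, Polynomial.natDegree_le_iff_coeff_eq_zero]
    intro n hn
    rw [Matrix.coeff_det_one_add_X_smul_eq_sum_minors,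
      Finset.powersetCard_eq_empty.2 (by simpa using hn)]
    simp
  have h := Polynomial.eval_eq_sum_range' hd (-1)
  simp only [Matrix.coeff_det_one_add_X_smul_eq_sum_minors] at h
  rw [Finset.sum_congr rfl fun n _ => mul_comm _ _, ← h, ← Polynomial.coe_evalRingHom,
    RingHom.map_det]
  congr 1
  ext i j
  simp [Matrix.one_apply, sub_eq_add_neg]
  split_ifs <;> simp

/-- The Fredholm determinant of a kernel of finite rank is a determinant of finite size. -/
theorem fredholmDet_finite_rank {S : Set ℝ} {N : ℕ} (V W : Fin N → ℝ → ℝ)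
    (hVW : ∀ l m, IntegrableOn (fun x => V l x * W m x) S) :
    fredholmDet (fun x y => ((∑ l, V l x * W l y : ℝ) : ℂ)) S =
      (((1 - Matrix.of fun l m => ∫ x in S, V m x * W l x).det : ℝ) : ℂ) := by
  set G : Matrix (Fin N) (Fin N) ℝ := Matrix.of fun l m => ∫ x in S, V m x * W l x with hG
  -- the kernel matrix is a product of an `n × N` and an `N × n` matrix
  have hdet : ∀ n (x : Fin n → ℝ), kernelDet (fun x y => ∑ l, V l x * W l y) n x =
      ∑ f : Fin n → Fin N, ∑ σ : Equiv.Perm (Fin n),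
        ((Equiv.Perm.sign σ : ℤ) : ℝ) * ∏ j, V (f j) (x j) * W (f (σ j)) (x j) := by
    intro n x
    have e : kernelDet (fun x y => ∑ l, V l x * W l y) n x =
        ((Matrix.of fun i l => V l (x i)) * (Matrix.of fun j l => W l (x j)).transpose).det := by
      rw [kernelDet]
      congr 1
    rw [e, det_mul_transpose_eq_sum_prod]
    refine Finset.sum_congr rfl fun f _ => ?_
    rw [← Matrix.det_transpose, Matrix.det_apply', Finset.mul_sum]
    refine Finset.sum_congr rfl fun σ _ => ?_
    simp only [Matrix.transpose_apply, Matrix.submatrix_apply, Matrix.of_apply, id,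
      Finset.prod_mul_distrib]
    ring
  have hint : ∀ n, ∫ x in Set.univ.pi fun _ : Fin n => S,
      kernelDet (fun x y => ∑ l, V l x * W l y) n x =
        ∑ f : Fin n → Fin N, (G.submatrix f f).det := by
    intro n
    simp only [hdet, volume_restrict_pi]
    have hi : ∀ (f : Fin n → Fin N) (σ : Equiv.Perm (Fin n)), Integrable
        (fun x : Fin n → ℝ => ((Equiv.Perm.sign σ : ℤ) : ℝ) *
          ∏ j, V (f j) (x j) * W (f (σ j)) (x j)) (Measure.pi fun _ => volume.restrict S) :=
      fun f σ => (Integrable.fintype_prod (f := fun j x => V (f j) x * W (f (σ j)) x)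
        fun j => hVW _ _).const_mul _
    rw [integral_finsetSum _ fun f _ => integrable_finsetSum _ fun σ _ => hi f σ]
    refine Finset.sum_congr rfl fun f _ => ?_
    rw [integral_finsetSum _ fun σ _ => hi f σ, Matrix.det_apply']
    refine Finset.sum_congr rfl fun σ _ => ?_
    rw [integral_const_mul, integral_fintype_prod_eq_prod (fun j x => V (f j) x * W (f (σ j)) x)]
    rfl
  have hterm : ∀ n, fredholmTerm (fun x y => ((∑ l, V l x * W l y : ℝ) : ℂ)) S n =
      (((-1) ^ n * ∑ s ∈ Finset.univ.powersetCard n,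
        (G.submatrix (Subtype.val : s → Fin N) (Subtype.val : s → Fin N)).det : ℝ) : ℂ) := by
    intro n
    rw [fredholmTerm_ofReal (fun x y => ∑ l, V l x * W l y), hint, sum_det_submatrix_eq]
    congr 1
    have : (n ! : ℝ) ≠ 0 := by positivity
    field_simp
  rw [← sum_minors_eq_det G, fredholmDet, tsum_eq_sum (s := Finset.range (N + 1))]
  · simp only [hterm]
    push_cast
    rfl
  · intro n hn
    rw [hterm, Finset.powersetCard_eq_empty.2 (by simpa using hn)]
    simp

/-! ### The inverse of the Cauchy matrix -/

/-- The coefficient `∏_k (1 - x_i y_k) / ∏_{k ≠ i} (x_k / x_i - 1)`, a normalized residue. -/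
def resCoeff (N : ℕ) (x y : ℕ → ℝ) (i : ℕ) : ℝ :=
  (∏ k ∈ Finset.range N, (1 - x i * y k)) / ∏ k ∈ (Finset.range N).erase i, (x k / x i - 1)

/-- The entries of the inverse of the Cauchy matrix `(1 / (1 - x_i y_j))`; this is Lagrange
interpolation of `∏_{k ≠ j} (1 - y_k z)` at the nodes `x_i`, evaluated at `z = 1 / y_l`. -/
theorem sum_resCoeff_mul {N : ℕ} {x y : ℕ → ℝ} (hx : ∀ i, 0 < x i) (hy : ∀ j, 0 < y j)
    (hxy : ∀ i j, x i * y j < 1) (hxi : Function.Injective x) (hyi : Function.Injective y)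
    {j l : ℕ} (hj : j < N) (hl : l < N) :
    ∑ i ∈ Finset.range N, resCoeff N x y i * resCoeff N y x j / (x i * y j) ^ (N - 1) /
      (1 - x i * y j) * (1 / (1 - x i * y l)) = if j = l then 1 else 0 := by
  classical
  have h1 : ∀ i j, 1 - x i * y j ≠ 0 := fun i j => by linarith [hxy i j]
  have h1' : ∀ i j, 1 - y j * x i ≠ 0 := fun i j => by linarith [hxy i j, mul_comm (x i) (y j)]
  set p : Polynomial ℝ := ∏ k ∈ (Finset.range N).erase j, (1 - Polynomial.C (y k) * Polynomial.X)
    with hp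
  have hpe : ∀ z, p.eval z = ∏ k ∈ (Finset.range N).erase j, (1 - y k * z) := fun z => by
    simp [hp, Polynomial.eval_prod]
  have hcard : ∀ i < N, ((Finset.range N).erase i).card = N - 1 := fun i hi => by
    rw [Finset.card_erase_of_mem (Finset.mem_range.2 hi), Finset.card_range]
  have hdeg : p.degree < (Finset.range N).card := by
    refine (Polynomial.degree_prod_le _ _).trans_lt ?_
    refine (Finset.sum_le_sum (g := fun _ => (1 : WithBot ℕ)) fun k _ => ?_).trans_lt ?_
    · refine (Polynomial.degree_sub_le _ _).trans (max_le ?_ (Polynomial.degree_C_mul_X_le _))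
      exact Polynomial.degree_one_le.trans zero_le_one
    · rw [Finset.sum_const, hcard j hj, Finset.card_range, nsmul_eq_mul, mul_one]
      exact_mod_cast (by omega : N - 1 < N)
  -- the value at `1 / y l` is zero unless `l = j`, since `1 - y l z` is then a factor of `p`
  have hint := Lagrange.eq_interpolate (hxi.injOn (s := (Finset.range N : Set ℕ))) hdeg
  have hev := congrArg (Polynomial.eval (1 / y l)) hint
  rw [Lagrange.interpolate_apply, Polynomial.eval_finsetSum] at hev
  have hterm : ∀ i ∈ Finset.range N,
      Polynomial.eval (1 / y l) (Polynomial.C (p.eval (x i)) *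
        Lagrange.basis (Finset.range N) x i) =
      resCoeff N x y i / (1 - x i * y j) * (resCoeff N y x l *
        (∏ k ∈ (Finset.range N).erase l, (y k / y l - 1))) / (1 - x i * y l) /
        ((x i * y l) ^ (N - 1) * (-1) ^ (N - 1)) := by
    intro i hi
    have hi' := Finset.mem_range.1 hi
    have hB : resCoeff N y x l * (∏ k ∈ (Finset.range N).erase l, (y k / y l - 1)) =
        ∏ k ∈ Finset.range N, (1 - x k * y l) := by
      rw [resCoeff, div_mul_cancel₀]
      · exact Finset.prod_congr rfl fun k _ => by ring
      · refine Finset.prod_ne_zero_iff.2 fun k hk => ?_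
        rw [sub_ne_zero, Ne, div_eq_one_iff_eq (hy l).ne']
        exact fun h => Finset.ne_of_mem_erase hk (hyi h)
    have hA : ∏ k ∈ Finset.range N, (1 - x i * y k) = resCoeff N x y i *
        ∏ k ∈ (Finset.range N).erase i, (x k / x i - 1) := by
      rw [resCoeff, div_mul_cancel₀]
      refine Finset.prod_ne_zero_iff.2 fun k hk => ?_
      rw [sub_ne_zero, Ne, div_eq_one_iff_eq (hx i).ne']
      exact fun h => Finset.ne_of_mem_erase hk (hxi h)
    have hne : ∏ k ∈ (Finset.range N).erase i, (x k / x i - 1) ≠ 0 := by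
      refine Finset.prod_ne_zero_iff.2 fun k hk => ?_
      rw [sub_ne_zero, Ne, div_eq_one_iff_eq (hx i).ne']
      exact fun h => Finset.ne_of_mem_erase hk (hxi h)
    have e1 : p.eval (x i) = resCoeff N x y i *
        (∏ k ∈ (Finset.range N).erase i, (x k / x i - 1)) / (1 - x i * y j) := by
      rw [← hA, hpe, ← Finset.mul_prod_erase _ _ (Finset.mem_range.2 hj),
        mul_div_cancel_left₀ _ (h1 i j)]
      exact Finset.prod_congr rfl fun k _ => by ring
    have e2 : (Lagrange.basis (Finset.range N) x i).eval (1 / y l) =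
        (∏ k ∈ Finset.range N, (1 - x k * y l)) / (1 - x i * y l) / (y l) ^ (N - 1) /
          (x i ^ (N - 1) * (-1) ^ (N - 1) *
            ∏ k ∈ (Finset.range N).erase i, (x k / x i - 1)) := by
      rw [← Finset.mul_prod_erase _ _ hi, mul_div_cancel_left₀ _ (h1 i l), ← hcard i hi',
        ← Finset.prod_const, ← Finset.prod_const, ← Finset.prod_const, ← Finset.prod_mul_distrib,
        ← Finset.prod_mul_distrib, ← Finset.prod_div_distrib, ← Finset.prod_div_distrib,
        Lagrange.basis, Polynomial.eval_prod]
      refine Finset.prod_congr rfl fun k hk => ?_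
      have hxl := (hy l).ne'
      have hxi' := (hx i).ne'
      have : x i - x k ≠ 0 := sub_ne_zero.2 fun h => Finset.ne_of_mem_erase hk (hxi h.symm)
      have h3 : x i * -1 * (x k / x i - 1) = x i - x k := by field_simp; ring
      rw [h3]
      simp only [Lagrange.basisDivisor, Polynomial.eval_mul, Polynomial.eval_C,
        Polynomial.eval_sub, Polynomial.eval_X]
      field_simp
    rw [Polynomial.eval_mul, Polynomial.eval_C, e1, e2, hB]
    have := (hx i).ne'
    have := (hy l).ne'
    have := h1 i l
    have := h1 i j
    rw [mul_pow]
    generalize (∏ k ∈ (Finset.range N).erase i, (x k / x i - 1)) = D at hne ⊢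
    generalize (∏ k ∈ Finset.range N, (1 - x k * y l)) = E
    field_simp
  rw [Finset.sum_congr rfl hterm] at hev
  have hneg : ((-1 : ℝ) ^ (N - 1)) ≠ 0 := pow_ne_zero _ (by norm_num)
  split_ifs with hjl
  · subst hjl
    have hpj : p.eval (1 / y j) =
        (-1) ^ (N - 1) * ∏ k ∈ (Finset.range N).erase j, (y k / y j - 1) := by
      rw [hpe, ← hcard j hj, ← Finset.prod_const, ← Finset.prod_mul_distrib]
      exact Finset.prod_congr rfl fun k _ => by ring
    rw [hpj] at hev
    have hne : ∏ k ∈ (Finset.range N).erase j, (y k / y j - 1) ≠ 0 := by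
      refine Finset.prod_ne_zero_iff.2 fun k hk => ?_
      rw [sub_ne_zero, Ne, div_eq_one_iff_eq (hy j).ne']
      exact fun h => Finset.ne_of_mem_erase hk (hyi h)
    have hsq : ((-1 : ℝ) ^ (N - 1)) * ((-1 : ℝ) ^ (N - 1)) = 1 := by
      rw [← mul_pow]; norm_num
    refine mul_right_cancel₀ (mul_ne_zero hneg hne) ?_
    rw [one_mul]
    refine Eq.trans ?_ hev.symm
    rw [Finset.sum_mul]
    refine Finset.sum_congr rfl fun i _ => ?_
    rw [div_eq_mul_inv _ ((x i * y j) ^ (N - 1) * (-1) ^ (N - 1)), mul_inv,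
      inv_eq_of_mul_eq_one_left hsq]
    ring
  · have hpl : p.eval (1 / y l) = 0 := by
      rw [hpe]
      refine Finset.prod_eq_zero (Finset.mem_erase.2 ⟨Ne.symm hjl, Finset.mem_range.2 hl⟩) ?_
      rw [mul_one_div_cancel (hy l).ne', sub_self]
    rw [hpl] at hev
    have hBne : resCoeff N y x l * ∏ k ∈ (Finset.range N).erase l, (y k / y l - 1) ≠ 0 := by
      rw [resCoeff, div_mul_cancel₀]
      · exact Finset.prod_ne_zero_iff.2 fun k _ => h1' k l
      · refine Finset.prod_ne_zero_iff.2 fun k hk => ?_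
        rw [sub_ne_zero, Ne, div_eq_one_iff_eq (hy l).ne']
        exact fun h => Finset.ne_of_mem_erase hk (hyi h)
    have h0 : ∑ i ∈ Finset.range N, resCoeff N x y i / (1 - x i * y j) / (1 - x i * y l) /
        (x i) ^ (N - 1) = 0 := by
      refine mul_right_cancel₀ (mul_ne_zero hBne (inv_ne_zero (mul_ne_zero
        (pow_ne_zero (N - 1) (hy l).ne') hneg))) ?_
      rw [zero_mul, hev, Finset.sum_mul]
      refine Finset.sum_congr rfl fun i _ => ?_
      have := h1 i j
      have := h1 i l
      have := (hx i).ne'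
      have := (hy l).ne'
      rw [mul_pow]
      field_simp
    have h2 : (resCoeff N y x j / (y j) ^ (N - 1)) * ∑ i ∈ Finset.range N,
        resCoeff N x y i / (1 - x i * y j) / (1 - x i * y l) / (x i) ^ (N - 1) = 0 := by
      rw [h0, mul_zero]
    rw [← h2, Finset.mul_sum]
    refine Finset.sum_congr rfl fun i _ => ?_
    have := h1 i j
    have := h1 i l
    have := (hx i).ne'
    have := (hy j).ne'
    rw [mul_pow]
    field_simp

theorem tendsto_measure_le_one {Ω : Type*} [MeasurableSpace Ω] (P : Measure Ω)
    [IsProbabilityMeasure P] (X : Ω → ℕ) :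
    Tendsto (fun n : ℕ => P {ω | X ω ≤ n}) atTop (𝓝 1) := by
  have hU : (⋃ n : ℕ, {ω | X ω ≤ n}) = Set.univ :=
    Set.eq_univ_of_forall fun ω => Set.mem_iUnion.2 ⟨X ω, le_refl (X ω)⟩
  have h : Monotone fun n : ℕ => {ω | X ω ≤ n} := fun m n hmn ω (hω : X ω ≤ m) => hω.trans hmn
  have h2 := tendsto_measure_iUnion_atTop (μ := P) h
  rw [hU, measure_univ] at h2
  exact h2

theorem alternant_zero_ne_zero {x : ℕ → ℝ} (hxi : Function.Injective x) (N : ℕ) :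
    alternant x N 0 ≠ 0 := by
  rw [alternant_zero_eq_vandermonde]
  exact Matrix.det_vandermonde_ne_zero_iff.2 (hxi.comp Fin.val_injective)

/-- The distribution function of a last passage time as a determinant: Cauchy–Binet turns the sum
over partitions into `det (C - X^m C Y^m)` for the Cauchy matrix `C = (1 / (1 - x_i y_j))`, which
is then divided by `det C`. -/
theorem measureReal_lpp_le_eq_det {Ω : Type*} [MeasurableSpace Ω] {P : Measure Ω}
    [IsProbabilityMeasure P] {w : ℕ × ℕ → Ω → ℕ} {x y : ℕ → ℝ} (hw : IsProductGeoField P w x y)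
    (hx : ∀ i, 0 < x i) (hy : ∀ j, 0 < y j) (hxy : ∀ i j, x i * y j < 1)
    (hxi : Function.Injective x) (hyi : Function.Injective y) (N n : ℕ) :
    P.real {ω | lpp (fun p => w p ω) N N ≤ n} =
      (1 - Matrix.of fun l m : Fin N => ∑ i ∈ Finset.range N,
        resCoeff N x y i * resCoeff N y x m * (x i * y l) ^ (n + 1) /
          ((1 - x i * y m) * (1 - x i * y l))).det := by
  classical
  have h1 : ∀ i j, 1 - x i * y j ≠ 0 := fun i j => by linarith [hxy i j]
  set c : ℝ := ∏ i ∈ Finset.range N, ∏ j ∈ Finset.range N, (1 - x i * y j) with hc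
  have hc0 : 0 < c := Finset.prod_pos fun i _ => Finset.prod_pos fun j _ => by linarith [hxy i j]
  set p : ℕ → ℝ := fun n => P.real {ω | lpp (fun p => w p ω) N N ≤ n} with hp
  set V : ℝ := alternant x N 0 * alternant y N 0 with hV
  have hV0 : V ≠ 0 := mul_ne_zero (alternant_zero_ne_zero hxi N) (alternant_zero_ne_zero hyi N)
  set C : Matrix (Fin N) (Fin N) ℝ := Matrix.of fun i j => 1 / (1 - x i * y j) with hC
  set E : ℕ → Matrix (Fin N) (Fin N) ℝ := fun n => Matrix.of fun i j =>
    ∑ l ∈ Finset.range (n + N), (x i * y j) ^ l with hE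
  have hpE : ∀ n, p n * V = c * (E n).det := fun n => by
    have h := measure_lpp_le hw (fun i => (hx i).le) (fun i => (hy i).le) hxy N n
    have hnn : 0 ≤ schurPairSum x y N n := by
      have h := map_schurPairSum NNReal.toRealHom (fun i => ⟨x i, (hx i).le⟩)
        (fun i => ⟨y i, (hy i).le⟩) N n
      exact (NNReal.coe_nonneg _).trans_eq h
    have hpn : p n = c * schurPairSum x y N n := by
      rw [hp]
      simp only [measureReal_def]
      rw [h, ENNReal.toReal_ofReal (mul_nonneg hc0.le hnn)]
    rw [hpn, mul_assoc, schurPairSum_mul_vandermonde]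
  have hpl : Tendsto p atTop (𝓝 1) := by
    have := (ENNReal.tendsto_toReal ENNReal.one_ne_top).comp
      (tendsto_measure_le_one P fun ω => lpp (fun p => w p ω) N N)
    exact this
  have hEl : Tendsto (fun n => (E n).det) atTop (𝓝 C.det) := by
    refine (Continuous.matrix_det continuous_id).continuousAt.tendsto.comp ?_
    refine tendsto_pi_nhds.2 fun i => tendsto_pi_nhds.2 fun j => ?_
    have := (hasSum_geometric_of_lt_one (mul_nonneg (hx i).le (hy j).le) (hxy i j)).tendsto_sum_nat
    rw [← one_div] at this
    exact this.comp (tendsto_add_atTop_nat N)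
  -- as `n → ∞` the total mass gives Cauchy's determinant, so the normalization need not be computed
  have hVC : V = c * C.det := by
    have h2 := (hpl.mul_const V)
    simp only [hpE, one_mul] at h2
    exact tendsto_nhds_unique h2 (hEl.const_mul c)
  set D : Matrix (Fin N) (Fin N) ℝ := Matrix.of fun j i =>
    resCoeff N x y i * resCoeff N y x j / (x i * y j) ^ (N - 1) / (1 - x i * y j) with hD
  have hDC : D * C = 1 := by
    ext j l
    rw [Matrix.mul_apply, Matrix.one_apply]
    have := sum_resCoeff_mul hx hy hxy hxi hyi j.2 l.2
    rw [Finset.sum_range] at this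
    simpa [hD, hC, Fin.ext_iff] using this
  have hpn : p n = (D * E n).det := by
    have h2 : p n * C.det = (E n).det := by
      have := hpE n
      rw [hVC] at this
      exact mul_left_cancel₀ hc0.ne' (by linarith)
    rw [Matrix.det_mul, ← h2, mul_comm (p n), ← mul_assoc, ← Matrix.det_mul, hDC, Matrix.det_one,
      one_mul]
  set G : Matrix (Fin N) (Fin N) ℝ := Matrix.of fun l m : Fin N => ∑ i ∈ Finset.range N,
        resCoeff N x y i * resCoeff N y x m * (x i * y l) ^ (n + 1) /
          ((1 - x i * y m) * (1 - x i * y l)) with hG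
  -- conjugation by `Y`, with a transposition, reduces the exponent `n + N` to `n + 1`
  set Y : Matrix (Fin N) (Fin N) ℝ := Matrix.diagonal fun j => y j ^ (N - 1) with hY
  have hconj : Y * (D * E n) = (1 - G).transpose * Y := by
    have hEC : E n = C - Matrix.of fun i j : Fin N => (x i * y j) ^ (n + N) / (1 - x i * y j) := by
      ext i j
      simp only [hE, hC, Matrix.of_apply, Matrix.sub_apply]
      rw [geom_sum_eq (hxy i j).ne, ← sub_div, ← neg_div_neg_eq, neg_sub, neg_sub]
    rw [hEC, Matrix.mul_sub, hDC, Matrix.transpose_sub, Matrix.transpose_one, Matrix.mul_sub,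
      Matrix.sub_mul, mul_one, one_mul]
    congr 1
    ext j l
    rw [hY, Matrix.diagonal_mul, Matrix.mul_diagonal, Matrix.mul_apply, Matrix.transpose_apply]
    simp only [hD, hG, Matrix.of_apply]
    rw [Finset.sum_range, Finset.mul_sum, Finset.sum_mul]
    refine Finset.sum_congr rfl fun i _ => ?_
    have := h1 i j
    have := h1 i l
    have hxi' := (hx i).ne'
    have hyj := (hy j).ne'
    have hN : n + N = (n + 1) + (N - 1) := by have := j.pos; omega
    rw [hN, mul_pow, mul_pow (x i) (y l), mul_pow, pow_add (x i), pow_add (y l)]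
    field_simp
  have hYdet : Y.det ≠ 0 := by
    rw [hY, Matrix.det_diagonal]
    exact Finset.prod_ne_zero_iff.2 fun j _ => pow_ne_zero _ (hy j).ne'
  have h3 := congrArg Matrix.det hconj
  rw [Matrix.det_mul Y, Matrix.det_mul _ Y, ← hpn, Matrix.det_transpose, mul_comm] at h3
  exact mul_right_cancel₀ hYdet h3

/-! ### The distribution function as a Fredholm determinant -/

theorem floor_add_div_self {ε s u : ℝ} (hε : 0 < ε) (hu : s ≤ u) :
    ⌊(u + ε - s) / ε⌋₊ = ⌊(u - s) / ε⌋₊ + 1 := by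
  rw [show (u + ε - s) / ε = (u - s) / ε + 1 by field_simp; ring,
    Nat.floor_add_one (div_nonneg (by linarith) hε.le)]

theorem measurable_floor_div (ε s : ℝ) : Measurable fun u : ℝ => ⌊(u - s) / ε⌋₊ :=
  Nat.measurable_floor.comp ((measurable_id.sub_const s).div_const ε)

theorem pow_floor_le_exp {ε s u r : ℝ} (hr : 0 < r) (hr1 : r ≤ 1) :
    r ^ ⌊(u - s) / ε⌋₊ ≤ r⁻¹ * Real.exp (Real.log r * ((u - s) / ε)) := by
  rw [← Real.rpow_def_of_pos hr, ← Real.rpow_natCast, ← Real.rpow_neg_one, ← Real.rpow_add hr]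
  exact Real.rpow_le_rpow_of_exponent_ge hr hr1 (by linarith [Nat.lt_floor_add_one ((u - s) / ε)])

theorem integrableOn_pow_floor {ε s r : ℝ} (hε : 0 < ε) (hr : 0 < r) (hr1 : r < 1) :
    IntegrableOn (fun u : ℝ => r ^ ⌊(u - s) / ε⌋₊) (Set.Ioi s) := by
  have hlog := Real.log_neg hr hr1
  have h : IntegrableOn (fun u : ℝ => r⁻¹ * Real.exp (Real.log r * ((u - s) / ε))) (Set.Ioi s) := by
    have := (integrableOn_exp_mul_Ioi (a := Real.log r / ε) (div_neg_of_neg_of_pos hlog hε) s)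
    refine ((this.const_mul (Real.exp (-(Real.log r / ε * s)))).const_mul r⁻¹).congr
      (Eventually.of_forall fun u => ?_)
    simp only
    rw [← Real.exp_add]
    congr 2
    field_simp
    ring
  refine h.mono' ((measurable_from_nat (f := fun n => r ^ n)).comp
    (measurable_floor_div ε s)).aestronglyMeasurable (Eventually.of_forall fun u => ?_)
  rw [Real.norm_of_nonneg (pow_nonneg hr.le _)]
  exact pow_floor_le_exp hr hr1.le

/-- Rescaling by the step of the lattice turns the geometric series into an integral. -/
theorem integral_pow_floor {ε s r : ℝ} (hε : 0 < ε) (hr : 0 < r) (hr1 : r < 1) :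
    ∫ u in Set.Ioi s, r ^ ⌊(u - s) / ε⌋₊ = ε / (1 - r) := by
  have hint := integrableOn_pow_floor (s := s) hε hr hr1
  set f : ℝ → ℝ := fun u => r ^ ⌊(u - s) / ε⌋₊ with hf
  have h1 : ∫ u in Set.Ioi (s + ε), f u = r * ∫ u in Set.Ioi s, f u := by
    have h := (measurePreserving_add_right volume ε).setIntegral_preimage_emb
      (measurableEmbedding_addRight ε) f (Set.Ioi (s + ε))
    rw [← h, ← integral_const_mul]
    have hs : (fun x => x + ε) ⁻¹' Set.Ioi (s + ε) = Set.Ioi s := by ext x; simp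
    rw [hs]
    refine setIntegral_congr_fun measurableSet_Ioi fun u hu => ?_
    simp only [hf]
    rw [floor_add_div_self hε (le_of_lt hu), pow_succ']
  have h2 : ∫ u in Set.Ioc s (s + ε), f u = ε := by
    rw [integral_Ioc_eq_integral_Ioo, setIntegral_congr_fun (g := fun _ => 1) measurableSet_Ioo]
    · simp [hε.le]
    · intro u hu
      have : ⌊(u - s) / ε⌋₊ = 0 := by
        rw [Nat.floor_eq_zero, div_lt_one hε]; linarith [hu.2]
      simp [hf, this]
  -- the first step has length `ε` and height `1`, and the shift by `ε` multiplies by `r`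
  have h3 : ∫ u in Set.Ioi s, f u = ε + r * ∫ u in Set.Ioi s, f u := by
    nth_rewrite 1 [← Set.Ioc_union_Ioi_eq_Ioi (show s ≤ s + ε by linarith)]
    rw [setIntegral_union (Set.Ioc_disjoint_Ioi le_rfl) measurableSet_Ioi
      (hint.mono_set Set.Ioc_subset_Ioi_self)
      (hint.mono_set (Set.Ioi_subset_Ioi (by linarith))), h1, h2]
  rw [eq_div_iff (by linarith)]
  linarith

/-- The kernel, a step function of two real variables, whose Fredholm determinant on `(s, ∞)` is
the distribution function at `n` of the last passage time to the point `(N, N)`. -/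
def stepKernel (x y : ℕ → ℝ) (N n : ℕ) (ε s u v : ℝ) : ℝ :=
  ∑ i ∈ Finset.range N, ∑ m ∈ Finset.range N, resCoeff N x y i * resCoeff N y x m *
    (x i ^ (n + 1 + ⌊(u - s) / ε⌋₊) * y m ^ (n + 1 + ⌊(v - s) / ε⌋₊)) / ((1 - x i * y m) * ε)

/-- The distribution function of a last passage time as the Fredholm determinant of a step kernel,
which has rank at most `N`. The lattice spacing `ε` and the left end `s` of the half line are
arbitrary, so that they can be adapted to the scaling limit. -/
theorem measureReal_lpp_le_eq_fredholmDet {Ω : Type*} [MeasurableSpace Ω] {P : Measure Ω}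
    [IsProbabilityMeasure P] {w : ℕ × ℕ → Ω → ℕ} {x y : ℕ → ℝ} (hw : IsProductGeoField P w x y)
    (hx : ∀ i, 0 < x i) (hy : ∀ j, 0 < y j) (hxy : ∀ i j, x i * y j < 1)
    (hxi : Function.Injective x) (hyi : Function.Injective y) (N n : ℕ) {ε : ℝ} (hε : 0 < ε)
    (s : ℝ) :
    (P.real {ω | lpp (fun p => w p ω) N N ≤ n} : ℂ) =
      fredholmDet (fun u v => (stepKernel x y N n ε s u v : ℂ)) (Set.Ioi s) := by
  set V : Fin N → ℝ → ℝ := fun m u => ∑ i ∈ Finset.range N, resCoeff N x y i * resCoeff N y x m *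
    x i ^ (n + 1 + ⌊(u - s) / ε⌋₊) / ((1 - x i * y m) * ε) with hV
  set W : Fin N → ℝ → ℝ := fun m v => y m ^ (n + 1 + ⌊(v - s) / ε⌋₊) with hW
  have hVWe : ∀ l m u, V l u * W m u = ∑ i ∈ Finset.range N,
      (resCoeff N x y i * resCoeff N y x l * (x i * y m) ^ (n + 1) / ((1 - x i * y l) * ε)) *
        (x i * y m) ^ ⌊(u - s) / ε⌋₊ := fun l m u => by
    simp only [hV, hW]
    rw [Finset.sum_mul]
    refine Finset.sum_congr rfl fun i _ => ?_
    simp only [mul_pow, pow_add]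
    ring
  have hi : ∀ i m, IntegrableOn (fun u : ℝ => (x i * y m) ^ ⌊(u - s) / ε⌋₊) (Set.Ioi s) :=
    fun i m => integrableOn_pow_floor hε (mul_pos (hx i) (hy m)) (hxy i m)
  have hVW : ∀ l m, IntegrableOn (fun x => V l x * W m x) (Set.Ioi s) := fun l m => by
    simp only [hVWe]
    exact integrable_finsetSum _ fun i _ => (hi i m).const_mul _
  have hK : (fun u v => (stepKernel x y N n ε s u v : ℂ)) =
      fun u v => ((∑ l, V l u * W l v : ℝ) : ℂ) := by
    ext u v
    rw [stepKernel, Finset.sum_comm, Finset.sum_range]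
    congr 1
    refine Finset.sum_congr rfl fun l _ => ?_
    simp only [hV, hW]
    rw [Finset.sum_mul]
    refine Finset.sum_congr rfl fun i _ => ?_
    ring
  rw [hK, fredholmDet_finite_rank V W hVW, measureReal_lpp_le_eq_det hw hx hy hxy hxi hyi]
  congr 4
  ext l m
  simp only [hVWe]
  rw [integral_finsetSum _ fun i _ => (hi i l).const_mul _]
  refine Finset.sum_congr rfl fun i _ => ?_
  rw [integral_const_mul, integral_pow_floor hε (mul_pos (hx i) (hy l)) (hxy i l)]
  have h1 : ∀ i j, 1 - x i * y j ≠ 0 := fun i j => by linarith [hxy i j]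
  have := h1 i m
  have := h1 i l
  field_simp

/-! ### `q`-Pochhammer symbols and geometric parameters -/

/-- The finite `q`-Pochhammer symbol `(z; q)_N`. -/
def qPochFin (z q : ℝ) (N : ℕ) : ℝ := ∏ k ∈ Finset.range N, (1 - z * q ^ k)

/-- The infinite `q`-Pochhammer symbol `(z; q)_∞`. -/
def qPoch (z q : ℝ) : ℝ := ∏' k : ℕ, (1 - z * q ^ k)

/-- The factor `q^(i (i + 1) / 2) / (q; q)_i`. -/
def qRes (q : ℝ) (i : ℕ) : ℝ := ∏ r ∈ Finset.range i, q ^ (r + 1) / (1 - q ^ (r + 1))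

section

variable {z q : ℝ}

theorem mul_pow_lt_one (hz : 0 ≤ z) (hz1 : z < 1) (hq : 0 ≤ q) (hq1 : q ≤ 1) (k : ℕ) :
    z * q ^ k < 1 :=
  (mul_le_of_le_one_right hz (pow_le_one₀ hq hq1)).trans_lt hz1

theorem qPochFin_pos (hz : 0 ≤ z) (hz1 : z < 1) (hq : 0 ≤ q) (hq1 : q ≤ 1) (N : ℕ) :
    0 < qPochFin z q N :=
  Finset.prod_pos fun k _ => sub_pos.2 (mul_pow_lt_one hz hz1 hq hq1 k)

theorem qPochFin_le_one (hz : 0 ≤ z) (hz1 : z < 1) (hq : 0 ≤ q) (hq1 : q ≤ 1) (N : ℕ) :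
    qPochFin z q N ≤ 1 :=
  Finset.prod_le_one (fun k _ => (sub_pos.2 (mul_pow_lt_one hz hz1 hq hq1 k)).le) fun k _ =>
    sub_le_self _ (mul_nonneg hz (pow_nonneg hq k))

theorem qPochFin_antitone (hz : 0 ≤ z) (hz1 : z < 1) (hq : 0 ≤ q) (hq1 : q ≤ 1) :
    Antitone (qPochFin z q) := by
  refine antitone_nat_of_succ_le fun N => ?_
  rw [qPochFin, Finset.prod_range_succ]
  exact mul_le_of_le_one_right (qPochFin_pos hz hz1 hq hq1 N).le
    (sub_le_self _ (mul_nonneg hz (pow_nonneg hq N)))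

theorem tendsto_qPochFin (hq : 0 ≤ q) (hq1 : q < 1) :
    Tendsto (qPochFin z q) atTop (𝓝 (qPoch z q)) := by
  have h : Summable fun k : ℕ => -(z * q ^ k) :=
    ((summable_geometric_of_lt_one hq hq1).mul_left z).neg
  have := (Real.multipliable_one_add_of_summable h).tendsto_prod_tprod_nat
  simp only [← sub_eq_add_neg] at this
  exact this

theorem qPoch_le_qPochFin (hz : 0 ≤ z) (hz1 : z < 1) (hq : 0 ≤ q) (hq1 : q < 1) (N : ℕ) :
    qPoch z q ≤ qPochFin z q N :=
  (qPochFin_antitone hz hz1 hq hq1.le).le_of_tendsto (tendsto_qPochFin hq hq1) N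

theorem qPoch_pos (hz : 0 ≤ z) (hz1 : z < 1) (hq : 0 ≤ q) (hq1 : q < 1) : 0 < qPoch z q := by
  refine lt_of_le_of_ne (ge_of_tendsto' (tendsto_qPochFin hq hq1) fun N =>
    (qPochFin_pos hz hz1 hq hq1.le N).le) (Ne.symm ?_)
  have h : Summable fun k : ℕ => ‖-(z * q ^ k)‖ :=
    (((summable_geometric_of_lt_one hq hq1).mul_left z).neg).norm
  have := tprod_one_add_ne_zero_of_summable (f := fun k : ℕ => -(z * q ^ k))
    (fun k => by linarith [mul_pow_lt_one hz hz1 hq hq1.le k]) h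
  simp only [← sub_eq_add_neg] at this
  exact this

theorem qRes_nonneg (hq : 0 ≤ q) (hq1 : q < 1) (i : ℕ) : 0 ≤ qRes q i :=
  Finset.prod_nonneg fun _ _ => div_nonneg (pow_nonneg hq _)
    (sub_nonneg.2 (pow_le_one₀ hq hq1.le))

theorem prod_pow_sub_eq_qPochFin (q : ℝ) (i : ℕ) :
    ∏ r ∈ Finset.range i, (1 - q ^ (r + 1)) = qPochFin q q i :=
  Finset.prod_congr rfl fun r _ => by rw [pow_succ']

theorem qRes_le (hq : 0 ≤ q) (hq1 : q < 1) (i : ℕ) : qRes q i ≤ 1 / qPoch q q := by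
  rw [qRes, Finset.prod_div_distrib, prod_pow_sub_eq_qPochFin]
  exact div_le_div₀ zero_le_one (Finset.prod_le_one (fun _ _ => pow_nonneg hq _)
    fun _ _ => pow_le_one₀ hq hq1.le) (qPoch_pos hq hq1 hq hq1) (qPoch_le_qPochFin hq hq1 hq hq1 i)

end

/-- The residue coefficients for a geometric progression of parameters. -/
theorem resCoeff_geometric {x0 y0 Q T : ℝ} (hx0 : x0 ≠ 0) (hQ : 0 < Q) (hQ1 : Q < 1) {N i : ℕ}
    (hi : i < N) :
    resCoeff N (fun i => x0 * Q ^ i) (fun j => y0 * T ^ j) i =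
      (-1) ^ (N - 1) * ((-1) ^ i * qRes Q i *
        (qPochFin (x0 * Q ^ i * y0) T N / qPochFin Q Q (N - 1 - i))) := by
  obtain ⟨M, rfl⟩ : ∃ M, N = i + (M + 1) := ⟨N - i - 1, by omega⟩
  have hM : i + (M + 1) - 1 = i + M := by omega
  have hM' : i + M - i = M := by omega
  have hnum : ∏ k ∈ Finset.range (i + (M + 1)), (1 - x0 * Q ^ i * (y0 * T ^ k)) =
      qPochFin (x0 * Q ^ i * y0) T (i + (M + 1)) :=
    Finset.prod_congr rfl fun k _ => by ring
  have hfac : ∀ k, x0 * Q ^ k / (x0 * Q ^ i) - 1 = Q ^ k / Q ^ i - 1 := fun k => by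
    rw [mul_div_mul_left _ _ hx0]
  -- the factors with `k < i` give `qRes Q i`, those with `k > i` a `q`-Pochhammer symbol
  have hsplit : ∏ k ∈ (Finset.range (i + (M + 1))).erase i, (Q ^ k / Q ^ i - 1) =
      (∏ k ∈ Finset.range i, (Q ^ k / Q ^ i - 1)) *
        ∏ k ∈ Finset.range M, (Q ^ (i + (k + 1)) / Q ^ i - 1) := by
    have h : ∀ k ∈ (Finset.range (i + (M + 1))).erase i, Q ^ k / Q ^ i - 1 =
        (fun k => if k = i then 1 else Q ^ k / Q ^ i - 1) k := fun k hk => by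
      simp [Finset.ne_of_mem_erase hk]
    rw [Finset.prod_congr rfl h, Finset.prod_erase _ (by simp), Finset.prod_range_add,
      Finset.prod_range_succ']
    simp only [Nat.add_zero, if_true, mul_one]
    congr 1
    · exact Finset.prod_congr rfl fun k hk => by simp [(Finset.mem_range.1 hk).ne]
    · exact Finset.prod_congr rfl fun k _ => by simp
  have hlow : (∏ k ∈ Finset.range i, (Q ^ k / Q ^ i - 1)) * qRes Q i = 1 := by
    rw [← Finset.prod_range_reflect, qRes, ← Finset.prod_mul_distrib]
    refine Finset.prod_eq_one fun r hr => ?_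
    have hr' := Finset.mem_range.1 hr
    have h2 : Q ^ i = Q ^ (i - 1 - r) * Q ^ (r + 1) := by rw [← pow_add]; congr 1; omega
    have h3 : 1 - Q ^ (r + 1) ≠ 0 := by
      rw [sub_ne_zero, Ne, eq_comm, pow_eq_one_iff_of_nonneg hQ.le (by omega)]
      exact hQ1.ne
    have := (pow_pos hQ (i - 1 - r)).ne'
    have := (pow_pos hQ (r + 1)).ne'
    rw [h2]
    field_simp
  have hhigh : ∏ k ∈ Finset.range M, (Q ^ (i + (k + 1)) / Q ^ i - 1) =
      (-1) ^ M * qPochFin Q Q M := by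
    rw [qPochFin, ← Finset.card_range M, ← Finset.prod_const, Finset.card_range,
      ← Finset.prod_mul_distrib]
    refine Finset.prod_congr rfl fun k _ => ?_
    have := (pow_pos hQ i).ne'
    rw [pow_add, mul_div_cancel_left₀ _ this]
    ring
  rw [resCoeff]
  simp only [hfac]
  rw [hnum, hsplit, hhigh, hM, hM', eq_inv_of_mul_eq_one_left hlow]
  have h1 : ((-1 : ℝ) ^ M) * (-1) ^ M = 1 := by rw [← mul_pow]; norm_num
  have h2 : ((-1 : ℝ) ^ i) * (-1) ^ i = 1 := by rw [← mul_pow]; norm_num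
  rw [div_eq_mul_inv, mul_inv, inv_inv, mul_inv, inv_eq_of_mul_eq_one_left h1, pow_add]
  linear_combination (-(-1) ^ M * qRes Q i * (qPochFin (x0 * Q ^ i * y0) T (i + (M + 1)) /
    qPochFin Q Q M)) * h2

/-! ### The infinite last passage problem -/

/-- The limit of the residue coefficients, up to sign, when the number of nodes tends to infinity;
here `z` stands for the product of the node with the first parameter of the other family. -/
def qCoeff (Q T z : ℝ) (i : ℕ) : ℝ := (-1) ^ i * qRes Q i * (qPoch z T / qPoch Q Q)

/-- A summand of the kernel of the infinite last passage problem, at the lattice site `(k, l)`. -/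
def latticeTerm (x0 y0 Q T : ℝ) (k l : ℕ) (p : ℕ × ℕ) : ℝ :=
  qCoeff Q T (x0 * Q ^ p.1 * y0) p.1 * qCoeff T Q (y0 * T ^ p.2 * x0) p.2 *
    ((x0 * Q ^ p.1) ^ k * (y0 * T ^ p.2) ^ l) / (1 - x0 * Q ^ p.1 * (y0 * T ^ p.2))

/-- The kernel, a step function of two real variables, whose Fredholm determinant on `(s, ∞)` is
the distribution function at `n` of the longest down-left path. -/
def latticeKernel (x0 y0 Q T : ℝ) (n : ℕ) (ε s u v : ℝ) : ℝ :=
  (∑' p, latticeTerm x0 y0 Q T (n + 1 + ⌊(u - s) / ε⌋₊) (n + 1 + ⌊(v - s) / ε⌋₊) p) / ε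

theorem measurable_comp_floor_floor {β : Type*} [MeasurableSpace β] (ε s : ℝ) (g : ℕ → ℕ → β) :
    Measurable (Function.uncurry fun u v : ℝ => g ⌊(u - s) / ε⌋₊ ⌊(v - s) / ε⌋₊) := by
  have h : Measurable fun p : ℝ × ℝ => (⌊(p.1 - s) / ε⌋₊, ⌊(p.2 - s) / ε⌋₊) :=
    ((measurable_floor_div ε s).comp measurable_fst).prodMk
      ((measurable_floor_div ε s).comp measurable_snd)
  exact (measurable_of_countable (Function.uncurry g)).comp h

section

variable {x0 y0 Q T : ℝ}

/-- The residue coefficients are bounded uniformly in the number of nodes. -/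
theorem abs_resCoeff_geometric_le (hx0 : 0 < x0) (hx1 : x0 < 1) (hy0 : 0 < y0) (hy1 : y0 < 1)
    (hQ : 0 < Q) (hQ1 : Q < 1) (hT : 0 < T) (hT1 : T < 1) {N i : ℕ} (hi : i < N) :
    |resCoeff N (fun i => x0 * Q ^ i) (fun j => y0 * T ^ j) i| ≤ (1 / qPoch Q Q) ^ 2 := by
  have hz : 0 ≤ x0 * Q ^ i * y0 := by positivity
  have hz1 : x0 * Q ^ i * y0 < 1 :=
    (mul_le_of_le_one_left hy0.le (mul_pow_lt_one hx0.le hx1 hQ.le hQ1.le i).le).trans_lt hy1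
  have hc := qPoch_pos hQ.le hQ1 hQ.le hQ1
  rw [resCoeff_geometric hx0.ne' hQ hQ1 hi, abs_mul, abs_mul, abs_mul, abs_pow, abs_pow, abs_neg,
    abs_one, one_pow, one_pow, one_mul, one_mul, sq, abs_of_nonneg (qRes_nonneg hQ.le hQ1 i),
    abs_of_nonneg (div_nonneg (qPochFin_pos hz hz1 hT.le hT1.le N).le
      (qPochFin_pos hQ.le hQ1 hQ.le hQ1.le _).le)]
  exact mul_le_mul (qRes_le hQ.le hQ1 i) (div_le_div₀ zero_le_one
    (qPochFin_le_one hz hz1 hT.le hT1.le N) hc (qPoch_le_qPochFin hQ.le hQ1 hQ.le hQ1 _))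
    (div_nonneg (qPochFin_pos hz hz1 hT.le hT1.le N).le
      (qPochFin_pos hQ.le hQ1 hQ.le hQ1.le _).le) (by positivity)

/-- The signs `(-1)^(N - 1)` of the two residue coefficients cancel in their product, which
therefore converges. -/
theorem tendsto_resCoeff_mul_resCoeff (hx0 : x0 ≠ 0) (hy0 : y0 ≠ 0)
    (hQ : 0 < Q) (hQ1 : Q < 1) (hT : 0 < T) (hT1 : T < 1) (i m : ℕ) :
    Tendsto (fun N => resCoeff N (fun i => x0 * Q ^ i) (fun j => y0 * T ^ j) i *
      resCoeff N (fun j => y0 * T ^ j) (fun i => x0 * Q ^ i) m) atTop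
      (𝓝 (qCoeff Q T (x0 * Q ^ i * y0) i * qCoeff T Q (y0 * T ^ m * x0) m)) := by
  have h : ∀ {Q T : ℝ} (_ : 0 < Q) (_ : Q < 1) (_ : 0 < T) (_ : T < 1) (z : ℝ) (i : ℕ),
      Tendsto (fun N => (-1) ^ i * qRes Q i * (qPochFin z T N / qPochFin Q Q (N - 1 - i))) atTop
        (𝓝 (qCoeff Q T z i)) := fun hQ hQ1 hT hT1 z i =>
    ((tendsto_qPochFin hT.le hT1).div ((tendsto_qPochFin hQ.le hQ1).comp
      ((tendsto_sub_atTop_nat i).comp (tendsto_sub_atTop_nat 1)))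
      (qPoch_pos hQ.le hQ1 hQ.le hQ1).ne').const_mul _
  refine ((h hQ hQ1 hT hT1 (x0 * Q ^ i * y0) i).mul
    (h hT hT1 hQ hQ1 (y0 * T ^ m * x0) m)).congr' ?_
  filter_upwards [eventually_gt_atTop i, eventually_gt_atTop m] with N hi hm
  rw [resCoeff_geometric hx0 hQ hQ1 hi, resCoeff_geometric hy0 hT hT1 hm]
  have h1 : ((-1 : ℝ) ^ (N - 1)) * (-1) ^ (N - 1) = 1 := by rw [← mul_pow]; norm_num
  linear_combination (-((-1) ^ i * qRes Q i * (qPochFin (x0 * Q ^ i * y0) T N /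
    qPochFin Q Q (N - 1 - i))) * ((-1) ^ m * qRes T m * (qPochFin (y0 * T ^ m * x0) Q N /
    qPochFin T T (N - 1 - m)))) * h1

theorem pow_add_le_mul_pow (hx0 : 0 < x0) (hx1 : x0 < 1) (hQ : 0 < Q) (hQ1 : Q < 1) (n i a : ℕ) :
    (x0 * Q ^ i) ^ (n + 1 + a) ≤ Q ^ i * x0 ^ a := by
  have h1 : (x0 * Q ^ i) ^ (n + 1 + a) ≤ (x0 * Q ^ i) ^ (1 + a) :=
    pow_le_pow_of_le_one (by positivity) (mul_pow_lt_one hx0.le hx1 hQ.le hQ1.le i).le (by omega)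
  refine h1.trans ?_
  rw [mul_pow, pow_add x0, pow_one, pow_add (Q ^ i), pow_one]
  have h2 : (Q ^ i) ^ a ≤ 1 := pow_le_one₀ (by positivity) (pow_le_one₀ hQ.le hQ1.le)
  have h3 : 0 < (Q ^ i) ^ a := by positivity
  have h4 : 0 < Q ^ i := by positivity
  have h5 : 0 < x0 ^ a := by positivity
  calc x0 * x0 ^ a * (Q ^ i * (Q ^ i) ^ a) = (x0 * (Q ^ i) ^ a) * (Q ^ i * x0 ^ a) := by ring
    _ ≤ 1 * (Q ^ i * x0 ^ a) := by
      gcongr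
      exact mul_le_one₀ hx1.le h3.le h2
    _ = _ := one_mul _

/-- A bound on the summands of the step kernel, uniform in the number of nodes. -/
theorem abs_stepTerm_le (hx0 : 0 < x0) (hx1 : x0 < 1) (hy0 : 0 < y0) (hy1 : y0 < 1)
    (hQ : 0 < Q) (hQ1 : Q < 1) (hT : 0 < T) (hT1 : T < 1) {N i m : ℕ} (hi : i < N) (hm : m < N)
    (n a b : ℕ) {ε : ℝ} (hε : 0 < ε) :
    |resCoeff N (fun i => x0 * Q ^ i) (fun j => y0 * T ^ j) i *
      resCoeff N (fun j => y0 * T ^ j) (fun i => x0 * Q ^ i) m *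
      ((x0 * Q ^ i) ^ (n + 1 + a) * (y0 * T ^ m) ^ (n + 1 + b)) /
        ((1 - x0 * Q ^ i * (y0 * T ^ m)) * ε)| ≤
    (1 / qPoch Q Q) ^ 2 * (1 / qPoch T T) ^ 2 * ((Q ^ i * x0 ^ a) * (T ^ m * y0 ^ b)) /
      ((1 - x0 * y0) * ε) := by
  have hxy : x0 * y0 < 1 := (mul_le_of_le_one_left hy0.le hx1.le).trans_lt hy1
  have h1 : x0 * Q ^ i * (y0 * T ^ m) ≤ x0 * y0 :=
    mul_le_mul (mul_le_of_le_one_right hx0.le (pow_le_one₀ hQ.le hQ1.le))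
      (mul_le_of_le_one_right hy0.le (pow_le_one₀ hT.le hT1.le)) (by positivity) hx0.le
  have h2 : 0 < (1 - x0 * Q ^ i * (y0 * T ^ m)) := by linarith
  rw [abs_div, abs_mul, abs_mul, abs_of_pos (mul_pos h2 hε),
    abs_of_pos (show 0 < (x0 * Q ^ i) ^ (n + 1 + a) * (y0 * T ^ m) ^ (n + 1 + b) by positivity)]
  refine div_le_div₀ (by positivity) ?_ (mul_pos (sub_pos.2 hxy) hε)
    (mul_le_mul_of_nonneg_right (by linarith) hε.le)
  refine mul_le_mul (mul_le_mul (abs_resCoeff_geometric_le hx0 hx1 hy0 hy1 hQ hQ1 hT hT1 hi)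
    (abs_resCoeff_geometric_le hy0 hy1 hx0 hx1 hT hT1 hQ hQ1 hm) (abs_nonneg _) (by positivity))
    ?_ (by positivity) (by positivity)
  exact mul_le_mul (pow_add_le_mul_pow hx0 hx1 hQ hQ1 n i a)
    (pow_add_le_mul_pow hy0 hy1 hT hT1 n m b)
    (by positivity) (by positivity)

theorem stepKernel_eq_tsum (x y : ℕ → ℝ) (N n : ℕ) (ε s u v : ℝ) :
    stepKernel x y N n ε s u v = ∑' p : ℕ × ℕ, if p.1 < N ∧ p.2 < N then
      resCoeff N x y p.1 * resCoeff N y x p.2 *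
      (x p.1 ^ (n + 1 + ⌊(u - s) / ε⌋₊) * y p.2 ^ (n + 1 + ⌊(v - s) / ε⌋₊)) /
        ((1 - x p.1 * y p.2) * ε) else 0 := by
  rw [tsum_eq_sum (s := Finset.range N ×ˢ Finset.range N)]
  · rw [Finset.sum_product, stepKernel]
    refine Finset.sum_congr rfl fun i hi => Finset.sum_congr rfl fun m hm => ?_
    rw [if_pos ⟨Finset.mem_range.1 hi, Finset.mem_range.1 hm⟩]
  · intro p hp
    rw [if_neg]
    simpa [Finset.mem_product] using hp

theorem summable_pow_mul_pow (hQ : 0 < Q) (hQ1 : Q < 1) (hT : 0 < T) (hT1 : T < 1) :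
    Summable fun p : ℕ × ℕ => Q ^ p.1 * T ^ p.2 :=
  (summable_geometric_of_lt_one hQ.le hQ1).mul_of_nonneg (summable_geometric_of_lt_one hT.le hT1)
    (fun _ => by positivity) fun _ => by positivity

/-- The kernels of the squares converge to the kernel of the infinite problem, by dominated
convergence of the double sum. -/
theorem tendsto_stepKernel (hx0 : 0 < x0) (hx1 : x0 < 1) (hy0 : 0 < y0) (hy1 : y0 < 1)
    (hQ : 0 < Q) (hQ1 : Q < 1) (hT : 0 < T) (hT1 : T < 1) (n : ℕ) {ε : ℝ} (hε : 0 < ε)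
    (s u v : ℝ) :
    Tendsto (fun N => stepKernel (fun i => x0 * Q ^ i) (fun j => y0 * T ^ j) N n ε s u v) atTop
      (𝓝 (latticeKernel x0 y0 Q T n ε s u v)) := by
  simp only [stepKernel_eq_tsum, latticeKernel, ← tsum_div_const]
  generalize ⌊(u - s) / ε⌋₊ = a
  generalize ⌊(v - s) / ε⌋₊ = b
  have hxy : x0 * y0 < 1 := (mul_le_of_le_one_left hy0.le hx1.le).trans_lt hy1
  set M := (1 / qPoch Q Q) ^ 2 * (1 / qPoch T T) ^ 2 * (x0 ^ a * y0 ^ b) / ((1 - x0 * y0) * ε)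
    with hM
  have hM0 : 0 ≤ M := div_nonneg (by positivity) (mul_pos (sub_pos.2 hxy) hε).le
  refine tendsto_tsum_of_dominated_convergence (bound := fun p => M * (Q ^ p.1 * T ^ p.2))
    ((summable_pow_mul_pow hQ hQ1 hT hT1).mul_left M) (fun p => ?_)
    (Eventually.of_forall fun N p => ?_)
  · have h := ((tendsto_resCoeff_mul_resCoeff hx0.ne' hy0.ne' hQ hQ1 hT hT1 p.1 p.2).mul_const
      ((x0 * Q ^ p.1) ^ (n + 1 + a) * (y0 * T ^ p.2) ^ (n + 1 + b))).div_const
      ((1 - x0 * Q ^ p.1 * (y0 * T ^ p.2)) * ε)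
    rw [latticeTerm, div_div]
    refine h.congr' ?_
    filter_upwards [eventually_gt_atTop p.1, eventually_gt_atTop p.2] with N hi hm
    rw [if_pos ⟨hi, hm⟩]
  · rw [Real.norm_eq_abs]
    split_ifs with h
    · refine (abs_stepTerm_le hx0 hx1 hy0 hy1 hQ hQ1 hT hT1 h.1 h.2 n a b hε).trans_eq ?_
      rw [hM]
      ring
    · rw [abs_zero]
      positivity

/-- The distribution function of the longest down-left path is a Fredholm determinant. -/
theorem measureReal_lppDownLeft_le_eq {Ω : Type*} [MeasurableSpace Ω] {P : Measure Ω}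
    [IsProbabilityMeasure P] {w : ℕ × ℕ → Ω → ℕ}
    (hw : IsProductGeoField P w (fun i => x0 * Q ^ i) (fun j => y0 * T ^ j))
    (hx0 : 0 < x0) (hx1 : x0 < 1) (hy0 : 0 < y0) (hy1 : y0 < 1)
    (hQ : 0 < Q) (hQ1 : Q < 1) (hT : 0 < T) (hT1 : T < 1) (n : ℕ) {ε : ℝ} (hε : 0 < ε) (s : ℝ) :
    (P.real {ω | (lppDownLeft fun p => w p ω) ≤ n} : ℂ) =
      fredholmDet (fun u v => (latticeKernel x0 y0 Q T n ε s u v : ℂ)) (Set.Ioi s) := by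
  have hxy : x0 * y0 < 1 := (mul_le_of_le_one_left hy0.le hx1.le).trans_lt hy1
  have hinj : ∀ {z r : ℝ}, 0 < z → 0 < r → r < 1 → Function.Injective fun i : ℕ => z * r ^ i :=
    fun hz hr hr1 i j hij =>
      (pow_right_strictAnti₀ hr hr1).injective (mul_left_cancel₀ hz.ne' hij)
  have hfin := fun N => measureReal_lpp_le_eq_fredholmDet hw (fun i => by positivity)
    (fun j => by positivity) (fun i j => mul_lt_one_of_nonneg_of_lt_one_left
      (mul_nonneg hx0.le (by positivity)) (mul_pow_lt_one hx0.le hx1 hQ.le hQ1.le i)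
      (mul_pow_lt_one hy0.le hy1 hT.le hT1.le j).le)
    (hinj hx0 hQ hQ1) (hinj hy0 hT hT1) N n hε s
  have h1 : Tendsto (fun N => (P.real {ω | lpp (fun p => w p ω) N N ≤ n} : ℂ)) atTop
      (𝓝 (P.real {ω | (lppDownLeft fun p => w p ω) ≤ n} : ℂ)) :=
    (Complex.continuous_ofReal.tendsto _).comp
      ((ENNReal.tendsto_toReal (measure_ne_top P _)).comp (tendsto_measure_lpp_le hw.measurable n))
  refine tendsto_nhds_unique h1 ?_
  simp only [hfin]
  -- the largest parameter governs the decay of all the kernels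
  set r := max x0 y0 with hr
  have hr0 : 0 < r := hx0.trans_le (le_max_left _ _)
  have hr1 : r < 1 := max_lt hx1 hy1
  set M := (1 / qPoch Q Q) ^ 2 * (1 / qPoch T T) ^ 2 / ((1 - x0 * y0) * ε) *
    ∑' p : ℕ × ℕ, Q ^ p.1 * T ^ p.2 with hM
  have hden : 0 < (1 - x0 * y0) * ε := mul_pos (sub_pos.2 hxy) hε
  have hM0 : 0 ≤ M := mul_nonneg (by positivity) (tsum_nonneg fun p => by positivity)
  refine tendsto_fredholmDet (f := fun u => √M * r ^ ⌊(u - s) / ε⌋₊) measurableSet_Ioi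
    (fun u _ => by positivity) ?_ (Eventually.of_forall fun N u _ v _ => ?_)
    (Eventually.of_forall fun N => ?_)
    fun u _ v _ => tendsto_stepKernel hx0 hx1 hy0 hy1 hQ hQ1 hT hT1 n hε s u v
  · refine ((integrableOn_pow_floor (s := s) hε (sq_pos_of_pos hr0)
      (pow_lt_one₀ hr0.le hr1 two_ne_zero)).const_mul (√M ^ 2)).congr
      (Eventually.of_forall fun u => ?_)
    simp only
    rw [mul_pow, ← pow_mul, ← pow_mul, mul_comm 2]
  · rw [stepKernel]
    generalize ⌊(u - s) / ε⌋₊ = a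
    generalize ⌊(v - s) / ε⌋₊ = b
    have hMM : √M * r ^ a * (√M * r ^ b) = M * (r ^ a * r ^ b) := by
      linear_combination (r ^ a * r ^ b) * Real.mul_self_sqrt hM0
    rw [hMM]
    refine (Finset.abs_sum_le_sum_abs _ _).trans ((Finset.sum_le_sum fun i _ =>
      Finset.abs_sum_le_sum_abs _ _).trans ((Finset.sum_le_sum fun i hi => Finset.sum_le_sum
      fun m hm => abs_stepTerm_le hx0 hx1 hy0 hy1 hQ hQ1 hT hT1 (Finset.mem_range.1 hi)
        (Finset.mem_range.1 hm) n a b hε).trans ?_))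
    have h2 : ∑ i ∈ Finset.range N, ∑ m ∈ Finset.range N, Q ^ i * T ^ m ≤
        ∑' p : ℕ × ℕ, Q ^ p.1 * T ^ p.2 := by
      rw [← Finset.sum_product' (f := fun i m => Q ^ i * T ^ m)]
      exact (summable_pow_mul_pow hQ hQ1 hT hT1).sum_le_tsum _ fun p _ => by positivity
    have h3 : x0 ^ a * y0 ^ b ≤ r ^ a * r ^ b := by
      gcongr
      · exact le_max_left _ _
      · exact le_max_right _ _
    calc _ = (1 / qPoch Q Q) ^ 2 * (1 / qPoch T T) ^ 2 / ((1 - x0 * y0) * ε) *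
          (∑ i ∈ Finset.range N, ∑ m ∈ Finset.range N, Q ^ i * T ^ m) * (x0 ^ a * y0 ^ b) := by
          simp only [Finset.mul_sum, Finset.sum_mul]
          refine Finset.sum_congr rfl fun i _ => Finset.sum_congr rfl fun m _ => ?_
          ring
      _ ≤ M * (r ^ a * r ^ b) := by
          refine mul_le_mul (mul_le_mul_of_nonneg_left h2 (by positivity)) h3 (by positivity) hM0
  · exact measurable_comp_floor_floor ε s fun a b =>
      ∑ i ∈ Finset.range N, ∑ m ∈ Finset.range N,
        resCoeff N (fun i => x0 * Q ^ i) (fun j => y0 * T ^ j) i *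
        resCoeff N (fun j => y0 * T ^ j) (fun i => x0 * Q ^ i) m *
        ((x0 * Q ^ i) ^ (n + 1 + a) * (y0 * T ^ m) ^ (n + 1 + b)) /
          ((1 - x0 * Q ^ i * (y0 * T ^ m)) * ε)

end

/-! ### The `q`-Gamma function -/

/-- The `q`-number `[z]_q = (1 - q^z) / (1 - q)`. -/
def qNum (q z : ℝ) : ℝ := (1 - q ^ z) / (1 - q)

/-- The reciprocal `1 / Γ_q(z) = (1 - q)^(z - 1) (q^z; q)_∞ / (q; q)_∞` of the `q`-Gamma
function. -/
def qGammaInv (q z : ℝ) : ℝ := (1 - q) ^ (z - 1) * (qPoch (q ^ z) q / qPoch q q)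

theorem qPoch_eq_mul (z : ℝ) {q : ℝ} (hq : 0 ≤ q) (hq1 : q < 1) :
    qPoch z q = (1 - z) * qPoch (z * q) q := by
  refine tendsto_nhds_unique ((tendsto_qPochFin (z := z) hq hq1).comp (tendsto_add_atTop_nat 1))
    (((tendsto_qPochFin (z := z * q) hq hq1).const_mul (1 - z)).congr fun N => ?_)
  simp only [Function.comp, qPochFin]
  rw [Finset.prod_range_succ', pow_zero, mul_one, mul_comm]
  congr 1
  exact Finset.prod_congr rfl fun k _ => by ring

theorem tendsto_qNum (z : ℝ) : Tendsto (fun q => qNum q z) (𝓝[<] 1) (𝓝 z) := by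
  have h := hasDerivAt_iff_tendsto_slope.1 (Real.hasDerivAt_rpow_const (x := 1) (p := z)
    (Or.inl one_ne_zero))
  rw [Real.one_rpow, mul_one] at h
  refine (h.mono_left (nhdsWithin_mono _ fun x (hx : x < 1) => hx.ne)).congr fun q => ?_
  rw [slope_def_field, Real.one_rpow, qNum, ← neg_sub, ← neg_sub 1 q, neg_div_neg_eq]

section

variable {q z : ℝ}

theorem rpow_mem_Ioo (hq : 0 < q) (hq1 : q < 1) (hz : 0 < z) : 0 < q ^ z ∧ q ^ z < 1 :=
  ⟨Real.rpow_pos_of_pos hq z, Real.rpow_lt_one hq.le hq1 hz⟩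

theorem qNum_pos (hq : 0 < q) (hq1 : q < 1) (hz : 0 < z) : 0 < qNum q z :=
  div_pos (sub_pos.2 (rpow_mem_Ioo hq hq1 hz).2) (sub_pos.2 hq1)

theorem qNum_one (hq1 : q < 1) : qNum q 1 = 1 := by
  rw [qNum, Real.rpow_one, div_self (sub_pos.2 hq1).ne']

theorem qNum_mono (hq : 0 < q) (hq1 : q < 1) : Monotone (qNum q) := fun _ _ h =>
  div_le_div_of_nonneg_right (sub_le_sub_left (Real.rpow_le_rpow_of_exponent_ge hq hq1.le h) 1)
    (sub_pos.2 hq1).le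

theorem qNum_two_le (hq1 : q < 1) : qNum q 2 ≤ 2 := by
  rw [qNum, div_le_iff₀ (sub_pos.2 hq1), Real.rpow_two]
  nlinarith

theorem qGammaInv_pos (hq : 0 < q) (hq1 : q < 1) (hz : 0 < z) : 0 < qGammaInv q z :=
  mul_pos (Real.rpow_pos_of_pos (sub_pos.2 hq1) _) (div_pos
    (qPoch_pos (rpow_mem_Ioo hq hq1 hz).1.le (rpow_mem_Ioo hq hq1 hz).2 hq.le hq1)
    (qPoch_pos hq.le hq1 hq.le hq1))

theorem qGammaInv_one (hq : 0 < q) (hq1 : q < 1) : qGammaInv q 1 = 1 := by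
  rw [qGammaInv, sub_self, Real.rpow_zero, Real.rpow_one, one_mul,
    div_self (qPoch_pos hq.le hq1 hq.le hq1).ne']

/-- The functional equation `Γ_q(z + 1) = [z]_q Γ_q(z)`. -/
theorem qGammaInv_eq_mul (hq : 0 < q) (hq1 : q < 1) (z : ℝ) :
    qGammaInv q z = qNum q z * qGammaInv q (z + 1) := by
  have h : 0 < 1 - q := sub_pos.2 hq1
  rw [qGammaInv, qGammaInv, qNum, qPoch_eq_mul _ hq.le hq1, Real.rpow_add hq, Real.rpow_one,
    show z + 1 - 1 = (z - 1) + 1 by ring, Real.rpow_add h (z - 1), Real.rpow_one]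
  field_simp

theorem qGammaInv_eq_prod_mul (hq : 0 < q) (hq1 : q < 1) (z : ℝ) (n : ℕ) :
    qGammaInv q z = (∏ j ∈ Finset.range n, qNum q (z + j)) * qGammaInv q (z + n) := by
  induction n with
  | zero => simp
  | succ n ih =>
    rw [ih, Finset.prod_range_succ, qGammaInv_eq_mul hq hq1 (z + n)]
    push_cast
    ring_nf

/-- The reciprocal of the `q`-Gamma function is logarithmically concave: each factor of the product
is, by the weighted inequality of arithmetic and geometric means. -/
theorem qGammaInv_logConcave (hq : 0 < q) (hq1 : q < 1) {a b s t : ℝ} (ha : 0 < a) (hb : 0 < b)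
    (hs : 0 ≤ s) (ht : 0 ≤ t) (hst : s + t = 1) :
    qGammaInv q a ^ s * qGammaInv q b ^ t ≤ qGammaInv q (s * a + t * b) := by
  have h1 : 0 < 1 - q := sub_pos.2 hq1
  have hfac : ∀ k : ℕ, (1 - q ^ a * q ^ k) ^ s * (1 - q ^ b * q ^ k) ^ t ≤
      1 - q ^ (s * a + t * b) * q ^ k := by
    intro k
    obtain ⟨ha0, ha1⟩ := rpow_mem_Ioo hq hq1 ha
    obtain ⟨hb0, hb1⟩ := rpow_mem_Ioo hq hq1 hb
    have hA := mul_pow_lt_one ha0.le ha1 hq.le hq1.le k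
    have hB := mul_pow_lt_one hb0.le hb1 hq.le hq1.le k
    have hk : 0 < q ^ k := pow_pos hq k
    have e1 := Real.geom_mean_le_arith_mean2_weighted hs ht (sub_pos.2 hA).le (sub_pos.2 hB).le hst
    have e2 := Real.geom_mean_le_arith_mean2_weighted hs ht (mul_pos ha0 hk).le (mul_pos hb0 hk).le
      hst
    have e3 : (q ^ a * q ^ k) ^ s * (q ^ b * q ^ k) ^ t = q ^ (s * a + t * b) * q ^ k := by
      rw [Real.mul_rpow ha0.le hk.le, Real.mul_rpow hb0.le hk.le, Real.rpow_add hq,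
        ← Real.rpow_mul hq.le, ← Real.rpow_mul hq.le, mul_comm a s, mul_comm b t]
      have : (q ^ k) ^ s * (q ^ k) ^ t = q ^ k := by
        rw [← Real.rpow_add hk, hst, Real.rpow_one]
      linear_combination (q ^ (s * a) * q ^ (t * b)) * this
    rw [e3] at e2
    nlinarith
  have hpos : ∀ {z : ℝ}, 0 < z → ∀ k : ℕ, 0 < 1 - q ^ z * q ^ k := fun hz k =>
    sub_pos.2
      (mul_pow_lt_one (rpow_mem_Ioo hq hq1 hz).1.le (rpow_mem_Ioo hq hq1 hz).2 hq.le hq1.le k)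
  have hP : qPoch (q ^ a) q ^ s * qPoch (q ^ b) q ^ t ≤ qPoch (q ^ (s * a + t * b)) q := by
    refine le_of_tendsto_of_tendsto' (((tendsto_qPochFin hq.le hq1).rpow_const (Or.inr hs)).mul
      ((tendsto_qPochFin hq.le hq1).rpow_const (Or.inr ht)))
      (tendsto_qPochFin hq.le hq1) fun N => ?_
    simp only [qPochFin]
    rw [← Real.finsetProd_rpow _ _ (fun k _ => (hpos ha k).le),
      ← Real.finsetProd_rpow _ _ (fun k _ => (hpos hb k).le), ← Finset.prod_mul_distrib]
    exact Finset.prod_le_prod (fun k _ => mul_nonneg (Real.rpow_nonneg (hpos ha k).le _)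
      (Real.rpow_nonneg (hpos hb k).le _)) fun k _ => hfac k
  have hc := qPoch_pos hq.le hq1 hq.le hq1
  have hQ : ∀ {z : ℝ}, 0 < z → 0 < qPoch (q ^ z) q := fun hz =>
    qPoch_pos (rpow_mem_Ioo hq hq1 hz).1.le (rpow_mem_Ioo hq hq1 hz).2 hq.le hq1
  have hcc : qPoch q q ^ s * qPoch q q ^ t = qPoch q q := by
    rw [← Real.rpow_add hc, hst, Real.rpow_one]
  rw [qGammaInv, qGammaInv, qGammaInv, Real.mul_rpow (Real.rpow_nonneg h1.le _)
    (div_pos (hQ ha) hc).le, Real.mul_rpow (Real.rpow_nonneg h1.le _) (div_pos (hQ hb) hc).le,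
    ← Real.rpow_mul h1.le, ← Real.rpow_mul h1.le, Real.div_rpow (hQ ha).le hc.le,
    Real.div_rpow (hQ hb).le hc.le]
  have e : (1 - q) ^ (s * a + t * b - 1) = (1 - q) ^ ((a - 1) * s) * (1 - q) ^ ((b - 1) * t) := by
    rw [← Real.rpow_add h1]
    congr 1
    linear_combination hst
  calc _ = ((1 - q) ^ ((a - 1) * s) * (1 - q) ^ ((b - 1) * t)) *
        ((qPoch (q ^ a) q ^ s * qPoch (q ^ b) q ^ t) / (qPoch q q ^ s * qPoch q q ^ t)) := by
        rw [mul_div_mul_comm]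
        ring
    _ ≤ _ := by
        rw [hcc, e]
        gcongr

theorem qGammaInv_add_ge (hq : 0 < q) (hq1 : q < 1) {a t : ℝ} (ha : 0 < a) (ht : 0 ≤ t)
    (ht1 : t ≤ 1) : qGammaInv q a * (qNum q a ^ t)⁻¹ ≤ qGammaInv q (a + t) := by
  have h := qGammaInv_logConcave hq hq1 ha (show 0 < a + 1 by linarith) (sub_nonneg.2 ht1) ht
    (by ring)
  rw [show (1 - t) * a + t * (a + 1) = a + t by ring] at h
  refine le_trans (le_of_eq ?_) h
  have hG := qGammaInv_pos hq hq1 ha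
  have hG1 : qGammaInv q (a + 1) = qGammaInv q a / qNum q a := by
    rw [qGammaInv_eq_mul hq hq1 a, mul_div_cancel_left₀ _ (qNum_pos hq hq1 ha).ne']
  rw [hG1, Real.div_rpow hG.le (qNum_pos hq hq1 ha).le, div_eq_mul_inv, ← mul_assoc,
    ← Real.rpow_add hG, sub_add_cancel, Real.rpow_one]

theorem qGammaInv_add_le (hq : 0 < q) (hq1 : q < 1) {a t : ℝ} (ha : 0 < a) (ht : 0 ≤ t) :
    qGammaInv q (a + 1 + t) ≤ qGammaInv q (a + 1) * (qNum q a ^ t)⁻¹ := by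
  have ht1 : 0 < 1 + t := by linarith
  -- `a + 1` is a convex combination of `a` and `a + 1 + t`
  have h := qGammaInv_logConcave hq hq1 (show 0 < a + 1 + t by linarith) ha
    (s := 1 / (1 + t)) (t := t / (1 + t)) (by positivity) (by positivity) (by field_simp)
  rw [show 1 / (1 + t) * (a + 1 + t) + t / (1 + t) * a = a + 1 by field_simp; ring] at h
  have hG := qGammaInv_pos hq hq1 ha
  have hG1 := qGammaInv_pos hq hq1 (show 0 < a + 1 by linarith)
  have hGt := qGammaInv_pos hq hq1 (show 0 < a + 1 + t by linarith)
  have h2 := Real.rpow_le_rpow (by positivity) h ht1.le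
  rw [Real.mul_rpow (by positivity) (by positivity), ← Real.rpow_mul hGt.le,
    ← Real.rpow_mul hG.le, div_mul_cancel₀ _ ht1.ne', div_mul_cancel₀ _ ht1.ne', Real.rpow_one,
    Real.rpow_add hG1, Real.rpow_one, qGammaInv_eq_mul hq hq1 a,
    Real.mul_rpow (qNum_pos hq hq1 ha).le hG1.le] at h2
  have hN : 0 < qNum q a ^ t := Real.rpow_pos_of_pos (qNum_pos hq hq1 ha) t
  have hGG : 0 < qGammaInv q (a + 1) ^ t := Real.rpow_pos_of_pos hG1 t
  rw [← div_eq_mul_inv, le_div_iff₀ hN]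
  refine le_of_mul_le_mul_right ?_ hGG
  linarith

/-- The reciprocal of the `q`-Gamma function is bounded uniformly in `q`. -/
theorem qGammaInv_le_two (hq : 0 < q) (hq1 : q < 1) (hz : 0 < z) : qGammaInv q z ≤ 2 := by
  have h2 : qGammaInv q 2 = 1 := by
    have := qGammaInv_eq_mul hq hq1 1
    rw [qGammaInv_one hq hq1, qNum_one hq1, one_mul] at this
    rw [this]; norm_num
  -- the reciprocal of `Γ_q` is at most one on `[2, ∞)`
  have hge : ∀ t : ℝ, 0 ≤ t → qGammaInv q (2 + t) ≤ 1 := fun t ht => by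
    have := qGammaInv_add_le hq hq1 one_pos ht
    rwa [qNum_one hq1, Real.one_rpow, inv_one, mul_one, show (1 : ℝ) + 1 = 2 by norm_num, h2]
      at this
  have h12 : ∀ z : ℝ, 1 ≤ z → qGammaInv q z ≤ 2 := fun z hz => by
    rcases le_total 2 z with h | h
    · have := hge (z - 2) (by linarith)
      rw [add_sub_cancel] at this
      linarith
    · rw [qGammaInv_eq_mul hq hq1]
      have e1 := hge (z - 1) (by linarith)
      rw [show 2 + (z - 1) = z + 1 by ring] at e1
      have e2 := (qNum_mono hq hq1 h).trans (qNum_two_le hq1)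
      have e3 := qGammaInv_pos hq hq1 (show 0 < z + 1 by linarith)
      have e4 := qNum_pos hq hq1 (show 0 < z by linarith)
      nlinarith
  rcases le_total 1 z with h | h
  · exact h12 z h
  · rw [qGammaInv_eq_mul hq hq1]
    have e1 := h12 (z + 1) (by linarith)
    have e2 := (qNum_mono hq hq1 h).trans_eq (qNum_one hq1)
    have e3 := qGammaInv_pos hq hq1 (show 0 < z + 1 by linarith)
    have e4 := qNum_pos hq hq1 hz
    nlinarith

end

theorem qGammaInv_natCast {q : ℝ} (hq : 0 < q) (hq1 : q < 1) (n : ℕ) :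
    qGammaInv q (n + 1) = (∏ j ∈ Finset.range n, qNum q (1 + j))⁻¹ := by
  have h := qGammaInv_eq_prod_mul hq hq1 1 n
  rw [qGammaInv_one hq hq1, add_comm (1 : ℝ) n] at h
  exact eq_inv_of_mul_eq_one_right h.symm

/-- The `q`-Gamma function tends to the Gamma function as `q → 1`, on `(0, 1]`: it is squeezed
between products of `q`-numbers, whose limits are terms of the Euler–Gauss sequence of `Γ`. -/
theorem tendsto_qGammaInv_aux {z : ℝ} (hz : 0 < z) (hz1 : z ≤ 1) :
    Tendsto (fun q => qGammaInv q z) (𝓝[<] 1) (𝓝 (Real.Gamma z)⁻¹) := by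
  have hΓ := Real.Gamma_pos_of_pos hz
  have hev : ∀ᶠ q : ℝ in 𝓝[<] 1, 0 < q ∧ q < 1 := Ioo_mem_nhdsLT one_pos
  have hprod : ∀ n : ℕ, Tendsto (fun q => ∏ j ∈ Finset.range n, qNum q (z + j)) (𝓝[<] 1)
      (𝓝 (∏ j ∈ Finset.range n, (z + j))) := fun n =>
    tendsto_finsetProd _ fun j _ => tendsto_qNum _
  have hfact : ∀ n : ℕ, Tendsto (fun q => qGammaInv q (n + 1)) (𝓝[<] 1) (𝓝 (n ! : ℝ)⁻¹) := by
    intro n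
    have h : Tendsto (fun q => (∏ j ∈ Finset.range n, qNum q (1 + j))⁻¹) (𝓝[<] 1)
        (𝓝 (∏ j ∈ Finset.range n, (1 + (j : ℝ)))⁻¹) := by
      refine (tendsto_finsetProd _ fun j _ => tendsto_qNum _).inv₀ ?_
      exact Finset.prod_ne_zero_iff.2 fun j _ => by positivity
    have e : ∏ j ∈ Finset.range n, (1 + (j : ℝ)) = n ! := by
      rw [← Finset.prod_range_add_one_eq_factorial]
      push_cast
      exact Finset.prod_congr rfl fun j _ => add_comm _ _
    rw [e] at h
    refine h.congr' ?_
    filter_upwards [hev] with q hq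
    rw [qGammaInv_natCast hq.1 hq.2]
  have hpow : ∀ n : ℕ, Tendsto (fun q => (qNum q (n + 1) ^ z)⁻¹) (𝓝[<] 1)
      (𝓝 (((n : ℝ) + 1) ^ z)⁻¹) := fun n =>
    ((tendsto_qNum _).rpow_const (Or.inr hz.le)).inv₀ (by positivity)
  have hseq := (Real.GammaSeq_tendsto_Gamma z).inv₀ hΓ.ne'
  have hseq1 := hseq.comp (tendsto_add_atTop_nat 1)
  refine tendsto_order.2 ⟨fun a ha => ?_, fun a ha => ?_⟩
  · have hl : Tendsto (fun n : ℕ => (∏ j ∈ Finset.range (n + 1), (z + j)) *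
        ((n ! : ℝ)⁻¹ * (((n : ℝ) + 1) ^ z)⁻¹)) atTop (𝓝 (Real.Gamma z)⁻¹) := by
      have h1 : Tendsto (fun n : ℕ => ((n + 1 : ℕ) : ℝ) / (((n + 1 : ℕ) : ℝ) + z)) atTop (𝓝 1) :=
        (tendsto_natCast_div_add_atTop z).comp (tendsto_add_atTop_nat 1)
      have h2 := h1.mul hseq1
      rw [one_mul] at h2
      refine h2.congr fun n => ?_
      simp only [Function.comp, Real.GammaSeq]
      rw [Finset.prod_range_succ _ (n + 1), Nat.factorial_succ]
      push_cast
      have h3 : (n : ℝ) + 1 + z ≠ 0 := by positivity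
      have h3' : z + ((n : ℝ) + 1) ≠ 0 := by positivity
      have h4 : ∏ j ∈ Finset.range (n + 1), (z + (j : ℝ)) ≠ 0 :=
        Finset.prod_ne_zero_iff.2 fun j _ => by positivity
      generalize ∏ j ∈ Finset.range (n + 1), (z + (j : ℝ)) = X at h4 ⊢
      have h5 : ((n : ℝ) + 1) ^ z ≠ 0 := by positivity
      have h6 : (n ! : ℝ) ≠ 0 := by positivity
      have h7 : (n : ℝ) + 1 ≠ 0 := by positivity
      rw [add_comm ((n : ℝ) + 1) z]
      field_simp
    obtain ⟨n, hn⟩ := ((tendsto_order.1 hl).1 a ha).exists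
    filter_upwards [hev, (tendsto_order.1 ((hprod (n + 1)).mul ((hfact n).mul (hpow n)))).1 a hn]
      with q hq hqa
    refine hqa.trans_le ?_
    rw [qGammaInv_eq_prod_mul hq.1 hq.2 z (n + 1)]
    refine mul_le_mul_of_nonneg_left ?_ (Finset.prod_nonneg fun j _ =>
      (qNum_pos hq.1 hq.2 (by positivity)).le)
    have := qGammaInv_add_ge hq.1 hq.2 (a := (n : ℝ) + 1) (by positivity) hz.le hz1
    push_cast
    rwa [add_comm z]
  · obtain ⟨n, hn⟩ := ((tendsto_order.1 hseq1).2 a ha).exists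
    have hn' : (∏ j ∈ Finset.range (n + 2), (z + j)) *
        (((n + 1) ! : ℝ)⁻¹ * (((n : ℝ) + 1) ^ z)⁻¹) < a := by
      refine lt_of_eq_of_lt ?_ hn
      simp only [Function.comp, Real.GammaSeq]
      rw [inv_div, div_eq_mul_inv, mul_inv, mul_comm (((n + 1) ! : ℝ)⁻¹)]
      push_cast
      rfl
    have hf := hfact (n + 1)
    filter_upwards [hev, (tendsto_order.1 ((hprod (n + 2)).mul (hf.mul (hpow n)))).2 a hn']
      with q hq hqa
    refine lt_of_le_of_lt ?_ hqa
    rw [qGammaInv_eq_prod_mul hq.1 hq.2 z (n + 2)]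
    refine mul_le_mul_of_nonneg_left ?_ (Finset.prod_nonneg fun j _ =>
      (qNum_pos hq.1 hq.2 (by positivity)).le)
    have := qGammaInv_add_le hq.1 hq.2 (a := (n : ℝ) + 1) (by positivity) hz.le
    push_cast
    rwa [show z + ((n : ℝ) + 2) = (n : ℝ) + 1 + 1 + z by ring]

/-- The `q`-Gamma function tends to the Gamma function as `q → 1`, on the whole half line by the
functional equation. -/
theorem tendsto_qGammaInv {z : ℝ} (hz : 0 < z) :
    Tendsto (fun q => qGammaInv q z) (𝓝[<] 1) (𝓝 (Real.Gamma z)⁻¹) := by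
  have hev : ∀ᶠ q : ℝ in 𝓝[<] 1, 0 < q ∧ q < 1 := Ioo_mem_nhdsLT one_pos
  have key : ∀ n : ℕ, ∀ z : ℝ, 0 < z → z ≤ n + 1 →
      Tendsto (fun q => qGammaInv q z) (𝓝[<] 1) (𝓝 (Real.Gamma z)⁻¹) := by
    intro n
    induction n with
    | zero => exact fun z hz hz1 => tendsto_qGammaInv_aux hz (by simpa using hz1)
    | succ n ih =>
      intro z hz hz1
      rcases le_or_gt z 1 with h | h
      · exact tendsto_qGammaInv_aux hz h
      push_cast at hz1
      have h1 : 0 < z - 1 := by linarith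
      have h2 := (ih (z - 1) h1 (by linarith)).div (tendsto_qNum (z - 1)) h1.ne'
      have h3 : Real.Gamma z = (z - 1) * Real.Gamma (z - 1) := by
        rw [← Real.Gamma_add_one h1.ne', sub_add_cancel]
      rw [h3, mul_inv, mul_comm, ← div_eq_mul_inv]
      refine h2.congr' ?_
      filter_upwards [hev] with q hq
      simp only [Pi.div_apply]
      rw [qGammaInv_eq_mul hq.1 hq.2 (z - 1), sub_add_cancel,
        mul_div_cancel_left₀ _ (qNum_pos hq.1 hq.2 h1).ne']
  obtain ⟨n, hn⟩ := exists_nat_ge z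
  exact key n z hz (by linarith)

/-- `q^(i (i + 1) / 2) (1 - q)^i / (q; q)_i` is at most `1 / i!`. -/
theorem qRes_mul_le {q : ℝ} (hq : 0 < q) (hq1 : q < 1) (i : ℕ) :
    qRes q i * (1 - q) ^ i ≤ (i ! : ℝ)⁻¹ := by
  rw [qRes, ← Finset.card_range i, ← Finset.prod_const, Finset.card_range,
    ← Finset.prod_mul_distrib, ← Finset.prod_range_add_one_eq_factorial]
  push_cast
  rw [← Finset.prod_inv_distrib]
  refine Finset.prod_le_prod (fun r _ => ?_) fun r _ => ?_
  · exact mul_nonneg (div_nonneg (by positivity) (sub_nonneg.2 (pow_le_one₀ hq.le hq1.le)))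
      (sub_pos.2 hq1).le
  · have h1 : 0 < 1 - q ^ (r + 1) := sub_pos.2 (pow_lt_one₀ hq.le hq1 (by omega))
    have h2 : 1 - q ^ (r + 1) = (1 - q) * ∑ k ∈ Finset.range (r + 1), q ^ k := by
      rw [mul_comm, geom_sum_mul_neg]
    have h3 : ((r : ℝ) + 1) * q ^ (r + 1) ≤ ∑ k ∈ Finset.range (r + 1), q ^ k := by
      have : ∑ k ∈ Finset.range (r + 1), q ^ (r + 1) ≤ ∑ k ∈ Finset.range (r + 1), q ^ k :=
        Finset.sum_le_sum fun k hk => pow_le_pow_of_le_one hq.le hq1.le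
          (Finset.mem_range.1 hk).le
      simpa using this
    rw [div_mul_eq_mul_div, ← one_div, div_le_div_iff₀ h1 (by positivity), one_mul]
    rw [h2]
    nlinarith [sub_pos.2 hq1]

theorem tendsto_qRes_mul (i : ℕ) :
    Tendsto (fun q => qRes q i * (1 - q) ^ i) (𝓝[<] 1) (𝓝 (i ! : ℝ)⁻¹) := by
  have h : ∀ r : ℕ, Tendsto (fun q : ℝ => q ^ (r + 1) / qNum q ((r : ℝ) + 1)) (𝓝[<] 1)
      (𝓝 (1 / ((r : ℝ) + 1))) := fun r => by
    have h1 : Tendsto (fun q : ℝ => q ^ (r + 1)) (𝓝[<] 1) (𝓝 1) := by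
      have : Tendsto (fun q : ℝ => q ^ (r + 1)) (𝓝 1) (𝓝 (1 ^ (r + 1))) := tendsto_id.pow _
      rw [one_pow] at this
      exact this.mono_left nhdsWithin_le_nhds
    exact h1.div (tendsto_qNum _) (by positivity)
  have h2 := tendsto_finsetProd (Finset.range i) fun r _ => h r
  have e : ∏ r ∈ Finset.range i, (1 / ((r : ℝ) + 1)) = (i ! : ℝ)⁻¹ := by
    rw [← Finset.prod_range_add_one_eq_factorial]
    push_cast
    rw [← Finset.prod_inv_distrib]
    exact Finset.prod_congr rfl fun r _ => one_div _
  rw [e] at h2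
  refine h2.congr' ?_
  filter_upwards [Ioo_mem_nhdsLT (show (0 : ℝ) < 1 from one_pos)] with q hq
  rw [qRes, ← Finset.card_range i, ← Finset.prod_const, Finset.card_range,
    ← Finset.prod_mul_distrib]
  refine Finset.prod_congr rfl fun r _ => ?_
  rw [qNum, ← Nat.cast_add_one, Real.rpow_natCast, div_div_eq_mul_div, div_mul_eq_mul_div]

/-! ### Asymptotics of the terms of the kernel -/

/-- The decay rate `α / 2 + η (i + 1 / 2)`; `rowParam (e^(-α ε)) (e^(-ε)) η i` is the exponential
of `-ε` times it, and it is the `i`-th pole of `hardEdgeF α η θ`, as a function of `ζ`. -/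
def poleExp (α η : ℝ) (i : ℕ) : ℝ := α / 2 + η / 2 + i * η

/-- The argument of the Gamma function in the denominator of `hardEdgeF α η θ` at the pole
`poleExp α η i`. -/
def poleArg (α η θ : ℝ) (i : ℕ) : ℝ := α / (2 * θ) + poleExp α η i / θ + 1 / 2

/-- The residue of the integrand of the hard-edge kernel at a pole of each of the two variables. -/
def hardTerm (α η θ u v : ℝ) (p : ℕ × ℕ) : ℝ :=
  (-1) ^ (p.1 + p.2) * ((p.1 ! : ℝ)⁻¹ * (p.2 ! : ℝ)⁻¹) *
    ((Real.Gamma (poleArg α η θ p.1))⁻¹ * (Real.Gamma (poleArg α θ η p.2))⁻¹) *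
    (η * θ / (poleExp α η p.1 + poleExp α θ p.2)) *
    (Real.exp (-(poleExp α η p.1 * u)) * Real.exp (-(poleExp α θ p.2 * v)))

/-- The hard-edge kernel as a double series of residues. -/
def hardSeries (α η θ u v : ℝ) : ℝ := ∑' p, hardTerm α η θ u v p

/-- A summand of the kernel of the infinite last passage problem for `q = e^(-ε)` and
`a = e^(-α ε)`, in terms of quantities that converge as `ε → 0`; here `r` and `t` are the real
positions of the two lattice sites. -/
def scaledTerm (α η θ ε r t : ℝ) (p : ℕ × ℕ) : ℝ :=
  (-1) ^ (p.1 + p.2) *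
    ((qRes (Real.exp (-(ε * η))) p.1 * (1 - Real.exp (-(ε * η))) ^ p.1) *
      (qRes (Real.exp (-(ε * θ))) p.2 * (1 - Real.exp (-(ε * θ))) ^ p.2)) *
    (qGammaInv (Real.exp (-(ε * θ))) (poleArg α η θ p.1) *
      qGammaInv (Real.exp (-(ε * η))) (poleArg α θ η p.2)) *
    ((1 - Real.exp (-(ε * η))) * (1 - Real.exp (-(ε * θ))) /
      (ε * (1 - Real.exp (-(ε * (poleExp α η p.1 + poleExp α θ p.2)))))) *
    (Real.exp (-(poleExp α η p.1 * r)) * Real.exp (-(poleExp α θ p.2 * t))) *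
    ((ε * η / (1 - Real.exp (-(ε * η)))) ^ (p.1 + poleArg α θ η p.2) *
      (ε * θ / (1 - Real.exp (-(ε * θ)))) ^ (p.2 + poleArg α η θ p.1))

/-- The centering `-log(ε η) / η - log(ε θ) / θ` of the scaled last passage time. -/
def centering (η θ ε : ℝ) : ℝ := -(Real.log (ε * η) / η) - Real.log (ε * θ) / θ

section

variable {α η θ ε : ℝ}

theorem poleExp_pos (hα : 0 ≤ α) (hη : 0 < η) (i : ℕ) : 0 < poleExp α η i := by
  unfold poleExp
  positivity

theorem poleExp_zero_le (hη : 0 < η) (i : ℕ) : poleExp α η 0 ≤ poleExp α η i := by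
  have : 0 ≤ (i : ℝ) * η := by positivity
  simp only [poleExp, Nat.cast_zero, zero_mul, add_zero]
  linarith

theorem poleArg_pos (hα : 0 ≤ α) (hη : 0 < η) (hθ : 0 < θ) (i : ℕ) : 0 < poleArg α η θ i := by
  have := poleExp_pos hα hη i
  unfold poleArg
  positivity

theorem rowParam_exp (i : ℕ) :
    rowParam (Real.exp (-(α * ε))) (Real.exp (-ε)) η i =
      Real.exp (-(ε * poleExp α η 0)) * Real.exp (-(ε * η)) ^ i := by
  rw [rowParam, Real.sqrt_eq_rpow, ← Real.exp_mul, ← Real.exp_mul, ← Real.exp_mul, ← Real.exp_add,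
    ← Real.exp_nat_mul, ← Real.exp_add, poleExp]
  congr 1
  push_cast
  ring

/-- Up to the lattice spacing, the powers of `ε` produced by the `q`-Pochhammer symbols are those
that the centering of the lattice sites removes. -/
theorem latticeTerm_exp_eq (hα : 0 ≤ α) (hη : 0 < η) (hθ : 0 < θ) (hε : 0 < ε) (k l : ℕ)
    (p : ℕ × ℕ) :
    latticeTerm (Real.exp (-(ε * poleExp α η 0))) (Real.exp (-(ε * poleExp α θ 0)))
      (Real.exp (-(ε * η))) (Real.exp (-(ε * θ))) k l p / ε =
    scaledTerm α η θ ε (ε * k - centering η θ ε) (ε * l - centering η θ ε) p := by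
  obtain ⟨i, m⟩ := p
  have hx : ∀ (η : ℝ) (i : ℕ), Real.exp (-(ε * poleExp α η 0)) * Real.exp (-(ε * η)) ^ i =
      Real.exp (-(ε * poleExp α η i)) := fun η i => by
    rw [← Real.exp_nat_mul, ← Real.exp_add, poleExp, poleExp]
    congr 1
    push_cast
    ring
  have hz : ∀ {η θ : ℝ}, 0 < θ → ∀ i : ℕ, Real.exp (-(ε * poleExp α η i)) *
      Real.exp (-(ε * poleExp α θ 0)) = Real.exp (-(ε * θ)) ^ poleArg α η θ i := fun hθ i => by
    rw [← Real.exp_mul, ← Real.exp_add, poleArg, poleExp, poleExp]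
    congr 1
    push_cast
    field_simp
    ring
  have hA : 0 < 1 - Real.exp (-(ε * η)) :=
    sub_pos.2 (Real.exp_lt_one_iff.2 (neg_lt_zero.2 (mul_pos hε hη)))
  have hB : 0 < 1 - Real.exp (-(ε * θ)) :=
    sub_pos.2 (Real.exp_lt_one_iff.2 (neg_lt_zero.2 (mul_pos hε hθ)))
  have hQ : 0 < qPoch (Real.exp (-(ε * η))) (Real.exp (-(ε * η))) :=
    qPoch_pos (Real.exp_pos _).le (sub_pos.1 hA) (Real.exp_pos _).le (sub_pos.1 hA)
  have hT : 0 < qPoch (Real.exp (-(ε * θ))) (Real.exp (-(ε * θ))) :=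
    qPoch_pos (Real.exp_pos _).le (sub_pos.1 hB) (Real.exp_pos _).le (sub_pos.1 hB)
  have hζ := poleExp_pos hα hη i
  have hω := poleExp_pos hα hθ m
  have hD : 0 < 1 - Real.exp (-(ε * (poleExp α η i + poleExp α θ m))) :=
    sub_pos.2 (Real.exp_lt_one_iff.2 (neg_lt_zero.2 (by positivity)))
  have e1 : Real.exp (-(ε * poleExp α η i)) * Real.exp (-(ε * poleExp α θ m)) =
      Real.exp (-(ε * (poleExp α η i + poleExp α θ m))) := by
    rw [← Real.exp_add]; congr 1; ring
  have e2 : Real.exp (-(ε * poleExp α η i)) ^ k * Real.exp (-(ε * poleExp α θ m)) ^ l =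
      Real.exp (-(poleExp α η i * (ε * k - centering η θ ε))) *
      Real.exp (-(poleExp α θ m * (ε * l - centering η θ ε))) *
      ((ε * η) ^ (i + poleArg α θ η m) * (ε * θ) ^ (m + poleArg α η θ i)) := by
    rw [Real.rpow_def_of_pos (mul_pos hε hη), Real.rpow_def_of_pos (mul_pos hε hθ),
      ← Real.exp_nat_mul, ← Real.exp_nat_mul, ← Real.exp_add, ← Real.exp_add, ← Real.exp_add,
      ← Real.exp_add, centering, poleArg, poleArg, poleExp, poleExp]
    congr 1
    field_simp
    ring
  have e3 : ∀ {A x z : ℝ} (i : ℕ), 0 < A → 0 < x →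
      (x / A) ^ ((i : ℝ) + z) * (A ^ i * A ^ (z - 1) * A) =
      x ^ ((i : ℝ) + z) := fun {A x z} i hA hx => by
    rw [Real.div_rpow hx.le hA.le, ← Real.rpow_natCast, mul_assoc, ← Real.rpow_add_one hA.ne',
      ← Real.rpow_add hA, sub_add_cancel, div_mul_cancel₀ _ (Real.rpow_pos_of_pos hA _).ne']
  have e4 := e3 (z := poleArg α θ η m) i hA (mul_pos hε hη)
  have e5 := e3 (z := poleArg α η θ i) m hB (mul_pos hε hθ)
  simp only [latticeTerm, scaledTerm, qCoeff]
  rw [hx, hx, e1, e2, hz hθ, hz hη, qGammaInv, qGammaInv, ← e4, ← e5, pow_add]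
  field_simp

theorem half_le_one_sub_exp_neg {x : ℝ} (hx : 0 ≤ x) (hx1 : x ≤ 1) :
    x / 2 ≤ 1 - Real.exp (-x) := by
  have h1 : x + 1 ≤ Real.exp x := Real.add_one_le_exp x
  have h2 : Real.exp (-x) ≤ (x + 1)⁻¹ := by
    rw [Real.exp_neg]
    exact inv_anti₀ (by linarith) h1
  have h3 : (x + 1)⁻¹ ≤ 1 - x / 2 := by
    rw [inv_le_iff_one_le_mul₀ (by linarith)]
    nlinarith
  linarith

theorem tendsto_one_sub_exp_div (c : ℝ) :
    Tendsto (fun ε : ℝ => (1 - Real.exp (-(ε * c))) / ε) (𝓝[>] 0) (𝓝 c) := by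
  have h : HasDerivAt (fun ε : ℝ => 1 - Real.exp (-(ε * c))) c 0 := by
    have := (((hasDerivAt_id (0 : ℝ)).mul_const c).neg.exp).const_sub 1
    simpa using this
  refine (h.tendsto_slope.mono_left (nhdsWithin_mono _ fun x (hx : 0 < x) => hx.ne')).congr
    fun ε => ?_
  rw [slope_def_field]
  simp

theorem tendsto_exp_neg_mul_nhdsLT (hη : 0 < η) :
    Tendsto (fun ε : ℝ => Real.exp (-(ε * η))) (𝓝[>] 0) (𝓝[<] 1) := by
  refine tendsto_nhdsWithin_iff.2 ⟨?_, ?_⟩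
  · have : Tendsto (fun ε : ℝ => Real.exp (-(ε * η))) (𝓝 0) (𝓝 (Real.exp (-(0 * η)))) :=
      (Continuous.tendsto (by fun_prop) 0)
    simp only [zero_mul, neg_zero, Real.exp_zero] at this
    exact this.mono_left nhdsWithin_le_nhds
  · filter_upwards [self_mem_nhdsWithin] with ε hε
    exact Real.exp_lt_one_iff.2 (neg_lt_zero.2 (mul_pos hε hη))

theorem tendsto_div_one_sub_exp (hη : 0 < η) :
    Tendsto (fun ε : ℝ => ε * η / (1 - Real.exp (-(ε * η)))) (𝓝[>] 0) (𝓝 1) := by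
  have h := (tendsto_one_sub_exp_div η).inv₀ hη.ne'
  have h2 := h.const_mul η
  rw [mul_inv_cancel₀ hη.ne'] at h2
  refine h2.congr fun ε => ?_
  rw [inv_div]
  ring

theorem tendsto_scaledTerm (hα : 0 ≤ α) (hη : 0 < η) (hθ : 0 < θ) {r t : ℝ → ℝ} {u v : ℝ}
    (hr : Tendsto r (𝓝[>] 0) (𝓝 u)) (ht : Tendsto t (𝓝[>] 0) (𝓝 v)) (p : ℕ × ℕ) :
    Tendsto (fun ε => scaledTerm α η θ ε (r ε) (t ε) p) (𝓝[>] 0) (𝓝 (hardTerm α η θ u v p)) := by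
  have hQ := tendsto_exp_neg_mul_nhdsLT hη
  have hT := tendsto_exp_neg_mul_nhdsLT hθ
  have hc : 0 < poleExp α η p.1 + poleExp α θ p.2 :=
    add_pos (poleExp_pos hα hη _) (poleExp_pos hα hθ _)
  have h1 := ((tendsto_qRes_mul p.1).comp hQ).mul ((tendsto_qRes_mul p.2).comp hT)
  have h2 := ((tendsto_qGammaInv (poleArg_pos hα hη hθ p.1)).comp hT).mul
    ((tendsto_qGammaInv (poleArg_pos hα hθ hη p.2)).comp hQ)
  have h3 : Tendsto (fun ε => (1 - Real.exp (-(ε * η))) * (1 - Real.exp (-(ε * θ))) /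
      (ε * (1 - Real.exp (-(ε * (poleExp α η p.1 + poleExp α θ p.2)))))) (𝓝[>] 0)
      (𝓝 (η * θ / (poleExp α η p.1 + poleExp α θ p.2))) := by
    refine (((tendsto_one_sub_exp_div η).mul (tendsto_one_sub_exp_div θ)).div
      (tendsto_one_sub_exp_div _) hc.ne').congr' ?_
    filter_upwards [self_mem_nhdsWithin] with ε hε
    have hε' : ε ≠ 0 := (Set.mem_Ioi.1 hε).ne'
    have hD : 1 - Real.exp (-(ε * (poleExp α η p.1 + poleExp α θ p.2))) ≠ 0 :=
      (sub_pos.2 (Real.exp_lt_one_iff.2 (neg_lt_zero.2 (mul_pos (Set.mem_Ioi.1 hε) hc)))).ne'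
    simp only [Pi.div_apply]
    field_simp
  have h4 : Tendsto (fun ε => Real.exp (-(poleExp α η p.1 * r ε)) *
      Real.exp (-(poleExp α θ p.2 * t ε))) (𝓝[>] 0)
      (𝓝 (Real.exp (-(poleExp α η p.1 * u)) * Real.exp (-(poleExp α θ p.2 * v)))) :=
    ((Real.continuous_exp.tendsto _).comp (hr.const_mul _).neg).mul
      ((Real.continuous_exp.tendsto _).comp (ht.const_mul _).neg)
  have h5 := ((tendsto_div_one_sub_exp hη).rpow_const (p := p.1 + poleArg α θ η p.2)
    (Or.inl one_ne_zero)).mul ((tendsto_div_one_sub_exp hθ).rpow_const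
    (p := p.2 + poleArg α η θ p.1) (Or.inl one_ne_zero))
  rw [Real.one_rpow, Real.one_rpow, mul_one] at h5
  have := ((((h1.const_mul ((-1) ^ (p.1 + p.2))).mul h2).mul h3).mul h4).mul h5
  rw [mul_one] at this
  exact this

/-- The factor of a summable majorant that depends on one of the two indices. -/
def majorant (α η θ s : ℝ) (i : ℕ) : ℝ :=
  (i ! : ℝ)⁻¹ * (2 : ℝ) ^ (i + poleArg α η θ i) * Real.exp (-(poleExp α η i * (s - 1)))

theorem majorant_nonneg (α η θ s : ℝ) (i : ℕ) : 0 ≤ majorant α η θ s i := by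
  unfold majorant
  positivity

theorem summable_majorant (α η θ s : ℝ) : Summable (majorant α η θ s) := by
  have h : ∀ i, majorant α η θ s i =
      Real.exp (Real.log 2 * poleArg α η θ 0 - poleExp α η 0 * (s - 1)) *
        (Real.exp (Real.log 2 * (1 + η / θ) - η * (s - 1)) ^ i / (i ! : ℝ)) := fun i => by
    rw [majorant, Real.rpow_def_of_pos two_pos, mul_assoc, ← Real.exp_add, ← mul_div_assoc,
      ← Real.exp_nat_mul, ← Real.exp_add, div_eq_inv_mul]
    congr 2
    simp only [poleArg, poleExp]
    push_cast
    ring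
  rw [funext h]
  exact (Real.summable_pow_div_factorial _).mul_left _

theorem exp_neg_mul_le {ζ c s u r : ℝ} (hc : 0 < c) (hζ : c ≤ ζ) (hu : s ≤ u) (hr : u - 1 ≤ r) :
    Real.exp (-(ζ * r)) ≤ Real.exp (-(ζ * (s - 1))) * Real.exp (-(c * (u - s))) := by
  rw [← Real.exp_add, Real.exp_le_exp]
  have h1 : ζ * (u - 1) ≤ ζ * r := mul_le_mul_of_nonneg_left hr (hc.le.trans hζ)
  have h2 : c * (u - s) ≤ ζ * (u - s) := mul_le_mul_of_nonneg_right hζ (by linarith)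
  nlinarith

/-- A bound on the summands of the scaled kernel, uniform in `ε`. -/
theorem abs_scaledTerm_le (hα : 0 ≤ α) (hη : 0 < η) (hθ : 0 < θ) {c : ℝ} (hc : 0 < c)
    (hcη : c ≤ poleExp α η 0) (hcθ : c ≤ poleExp α θ 0) (hε : 0 < ε) (hε1 : ε * η ≤ 1)
    (hε2 : ε * θ ≤ 1) (hε3 : ε * c ≤ 1) {s u v r t : ℝ} (hu : s ≤ u) (hv : s ≤ v)
    (hr : u - 1 ≤ r) (ht : v - 1 ≤ t) (p : ℕ × ℕ) :
    |scaledTerm α η θ ε r t p| ≤ 4 * (2 * η * θ / c) *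
      (majorant α η θ s p.1 * majorant α θ η s p.2) *
      (Real.exp (-(c * (u - s))) * Real.exp (-(c * (v - s)))) := by
  obtain ⟨i, m⟩ := p
  have bound : ∀ {η θ : ℝ}, 0 < η → 0 < θ → ε * η ≤ 1 → ε * θ ≤ 1 → ∀ i : ℕ,
      0 ≤ qRes (Real.exp (-(ε * η))) i * (1 - Real.exp (-(ε * η))) ^ i ∧
      qRes (Real.exp (-(ε * η))) i * (1 - Real.exp (-(ε * η))) ^ i ≤ (i ! : ℝ)⁻¹ ∧
      0 ≤ qGammaInv (Real.exp (-(ε * θ))) (poleArg α η θ i) ∧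
      qGammaInv (Real.exp (-(ε * θ))) (poleArg α η θ i) ≤ 2 := by
    intro η θ hη hθ hε1 hε2 i
    have hA : Real.exp (-(ε * η)) < 1 := Real.exp_lt_one_iff.2 (neg_lt_zero.2 (mul_pos hε hη))
    have hB : Real.exp (-(ε * θ)) < 1 := Real.exp_lt_one_iff.2 (neg_lt_zero.2 (mul_pos hε hθ))
    exact ⟨mul_nonneg (qRes_nonneg (Real.exp_pos _).le hA i) (pow_nonneg (sub_pos.2 hA).le _),
      qRes_mul_le (Real.exp_pos _) hA i,
      (qGammaInv_pos (Real.exp_pos _) hB (poleArg_pos hα hη hθ i)).le,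
      qGammaInv_le_two (Real.exp_pos _) hB (poleArg_pos hα hη hθ i)⟩
  have ratio : ∀ {η z : ℝ}, 0 < η → ε * η ≤ 1 → 0 ≤ z →
      0 ≤ (ε * η / (1 - Real.exp (-(ε * η)))) ^ z ∧
      (ε * η / (1 - Real.exp (-(ε * η)))) ^ z ≤ 2 ^ z := by
    intro η z hη hε1 hz
    have h := half_le_one_sub_exp_neg (mul_pos hε hη).le hε1
    have h0 : 0 < 1 - Real.exp (-(ε * η)) := lt_of_lt_of_le (by positivity) h
    refine ⟨by positivity, Real.rpow_le_rpow (by positivity) ?_ hz⟩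
    rw [div_le_iff₀ h0]
    linarith
  obtain ⟨a1, a2, a3, a4⟩ := bound hη hθ hε1 hε2 i
  obtain ⟨b1, b2, b3, b4⟩ := bound hθ hη hε2 hε1 m
  have hzi := (poleArg_pos hα hη hθ i).le
  have hzm := (poleArg_pos hα hθ hη m).le
  obtain ⟨c1, c2⟩ := ratio (z := i + poleArg α θ η m) hη hε1 (by positivity)
  obtain ⟨d1, d2⟩ := ratio (z := m + poleArg α η θ i) hθ hε2 (by positivity)
  have e1 := exp_neg_mul_le hc (hcη.trans (poleExp_zero_le hη i)) hu hr
  have e2 := exp_neg_mul_le hc (hcθ.trans (poleExp_zero_le hθ m)) hv ht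
  have hD : ε * c / 2 ≤ 1 - Real.exp (-(ε * (poleExp α η i + poleExp α θ m))) := by
    refine (half_le_one_sub_exp_neg (mul_pos hε hc).le hε3).trans ?_
    refine sub_le_sub_left (Real.exp_le_exp.2 (neg_le_neg (mul_le_mul_of_nonneg_left ?_ hε.le))) 1
    linarith [hcη.trans (poleExp_zero_le hη i), poleExp_pos hα hθ m]
  have hone : ∀ {η : ℝ}, 0 < η → 0 ≤ 1 - Real.exp (-(ε * η)) ∧ 1 - Real.exp (-(ε * η)) ≤ ε * η :=
    fun {η} hη => ⟨sub_nonneg.2 (Real.exp_lt_one_iff.2 (neg_lt_zero.2 (mul_pos hε hη))).le, by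
      linarith [Real.add_one_le_exp (-(ε * η))]⟩
  have hF : (1 - Real.exp (-(ε * η))) * (1 - Real.exp (-(ε * θ))) /
      (ε * (1 - Real.exp (-(ε * (poleExp α η i + poleExp α θ m))))) ≤ 2 * η * θ / c := by
    refine (div_le_div₀ (by positivity) (mul_le_mul (hone hη).2 (hone hθ).2 (hone hθ).1
      (by positivity)) (by positivity) (mul_le_mul_of_nonneg_left hD hε.le)).trans_eq ?_
    field_simp
  have hF0 : 0 ≤ (1 - Real.exp (-(ε * η))) * (1 - Real.exp (-(ε * θ))) /
      (ε * (1 - Real.exp (-(ε * (poleExp α η i + poleExp α θ m))))) :=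
    div_nonneg (mul_nonneg (hone hη).1 (hone hθ).1)
      (mul_nonneg hε.le ((by positivity : 0 ≤ ε * c / 2).trans hD))
  have hg0 : ∀ i : ℕ, (0 : ℝ) ≤ (i ! : ℝ)⁻¹ := fun i => by positivity
  simp only [scaledTerm]
  rw [abs_mul, abs_mul, abs_mul, abs_mul, abs_mul, abs_pow, abs_neg, abs_one, one_pow, one_mul,
    abs_of_nonneg (mul_nonneg a1 b1), abs_of_nonneg (mul_nonneg a3 b3), abs_of_nonneg hF0,
    abs_of_nonneg (mul_nonneg c1 d1), abs_of_nonneg (by positivity)]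
  have f1 := mul_le_mul a2 b2 b1 (hg0 i)
  have f2 := mul_le_mul a4 b4 b3 zero_le_two
  have f3 := mul_le_mul e1 e2 (Real.exp_pos _).le (by positivity)
  have f4 := mul_le_mul c2 d2 d1 (by positivity)
  have f5 := mul_le_mul f1 f2 (mul_nonneg a3 b3) (mul_nonneg (hg0 i) (hg0 m))
  have f6 := mul_le_mul f5 hF hF0 (by positivity)
  have f7 := mul_le_mul f6 f3 (by positivity) (by positivity)
  have f8 := mul_le_mul f7 f4 (mul_nonneg c1 d1) (by positivity)
  refine f8.trans_eq ?_
  simp only [majorant]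
  have h2 : (2 : ℝ) ^ ((i : ℝ) + poleArg α θ η m) * 2 ^ ((m : ℝ) + poleArg α η θ i) =
      2 ^ ((i : ℝ) + poleArg α η θ i) * 2 ^ ((m : ℝ) + poleArg α θ η m) := by
    rw [← Real.rpow_add two_pos, ← Real.rpow_add two_pos]
    congr 1
    ring
  rw [h2]
  ring

end

/-! ### The limit law -/

section

variable {α η θ : ℝ}

theorem eventually_mul_le_one (c : ℝ) : ∀ᶠ ε : ℝ in 𝓝[>] 0, ε * c ≤ 1 := by
  have h : Tendsto (fun ε : ℝ => ε * c) (𝓝 0) (𝓝 (0 * c)) := tendsto_id.mul_const c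
  rw [zero_mul] at h
  exact ((tendsto_order.1 (h.mono_left nhdsWithin_le_nhds)).2 1 one_pos).mono fun _ h => h.le

theorem tendsto_centering (hη : 0 < η) (hθ : 0 < θ) :
    Tendsto (centering η θ) (𝓝[>] 0) atTop := by
  have h : ∀ {η : ℝ}, 0 < η → Tendsto (fun ε : ℝ => -(Real.log (ε * η) / η)) (𝓝[>] 0) atTop := by
    intro η hη
    refine tendsto_neg_atBot_atTop.comp ((Real.tendsto_log_nhdsGT_zero.comp ?_).atBot_div_const hη)
    refine tendsto_nhdsWithin_iff.2 ⟨?_, ?_⟩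
    · have h : Tendsto (fun ε : ℝ => ε * η) (𝓝 0) (𝓝 (0 * η)) := tendsto_id.mul_const η
      rw [zero_mul] at h
      exact h.mono_left nhdsWithin_le_nhds
    · filter_upwards [self_mem_nhdsWithin] with ε hε
      exact mul_pos hε hη
  exact ((h hη).atTop_add_atTop (h hθ)).congr fun ε => by rw [centering]; ring

/-- The greatest integer below `(s + centering) / ε`. -/
def cutoff (η θ s ε : ℝ) : ℕ := ⌈(s + centering η θ ε) / ε⌉₊ - 1

theorem cutoff_add_one {s ε : ℝ} (hε : 0 < ε) (hs : 0 < s + centering η θ ε) :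
    cutoff η θ s ε + 1 = ⌈(s + centering η θ ε) / ε⌉₊ :=
  Nat.sub_add_cancel (Nat.one_le_ceil_iff.2 (div_pos hs hε))

/-- The position of the lattice site that corresponds to `u` is at distance at most `ε` of `u`. -/
theorem abs_site_sub_le {s u ε : ℝ} (hε : 0 < ε) (hs : 0 < s + centering η θ ε) (hu : s ≤ u) :
    |ε * ((cutoff η θ s ε + 1 + ⌊(u - s) / ε⌋₊ : ℕ) : ℝ) - centering η θ ε - u| ≤ ε := by
  rw [cutoff_add_one hε hs]
  have h1 := Nat.le_ceil ((s + centering η θ ε) / ε)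
  have h2 := Nat.ceil_lt_add_one (div_pos hs hε).le
  have h3 := Nat.floor_le (div_nonneg (sub_nonneg.2 hu) hε.le)
  have h4 := Nat.lt_floor_add_one ((u - s) / ε)
  rw [div_le_iff₀ hε] at h1
  rw [← sub_lt_iff_lt_add, lt_div_iff₀ hε] at h2
  rw [le_div_iff₀ hε] at h3
  rw [div_lt_iff₀ hε] at h4
  push_cast
  rw [abs_le]
  constructor <;> nlinarith

theorem tendsto_site (hη : 0 < η) (hθ : 0 < θ) {s u : ℝ} (hu : s ≤ u) :
    Tendsto (fun ε => ε * ((cutoff η θ s ε + 1 + ⌊(u - s) / ε⌋₊ : ℕ) : ℝ) - centering η θ ε)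
      (𝓝[>] 0) (𝓝 u) := by
  rw [tendsto_iff_norm_sub_tendsto_zero]
  refine squeeze_zero' (Eventually.of_forall fun _ => norm_nonneg _) ?_
    (tendsto_id.mono_left nhdsWithin_le_nhds)
  filter_upwards [self_mem_nhdsWithin, (tendsto_atTop_add_const_left _ s
    (tendsto_centering hη hθ)).eventually_gt_atTop 0] with ε hε hs
  exact abs_site_sub_le hε hs hu

/-- The bound on the rescaled terms passes to the limit. -/
theorem abs_hardTerm_le (hα : 0 ≤ α) (hη : 0 < η) (hθ : 0 < θ) {c : ℝ} (hc : 0 < c)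
    (hcη : c ≤ poleExp α η 0) (hcθ : c ≤ poleExp α θ 0) {s u v : ℝ} (hu : s ≤ u) (hv : s ≤ v)
    (p : ℕ × ℕ) :
    |hardTerm α η θ u v p| ≤ 4 * (2 * η * θ / c) *
      (majorant α η θ s p.1 * majorant α θ η s p.2) *
      (Real.exp (-(c * (u - s))) * Real.exp (-(c * (v - s)))) := by
  refine le_of_tendsto (tendsto_scaledTerm hα hη hθ (r := fun _ => u) (t := fun _ => v)
    tendsto_const_nhds tendsto_const_nhds p).abs ?_
  filter_upwards [self_mem_nhdsWithin, eventually_mul_le_one η, eventually_mul_le_one θ,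
    eventually_mul_le_one c] with ε hε h1 h2 h3
  exact abs_scaledTerm_le hα hη hθ hc hcη hcθ hε h1 h2 h3 hu hv (by linarith) (by linarith) p

theorem summable_majorant_mul (α η θ s : ℝ) :
    Summable fun p : ℕ × ℕ => majorant α η θ s p.1 * majorant α θ η s p.2 :=
  (summable_majorant α η θ s).mul_of_nonneg (summable_majorant α θ η s)
    (majorant_nonneg _ _ _ _) (majorant_nonneg _ _ _ _)

theorem exists_decay (hα : 0 ≤ α) (hη : 0 < η) (hθ : 0 < θ) :
    ∃ c, 0 < c ∧ c ≤ poleExp α η 0 ∧ c ≤ poleExp α θ 0 :=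
  ⟨min (poleExp α η 0) (poleExp α θ 0), lt_min (poleExp_pos hα hη 0) (poleExp_pos hα hθ 0),
    min_le_left _ _, min_le_right _ _⟩

theorem summable_hardTerm (hα : 0 ≤ α) (hη : 0 < η) (hθ : 0 < θ) (u v : ℝ) :
    Summable (hardTerm α η θ u v) := by
  obtain ⟨c, hc, hcη, hcθ⟩ := exists_decay hα hη hθ
  exact Summable.of_norm_bounded (((summable_majorant_mul α η θ (min u v)).mul_left _).mul_right _)
    fun p => abs_hardTerm_le hα hη hθ hc hcη hcθ (min_le_left u v) (min_le_right u v) p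

theorem measurable_hardSeries (hα : 0 ≤ α) (hη : 0 < η) (hθ : 0 < θ) :
    Measurable (Function.uncurry (hardSeries α η θ)) := by
  refine measurable_of_tendsto_metrizable' (atTop : Filter (Finset (ℕ × ℕ)))
    (f := fun A (z : ℝ × ℝ) => ∑ p ∈ A, hardTerm α η θ z.1 z.2 p) (fun A => ?_) ?_
  · refine Finset.measurable_sum _ fun p _ => Continuous.measurable ?_
    unfold hardTerm
    fun_prop
  · exact tendsto_pi_nhds.2 fun z => (summable_hardTerm hα hη hθ z.1 z.2).hasSum

/-- The constant in the bound on the kernels. -/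
def kernelBound (α η θ c s : ℝ) : ℝ :=
  4 * (2 * η * θ / c) * ∑' p : ℕ × ℕ, majorant α η θ s p.1 * majorant α θ η s p.2

theorem kernelBound_nonneg (hη : 0 < η) (hθ : 0 < θ) {c : ℝ} (hc : 0 < c) (s : ℝ) :
    0 ≤ kernelBound α η θ c s :=
  mul_nonneg (by positivity) (tsum_nonneg fun _ =>
    mul_nonneg (majorant_nonneg _ _ _ _ _) (majorant_nonneg _ _ _ _ _))

theorem abs_tsum_le_kernelBound (hη : 0 < η) (hθ : 0 < θ) {c : ℝ} (hc : 0 < c) {s u v : ℝ}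
    {g : ℕ × ℕ → ℝ} (hg : ∀ p, |g p| ≤ 4 * (2 * η * θ / c) *
      (majorant α η θ s p.1 * majorant α θ η s p.2) *
      (Real.exp (-(c * (u - s))) * Real.exp (-(c * (v - s))))) :
    |∑' p, g p| ≤ (√(kernelBound α η θ c s) * Real.exp (-(c * (u - s)))) *
      (√(kernelBound α η θ c s) * Real.exp (-(c * (v - s)))) := by
  have hs := ((summable_majorant_mul α η θ s).mul_left (4 * (2 * η * θ / c))).mul_right
    (Real.exp (-(c * (u - s))) * Real.exp (-(c * (v - s))))
  refine (tsum_of_norm_bounded (f := g) hs.hasSum hg).trans_eq ?_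
  rw [tsum_mul_right, tsum_mul_left, ← kernelBound]
  linear_combination (-(Real.exp (-(c * (u - s))) * Real.exp (-(c * (v - s))))) *
    Real.mul_self_sqrt (kernelBound_nonneg (α := α) hη hθ hc s)

theorem integrableOn_sq_mul_exp {c : ℝ} (hc : 0 < c) (M s : ℝ) :
    IntegrableOn (fun u => (M * Real.exp (-(c * (u - s)))) ^ 2) (Set.Ioi s) := by
  refine ((integrableOn_exp_mul_Ioi (a := -(2 * c)) (by linarith) s).const_mul
    (M ^ 2 * Real.exp (2 * c * s))).congr (Eventually.of_forall fun u => ?_)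
  simp only
  rw [mul_pow, ← Real.exp_nat_mul, mul_assoc, ← Real.exp_add]
  congr 2
  push_cast
  ring

theorem fredholmConverges_hardSeries (hα : 0 ≤ α) (hη : 0 < η) (hθ : 0 < θ) (s : ℝ) :
    FredholmConverges (fun u v => (hardSeries α η θ u v : ℂ)) (Set.Ioi s) := by
  obtain ⟨c, hc, hcη, hcθ⟩ := exists_decay hα hη hθ
  exact fredholmConverges_ofReal measurableSet_Ioi (fun u _ => by positivity)
    (integrableOn_sq_mul_exp hc _ s)
    (fun u hu v hv => abs_tsum_le_kernelBound hη hθ hc fun p =>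
      abs_hardTerm_le hα hη hθ hc hcη hcθ (le_of_lt hu) (le_of_lt hv) p)
    (measurable_hardSeries hα hη hθ)

/-- The kernel of the infinite last passage problem for `q = e^(-ε)` and `a = e^(-α ε)`. -/
def scaledKernel (α η θ s ε u v : ℝ) : ℝ :=
  latticeKernel (Real.exp (-(ε * poleExp α η 0))) (Real.exp (-(ε * poleExp α θ 0)))
    (Real.exp (-(ε * η))) (Real.exp (-(ε * θ))) (cutoff η θ s ε) ε s u v

theorem scaledKernel_eq (hα : 0 ≤ α) (hη : 0 < η) (hθ : 0 < θ) {ε : ℝ} (hε : 0 < ε)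
    (s u v : ℝ) :
    scaledKernel α η θ s ε u v = ∑' p, scaledTerm α η θ ε
      (ε * ((cutoff η θ s ε + 1 + ⌊(u - s) / ε⌋₊ : ℕ) : ℝ) - centering η θ ε)
      (ε * ((cutoff η θ s ε + 1 + ⌊(v - s) / ε⌋₊ : ℕ) : ℝ) - centering η θ ε) p := by
  rw [scaledKernel, latticeKernel, ← tsum_div_const]
  exact tsum_congr fun p => latticeTerm_exp_eq hα hη hθ hε _ _ p

/-- Both the double series of the kernel and the Fredholm determinant converge dominatedly. -/
theorem tendsto_fredholmDet_scaledKernel (hα : 0 ≤ α) (hη : 0 < η) (hθ : 0 < θ) (s : ℝ) :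
    Tendsto (fun ε => fredholmDet (fun u v => (scaledKernel α η θ s ε u v : ℂ)) (Set.Ioi s))
      (𝓝[>] 0) (𝓝 (fredholmDet (fun u v => (hardSeries α η θ u v : ℂ)) (Set.Ioi s))) := by
  obtain ⟨c, hc, hcη, hcθ⟩ := exists_decay hα hη hθ
  -- one bound serves both for the sum over `p` and for the Fredholm series
  have hbound : ∀ᶠ ε : ℝ in 𝓝[>] 0, ∀ u ∈ Set.Ioi s, ∀ v ∈ Set.Ioi s, ∀ p, |scaledTerm α η θ ε
      (ε * ((cutoff η θ s ε + 1 + ⌊(u - s) / ε⌋₊ : ℕ) : ℝ) - centering η θ ε)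
      (ε * ((cutoff η θ s ε + 1 + ⌊(v - s) / ε⌋₊ : ℕ) : ℝ) - centering η θ ε) p| ≤
      4 * (2 * η * θ / c) * (majorant α η θ s p.1 * majorant α θ η s p.2) *
      (Real.exp (-(c * (u - s))) * Real.exp (-(c * (v - s)))) := by
    filter_upwards [self_mem_nhdsWithin, eventually_mul_le_one η, eventually_mul_le_one θ,
      eventually_mul_le_one c, eventually_mul_le_one 1, (tendsto_atTop_add_const_left _ s
      (tendsto_centering hη hθ)).eventually_gt_atTop 0] with ε hε h1 h2 h3 h4 hs u hu v hv p
    have e1 := (abs_le.1 (abs_site_sub_le hε hs (le_of_lt hu))).1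
    have e2 := (abs_le.1 (abs_site_sub_le hε hs (le_of_lt hv))).1
    exact abs_scaledTerm_le hα hη hθ hc hcη hcθ hε h1 h2 h3 (le_of_lt hu) (le_of_lt hv)
      (by linarith) (by linarith) p
  refine tendsto_fredholmDet measurableSet_Ioi (fun u _ => by positivity)
    (integrableOn_sq_mul_exp hc (√(kernelBound α η θ c s)) s) ?_ ?_ ?_
  · filter_upwards [self_mem_nhdsWithin, hbound] with ε hε hb u hu v hv
    rw [scaledKernel_eq hα hη hθ hε]
    exact abs_tsum_le_kernelBound hη hθ hc (hb u hu v hv)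
  · exact Eventually.of_forall fun ε => measurable_comp_floor_floor ε s fun a b =>
      (∑' p, latticeTerm (Real.exp (-(ε * poleExp α η 0))) (Real.exp (-(ε * poleExp α θ 0)))
        (Real.exp (-(ε * η))) (Real.exp (-(ε * θ))) (cutoff η θ s ε + 1 + a)
        (cutoff η θ s ε + 1 + b) p) / ε
  · intro u hu v hv
    have h : Tendsto (fun ε => ∑' p, scaledTerm α η θ ε
        (ε * ((cutoff η θ s ε + 1 + ⌊(u - s) / ε⌋₊ : ℕ) : ℝ) - centering η θ ε)
        (ε * ((cutoff η θ s ε + 1 + ⌊(v - s) / ε⌋₊ : ℕ) : ℝ) - centering η θ ε) p) (𝓝[>] 0)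
        (𝓝 (hardSeries α η θ u v)) := by
      refine tendsto_tsum_of_dominated_convergence
        (((summable_majorant_mul α η θ s).mul_left (4 * (2 * η * θ / c))).mul_right
          (Real.exp (-(c * (u - s))) * Real.exp (-(c * (v - s)))))
        (fun p => tendsto_scaledTerm hα hη hθ (tendsto_site hη hθ (le_of_lt hu))
          (tendsto_site hη hθ (le_of_lt hv)) p) ?_
      filter_upwards [hbound] with ε hb p
      exact hb u hu v hv p
    refine h.congr' ?_
    filter_upwards [self_mem_nhdsWithin] with ε hε
    rw [scaledKernel_eq hα hη hθ hε]

/-- For integer values the strict inequality of the limit law is a weak one at the cutoff. -/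
theorem setOf_scaled_lt_eq (v : ℕ × ℕ → ℕ) {s ε : ℝ} (hε : 0 < ε)
    (hs : 0 < s + centering η θ ε) :
    (lppDownLeft v ≠ ∞ ∧
      ε * (lppDownLeft v).toReal + Real.log (ε * η) / η + Real.log (ε * θ) / θ < s) ↔
      lppDownLeft v ≤ cutoff η θ s ε := by
  have h0 : ∀ x : ℝ, ε * x + Real.log (ε * η) / η + Real.log (ε * θ) / θ < s ↔
      x < (s + centering η θ ε) / ε := fun x => by
    rw [lt_div_iff₀ hε, centering]
    constructor <;> intro h <;> linarith
  rw [h0]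
  have hn := cutoff_add_one hε hs
  constructor
  · rintro ⟨htop, hlt⟩
    rw [lppDownLeft_eq_iSup]
    refine iSup_le fun N => ?_
    have h1 : ((lpp v N N : ℕ) : ℝ) ≤ (lppDownLeft v).toReal := by
      rw [← ENNReal.toReal_natCast]
      refine ENNReal.toReal_mono htop ?_
      rw [lppDownLeft_eq_iSup]
      exact le_iSup (fun N => ((lpp v N N : ℕ) : ℝ≥0∞)) N
    have h2 := Nat.lt_ceil.2 (h1.trans_lt hlt)
    exact_mod_cast (by omega : lpp v N N ≤ cutoff η θ s ε)
  · intro h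
    refine ⟨ne_top_of_le_ne_top (ENNReal.natCast_ne_top _) h, ?_⟩
    have h1 := ENNReal.toReal_mono (ENNReal.natCast_ne_top _) h
    rw [ENNReal.toReal_natCast] at h1
    exact h1.trans_lt (Nat.lt_ceil.1 (by omega))

/-- The limit law of the longest down-left path, with the kernel in the form of a series. -/
theorem tendsto_scaledLppProb (hα : 0 ≤ α) (hη : 0 < η) (hθ : 0 < θ) (s : ℝ)
    (Ω : ℝ → Type*) [∀ ε, MeasurableSpace (Ω ε)] (P : ∀ ε, Measure (Ω ε))
    [∀ ε, IsProbabilityMeasure (P ε)] (w : ∀ ε, ℕ × ℕ → Ω ε → ℕ)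
    (hw : ∀ ε, 0 < ε → IsGeoField (P ε) (w ε) (Real.exp (-(α * ε))) (Real.exp (-ε)) η θ) :
    Tendsto (fun ε : ℝ => (scaledLppProb (P ε)
      (fun ω => lppDownLeft fun p => w ε p ω) ε η θ s : ℂ)) (𝓝[>] 0)
      (𝓝 (fredholmDet (fun u v => (hardSeries α η θ u v : ℂ)) (Set.Ioi s))) := by
  refine (tendsto_fredholmDet_scaledKernel hα hη hθ s).congr' ?_
  filter_upwards [self_mem_nhdsWithin, (tendsto_atTop_add_const_left _ s
    (tendsto_centering hη hθ)).eventually_gt_atTop 0] with ε hε hs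
  have hε' : 0 < ε := hε
  have hexp : ∀ {c : ℝ}, 0 < c → Real.exp (-(ε * c)) < 1 := fun hc =>
    Real.exp_lt_one_iff.2 (neg_lt_zero.2 (mul_pos hε' hc))
  have hp := (hw ε hε).isProductGeoField (Real.exp_pos _).le
  rw [funext (rowParam_exp (ε := ε) (α := α) (η := η)),
    funext (rowParam_exp (ε := ε) (α := α) (η := θ))] at hp
  have h := measureReal_lppDownLeft_le_eq hp (Real.exp_pos _) (hexp (poleExp_pos hα hη 0))
    (Real.exp_pos _) (hexp (poleExp_pos hα hθ 0)) (Real.exp_pos _) (hexp hη) (Real.exp_pos _)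
    (hexp hθ) (cutoff η θ s ε) hε' s
  simp only [scaledLppProb, setOf_scaled_lt_eq _ hε' hs]
  rw [h]
  rfl

/-- The scaled distribution function depends on the last passage time through its law only. -/
theorem scaledLppProb_congr {Ω : Type*} [MeasurableSpace Ω] {P : Measure Ω} {L L' : Ω → ℝ≥0∞}
    (h : IdentDistrib L L' P P) (ε η θ s : ℝ) :
    scaledLppProb P L ε η θ s = scaledLppProb P L' ε η θ s := by
  have hm : MeasurableSet {x : ℝ≥0∞ | x ≠ ∞ ∧
      ε * x.toReal + Real.log (ε * η) / η + Real.log (ε * θ) / θ < s} :=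
    (measurableSet_singleton ∞).compl.inter
      (measurableSet_lt (((ENNReal.measurable_toReal.const_mul ε).add_const _).add_const _)
        measurable_const)
  exact congrArg ENNReal.toReal (h.measure_mem_eq hm)

end

/-! ### Integrals over the Hankel contour -/

theorem integrable_exp_neg_abs : Integrable fun t : ℝ => Real.exp (-|t|) := by
  rw [← integrableOn_univ, ← Set.Iic_union_Ioi (a := (0 : ℝ))]
  refine IntegrableOn.union ?_ ?_
  · exact (integrableOn_exp_Iic 0).congr_fun (fun t ht => by
      rw [abs_of_nonpos (Set.mem_Iic.1 ht), neg_neg]) measurableSet_Iic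
  · have := exp_neg_integrableOn_Ioi 0 one_pos
    exact this.congr_fun (fun t ht => by
      simp [abs_of_pos (Set.mem_Ioi.1 ht)]) measurableSet_Ioi

section

variable {δ h : ℝ}

theorem continuous_hankelRight (δ h : ℝ) : Continuous (hankelRight δ h) := by
  have : hankelRight δ h = fun t => ((δ + max (|t| - h) 0 : ℝ) : ℂ) +
      ((max (-h) (min t h) : ℝ) : ℂ) * Complex.I := by
    funext t
    apply Complex.ext <;> simp [hankelRight]
  rw [this]
  fun_prop

theorem hankelRight_re (δ h t : ℝ) : (hankelRight δ h t).re = δ + max (|t| - h) 0 := rfl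

theorem le_hankelRight_re (δ h t : ℝ) : δ ≤ (hankelRight δ h t).re :=
  le_add_of_nonneg_right (le_max_right _ _)

theorem abs_hankelRight_im_le (hh : 0 < h) (t : ℝ) : |(hankelRight δ h t).im| ≤ h :=
  abs_le.2 ⟨le_max_left _ _, max_le (by linarith) (min_le_right _ _)⟩

theorem exp_neg_hankelRight_re_le (t : ℝ) :
    Real.exp (-(hankelRight δ h t).re) ≤ Real.exp (h - δ) * Real.exp (-|t|) := by
  rw [← Real.exp_add, Real.exp_le_exp, hankelRight_re]
  linarith [le_max_left (|t| - h) 0]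

theorem hankelRight_of_abs_le {t : ℝ} (ht : |t| ≤ h) :
    hankelRight δ h t = δ + t * Complex.I := by
  obtain ⟨h1, h2⟩ := abs_le.1 ht
  apply Complex.ext <;> simp [hankelRight, ht, h1, h2]

theorem hankelRight_of_le (hh : 0 < h) {t : ℝ} (ht : h ≤ t) :
    hankelRight δ h t = ((t + (δ - h) : ℝ) : ℂ) + h * Complex.I := by
  have h1 : 0 < t := hh.trans_le ht
  apply Complex.ext
  · simp [hankelRight, abs_of_pos h1, ht]; ring
  · simp [hankelRight, ht, hh.le]

theorem hankelRight_of_le_neg (hh : 0 < h) {t : ℝ} (ht : t ≤ -h) :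
    hankelRight δ h t = ((δ - h - t : ℝ) : ℂ) + ((-h : ℝ) : ℂ) * Complex.I := by
  have h1 : t < 0 := by linarith
  apply Complex.ext
  · simp only [hankelRight, abs_of_neg h1, max_eq_left (show 0 ≤ -t - h by linarith)]
    simp; ring
  · simp only [hankelRight, min_eq_left (show t ≤ h by linarith), max_eq_left ht]
    simp

/-- A point on the axis to the right of `δ` has a positive distance to the contour. -/
theorem le_norm_hankelRight_sub (hh : 0 < h) {w : ℝ} (t : ℝ) :
    min h (w - δ) ≤ ‖hankelRight δ h t - w‖ := by
  rcases le_total |t| h with ht | ht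
  · refine (min_le_right _ _).trans ?_
    refine le_trans ?_ (Complex.abs_re_le_norm _)
    rw [hankelRight_of_abs_le ht]
    simp only [Complex.sub_re, Complex.add_re, Complex.ofReal_re, Complex.mul_re, Complex.I_re,
      mul_zero, Complex.ofReal_im, Complex.I_im, sub_zero, add_zero, zero_mul]
    rw [abs_sub_comm]
    exact le_abs_self _
  · refine (min_le_left _ _).trans (le_trans ?_ (Complex.abs_im_le_norm _))
    rcases le_abs'.1 ht with h1 | h1
    · rw [hankelRight_of_le_neg hh h1]
      simp [abs_of_pos hh]
    · rw [hankelRight_of_le hh h1]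
      simp [abs_of_pos hh]

theorem measurable_hankelRightVel (h : ℝ) : Measurable (hankelRightVel h) := by
  unfold hankelRightVel
  exact Measurable.ite (measurableSet_lt (by fun_prop) measurable_const) measurable_const
    (Measurable.ite measurableSet_Ioi measurable_const measurable_const)

theorem norm_hankelRightVel (h t : ℝ) : ‖hankelRightVel h t‖ = 1 := by
  unfold hankelRightVel
  split_ifs <;> simp

theorem integrable_hankel {C : ℝ} {f : ℂ → ℂ}
    (hf : Continuous fun t => f (hankelRight δ h t))
    (hC : ∀ t, ‖f (hankelRight δ h t)‖ ≤ C * Real.exp (-(hankelRight δ h t).re)) :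
    Integrable fun t => f (hankelRight δ h t) * hankelRightVel h t := by
  have hC0 : 0 ≤ C := by
    have := (norm_nonneg _).trans (hC 0)
    exact nonneg_of_mul_nonneg_left this (Real.exp_pos _)
  refine (integrable_exp_neg_abs.const_mul (C * Real.exp (h - δ))).mono'
    (hf.measurable.mul (measurable_hankelRightVel h)).aestronglyMeasurable
    (Eventually.of_forall fun t => ?_)
  rw [norm_mul, norm_hankelRightVel, mul_one, mul_assoc]
  exact (hC t).trans (mul_le_mul_of_nonneg_left (exp_neg_hankelRight_re_le t) hC0)

/-- The part of the contour with parameters in `[-R, R]` consists of three sides of a rectangle. -/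
theorem intervalIntegral_hankel (hh : 0 < h) {R : ℝ} (hR : h ≤ R) {f : ℂ → ℂ}
    (hf : Integrable fun t => f (hankelRight δ h t) * hankelRightVel h t) :
    ∫ t in -R..R, f (hankelRight δ h t) * hankelRightVel h t =
      -(∫ x in δ..(R + (δ - h)), f (x + (-h : ℝ) * Complex.I)) +
        Complex.I * (∫ y in -h..h, f (δ + y * Complex.I)) +
        ∫ x in δ..(R + (δ - h)), f (x + h * Complex.I) := by
  rw [← intervalIntegral.integral_add_adjacent_intervals (b := -h) hf.intervalIntegrable
    hf.intervalIntegrable, ← intervalIntegral.integral_add_adjacent_intervals (b := h) (a := -h)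
    hf.intervalIntegrable hf.intervalIntegrable, ← add_assoc]
  congr 1
  · congr 1
    · have e := intervalIntegral.integral_comp_sub_left
        (fun x : ℝ => f (x + (-h : ℝ) * Complex.I)) (δ - h) (a := -R) (b := -h)
      rw [show δ - h - -h = δ by ring, show δ - h - -R = R + (δ - h) by ring] at e
      rw [← e, ← intervalIntegral.integral_neg]
      refine intervalIntegral.integral_congr_ae (Eventually.of_forall fun t ht => ?_)
      rw [Set.uIoc_of_le (by linarith)] at ht
      have h1 : ¬ |t| < h := by rw [abs_of_neg (by linarith [ht.2])]; linarith [ht.2]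
      rw [hankelRight_of_le_neg hh ht.2, hankelRightVel, if_neg h1, if_neg (by linarith [ht.2]),
        mul_neg_one]
    · rw [← intervalIntegral.integral_const_mul]
      refine intervalIntegral.integral_congr_ae ?_
      have h0 : ∀ᵐ t : ℝ, t ≠ h := by simp [ae_iff]
      filter_upwards [h0] with t hth ht
      rw [Set.uIoc_of_le (by linarith)] at ht
      have h1 : |t| < h := abs_lt.2 ⟨ht.1, lt_of_le_of_ne ht.2 hth⟩
      rw [hankelRight_of_abs_le h1.le, hankelRightVel, if_pos h1, mul_comm]
  · have e := intervalIntegral.integral_comp_add_right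
      (fun x : ℝ => f (x + h * Complex.I)) (δ - h) (a := h) (b := R)
    rw [show h + (δ - h) = δ by ring] at e
    rw [← e]
    refine intervalIntegral.integral_congr_ae (Eventually.of_forall fun t ht => ?_)
    rw [Set.uIoc_of_le hR] at ht
    have h1 : ¬ |t| < h := by rw [abs_of_pos (by linarith [ht.1])]; linarith [ht.1]
    rw [hankelRight_of_le hh ht.1.le, hankelRightVel, if_neg h1, if_pos (by linarith [ht.1]),
      mul_one]

/-- The integral over the contour of a function that decays exponentially in a half strip, in terms
of its integrals over the boundaries of large rectangles. -/
theorem integral_hankel_eq_neg (hh : 0 < h) {C : ℝ} {f : ℂ → ℂ} {c : ℂ}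
    (hf : Integrable fun t => f (hankelRight δ h t) * hankelRightVel h t)
    (hC : ∀ᶠ b : ℝ in atTop, ∀ y : ℝ, |y| ≤ h → ‖f (b + y * Complex.I)‖ ≤ C * Real.exp (-b))
    (hc : ∀ᶠ b : ℝ in atTop, (∫ x in δ..b, f (x + (-h : ℝ) * Complex.I)) -
      (∫ x in δ..b, f (x + h * Complex.I)) + Complex.I * (∫ y in -h..h, f (b + y * Complex.I)) -
      Complex.I * (∫ y in -h..h, f (δ + y * Complex.I)) = c) :
    ∫ t, f (hankelRight δ h t) * hankelRightVel h t = -c := by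
  have h1 : Tendsto (fun R : ℝ => ∫ t in -R..R, f (hankelRight δ h t) * hankelRightVel h t) atTop
      (𝓝 (∫ t, f (hankelRight δ h t) * hankelRightVel h t)) :=
    intervalIntegral_tendsto_integral hf tendsto_neg_atTop_atBot tendsto_id
  have hsh : Tendsto (fun R : ℝ => R + (δ - h)) atTop atTop := tendsto_atTop_add_const_right _ _
    tendsto_id
  have h2 : Tendsto (fun b : ℝ => Complex.I * ∫ y in -h..h, f (b + y * Complex.I)) atTop
      (𝓝 0) := by
    refine squeeze_zero_norm' (a := fun b => C * Real.exp (-b) * |h - -h|) ?_ ?_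
    · filter_upwards [hC] with b hb
      rw [norm_mul, Complex.norm_I, one_mul]
      refine intervalIntegral.norm_integral_le_of_norm_le_const fun y hy => ?_
      rw [Set.uIoc_of_le (by linarith)] at hy
      exact hb y (abs_le.2 ⟨hy.1.le, hy.2⟩)
    · have : Tendsto (fun b => C * Real.exp (-b) * |h - -h|) atTop (𝓝 (C * 0 * |h - -h|)) :=
        ((Real.tendsto_exp_atBot.comp tendsto_neg_atTop_atBot).const_mul C).mul_const _
      simpa using this
  refine tendsto_nhds_unique h1 ?_
  have h3 := ((h2.comp hsh).add_const (-c))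
  rw [zero_add] at h3
  refine h3.congr' ?_
  filter_upwards [hsh.eventually hc, eventually_ge_atTop h] with R hR hRh
  rw [intervalIntegral_hankel hh hRh hf, ← hR]
  simp only [Function.comp]
  ring

theorem reProdIm_subset_of_le {a b : ℝ} {U : Set ℂ} (hU : ∀ z : ℂ, δ ≤ z.re → z ∈ U)
    (ha : δ ≤ a) (hb : δ ≤ b) (s : Set ℝ) : Set.uIcc a b ×ℂ s ⊆ U := fun z hz =>
  hU z ((le_min ha hb).trans hz.1.1)

/-- Cauchy's theorem for the contour: the integral of a function that is holomorphic to its right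
and decays there vanishes. -/
theorem integral_hankel_eq_zero (hh : 0 < h) {C : ℝ} {f : ℂ → ℂ} {U : Set ℂ}
    (hU : ∀ z : ℂ, δ ≤ z.re → z ∈ U) (hf : DifferentiableOn ℂ f U)
    (hC : ∀ z : ℂ, δ ≤ z.re → |z.im| ≤ h → ‖f z‖ ≤ C * Real.exp (-z.re)) :
    ∫ t, f (hankelRight δ h t) * hankelRightVel h t = 0 := by
  have hcont : Continuous fun t => f (hankelRight δ h t) :=
    hf.continuousOn.comp_continuous (continuous_hankelRight δ h) fun t =>
      hU _ (le_hankelRight_re δ h t)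
  rw [integral_hankel_eq_neg hh (C := C) (c := 0) (integrable_hankel hcont fun t =>
    hC _ (le_hankelRight_re δ h t) (abs_hankelRight_im_le hh t)), neg_zero]
  · filter_upwards [eventually_ge_atTop δ] with b hb y hy
    have := hC (b + y * Complex.I) (by simpa using hb) (by simpa using hy)
    simpa using this
  · filter_upwards [eventually_ge_atTop δ] with b hb
    have := Complex.integral_boundary_rect_eq_zero_of_differentiableOn f ⟨δ, -h⟩ ⟨b, h⟩
      (hf.mono (reProdIm_subset_of_le hU le_rfl hb _))
    simpa using this

theorem log_sub_log_neg {p : ℂ} (hp : 0 < p.im) :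
    Complex.log p - Complex.log (-p) = Real.pi * Complex.I := by
  rw [Complex.log, Complex.log, norm_neg, Complex.arg_neg_eq_arg_sub_pi_of_im_pos hp]
  push_cast
  ring

/-- The winding number of the boundary of a rectangle around a point on its axis. -/
theorem integral_rect_inv_sub (hh : 0 < h) {a b w : ℝ} (haw : a < w) (hwb : w < b) :
    (∫ x in a..b, ((x : ℂ) + (-h : ℝ) * Complex.I - w)⁻¹) -
      (∫ x in a..b, ((x : ℂ) + h * Complex.I - w)⁻¹) +
      Complex.I * (∫ y in -h..h, ((b : ℂ) + y * Complex.I - w)⁻¹) -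
      Complex.I * (∫ y in -h..h, ((a : ℂ) + y * Complex.I - w)⁻¹) =
      2 * Real.pi * Complex.I := by
  have horiz : ∀ k : ℝ, k ≠ 0 → ∫ x in a..b, ((x : ℂ) + k * Complex.I - w)⁻¹ =
      Complex.log (b + k * Complex.I - w) - Complex.log (a + k * Complex.I - w) := by
    intro k hk
    have hs : ∀ x : ℝ, (x : ℂ) + k * Complex.I - w ∈ Complex.slitPlane := fun x =>
      Or.inr (by simpa using hk)
    refine intervalIntegral.integral_eq_sub_of_hasDerivAt
      (f := fun x : ℝ => Complex.log (x + k * Complex.I - w)) (fun x _ => ?_) ?_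
    · have := (((Complex.ofRealCLM.hasDerivAt (x := x)).add_const (k * Complex.I)).sub_const
        (w : ℂ)).clog_real (hs x)
      simpa using this
    · refine ContinuousOn.intervalIntegrable fun x _ => ContinuousAt.continuousWithinAt ?_
      exact ContinuousAt.inv₀ (by fun_prop) (Complex.slitPlane_ne_zero (hs x))
  have hright : Complex.I * ∫ y in -h..h, ((b : ℂ) + y * Complex.I - w)⁻¹ =
      Complex.log (b + h * Complex.I - w) - Complex.log (b + (-h : ℝ) * Complex.I - w) := by
    have hs : ∀ y : ℝ, (b : ℂ) + y * Complex.I - w ∈ Complex.slitPlane := fun y =>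
      Or.inl (by simpa using hwb)
    rw [← intervalIntegral.integral_const_mul]
    refine intervalIntegral.integral_eq_sub_of_hasDerivAt
      (f := fun y : ℝ => Complex.log (b + y * Complex.I - w)) (fun y _ => ?_) ?_
    · have := ((((Complex.ofRealCLM.hasDerivAt (x := y)).mul_const Complex.I).const_add
        (b : ℂ)).sub_const (w : ℂ)).clog_real (hs y)
      simpa [div_eq_mul_inv] using this
    · refine ContinuousOn.intervalIntegrable fun y _ => ContinuousAt.continuousWithinAt ?_
      exact ContinuousAt.mul continuousAt_const
        (ContinuousAt.inv₀ (by fun_prop) (Complex.slitPlane_ne_zero (hs y)))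
  -- this side meets the branch cut of `log (z - w)`, so the primitive here is `log (-(z - w))`
  have hleft : Complex.I * ∫ y in -h..h, ((a : ℂ) + y * Complex.I - w)⁻¹ =
      Complex.log (-(a + h * Complex.I - w)) - Complex.log (-(a + (-h : ℝ) * Complex.I - w)) := by
    have hs : ∀ y : ℝ, -((a : ℂ) + y * Complex.I - w) ∈ Complex.slitPlane := fun y =>
      Or.inl (by simpa using haw)
    rw [← intervalIntegral.integral_const_mul]
    refine intervalIntegral.integral_eq_sub_of_hasDerivAt
      (f := fun y : ℝ => Complex.log (-(a + y * Complex.I - w))) (fun y _ => ?_) ?_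
    · have := (((((Complex.ofRealCLM.hasDerivAt (x := y)).mul_const Complex.I).const_add
        (a : ℂ)).sub_const (w : ℂ)).neg).clog_real (hs y)
      simp only [Pi.neg_apply, neg_div_neg_eq] at this
      simpa [div_eq_mul_inv] using this
    · refine ContinuousOn.intervalIntegrable fun y _ => ContinuousAt.continuousWithinAt ?_
      refine ContinuousAt.mul continuousAt_const (ContinuousAt.inv₀ (by fun_prop) ?_)
      exact neg_ne_zero.1 (Complex.slitPlane_ne_zero (hs y))
  rw [horiz _ (neg_ne_zero.2 hh.ne'), horiz _ hh.ne', hright, hleft]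
  have e1 := log_sub_log_neg (p := -(a + (-h : ℝ) * Complex.I - w)) (by simpa using hh)
  have e2 := log_sub_log_neg (p := a + h * Complex.I - w) (by simpa using hh)
  rw [neg_neg] at e1
  linear_combination e1 + e2

end

/-! ### Cauchy's formula for the Hankel contour -/

section

variable {δ h : ℝ}

/-- Cauchy's formula for the contour, which runs clockwise around the points of the half axis. -/
theorem integral_hankel_div_sub (hh : 0 < h) {C : ℝ} {F : ℂ → ℂ} {U : Set ℂ} (hUo : IsOpen U)
    (hU : ∀ z : ℂ, δ ≤ z.re → z ∈ U) (hF : DifferentiableOn ℂ F U)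
    (hC : ∀ z : ℂ, δ ≤ z.re → |z.im| ≤ h → ‖F z‖ ≤ C * Real.exp (-z.re)) {w : ℝ} (hw : δ < w) :
    ∫ t, F (hankelRight δ h t) / (hankelRight δ h t - w) * hankelRightVel h t =
      -(2 * Real.pi * Complex.I * F w) := by
  set f : ℂ → ℂ := fun z => F z / (z - w) with hf
  have hm : 0 < min h (w - δ) := lt_min hh (sub_pos.2 hw)
  have hne : ∀ t, hankelRight δ h t - w ≠ 0 := fun t =>
    norm_pos_iff.1 (hm.trans_le (le_norm_hankelRight_sub hh t))
  have hC0 : 0 ≤ C := by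
    have := (norm_nonneg _).trans (hC δ (by simp) (by simp [hh.le]))
    exact nonneg_of_mul_nonneg_left this (Real.exp_pos _)
  have hcont : Continuous fun t => f (hankelRight δ h t) :=
    (hF.continuousOn.comp_continuous (continuous_hankelRight δ h) fun t =>
      hU _ (le_hankelRight_re δ h t)).div ((continuous_hankelRight δ h).sub continuous_const) hne
  have hbound : ∀ t, ‖f (hankelRight δ h t)‖ ≤
      C / min h (w - δ) * Real.exp (-(hankelRight δ h t).re) := fun t => by
    rw [hf, norm_div, div_mul_eq_mul_div]
    exact div_le_div₀ (by positivity) (hC _ (le_hankelRight_re δ h t) (abs_hankelRight_im_le hh t))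
      hm (le_norm_hankelRight_sub hh t)
  rw [integral_hankel_eq_neg hh (C := C) (f := f) (c := 2 * Real.pi * Complex.I * F w)
    (integrable_hankel hcont hbound)]
  · filter_upwards [eventually_ge_atTop (w + 1), eventually_ge_atTop δ] with b hb hb2 y hy
    have h1 := hC (b + y * Complex.I) (by simpa using hb2) (by simpa using hy)
    have h2 : 1 ≤ ‖(b : ℂ) + y * Complex.I - w‖ := by
      refine le_trans ?_ (Complex.re_le_norm _)
      simp only [Complex.sub_re, Complex.add_re, Complex.ofReal_re, Complex.mul_re, Complex.I_re,
        mul_zero, Complex.ofReal_im, Complex.I_im]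
      linarith
    rw [hf, norm_div]
    refine (div_le_self (norm_nonneg _) h2).trans ?_
    simpa using h1
  · filter_upwards [eventually_gt_atTop w] with b hb
    have hg : DifferentiableOn ℂ (dslope F w) U :=
      (Complex.differentiableOn_dslope (hUo.mem_nhds (hU w (by simpa using hw.le)))).2 hF
    have h0 := Complex.integral_boundary_rect_eq_zero_of_differentiableOn (dslope F w) ⟨δ, -h⟩
      ⟨b, h⟩ (hg.mono (reProdIm_subset_of_le hU le_rfl (hw.trans hb).le _))
    have h1 := integral_rect_inv_sub hh hw hb
    -- away from the pole, the integrand is the sum of a holomorphic function and a multiple of the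
    -- inverse
    have side : ∀ (γ : ℝ → ℂ) (c d : ℝ), Continuous γ → (∀ x ∈ Set.uIcc c d, δ ≤ (γ x).re) →
        (∀ x, γ x - w ≠ 0) → ∫ x in c..d, f (γ x) =
        (∫ x in c..d, dslope F w (γ x)) + F w * ∫ x in c..d, (γ x - w)⁻¹ := by
      intro γ c d hγ hre hγw
      rw [← intervalIntegral.integral_const_mul, ← intervalIntegral.integral_add]
      · refine intervalIntegral.integral_congr fun x _ => ?_
        have hx : γ x ≠ w := sub_ne_zero.1 (hγw x)
        simp only [hf]
        rw [dslope_of_ne _ hx, slope_def_field]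
        field_simp [hγw x]
        ring
      · exact (hg.continuousOn.comp hγ.continuousOn fun x hx => hU _ (hre x hx)).intervalIntegrable
      · exact (continuous_const.mul ((hγ.sub continuous_const).inv₀ hγw)).intervalIntegrable _ _
    have hre1 : ∀ k : ℝ, ∀ x ∈ Set.uIcc δ b, δ ≤ ((x : ℂ) + k * Complex.I).re := fun k x hx => by
      rw [Set.uIcc_of_le (hw.trans hb).le] at hx
      simpa using hx.1
    have hk : ∀ k : ℝ, k ≠ 0 → ∀ x : ℝ, (x : ℂ) + k * Complex.I - w ≠ 0 := fun k hk x h =>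
      hk (by simpa using congrArg Complex.im h)
    have hv : ∀ a : ℝ, a ≠ w → ∀ y : ℝ, (a : ℂ) + y * Complex.I - w ≠ 0 := fun a ha y h =>
      ha (sub_eq_zero.1 (by simpa using congrArg Complex.re h))
    rw [side (fun x => x + (-h : ℝ) * Complex.I) δ b (by fun_prop) (hre1 _)
        (hk _ (neg_ne_zero.2 hh.ne')),
      side (fun x => x + h * Complex.I) δ b (by fun_prop) (hre1 _) (hk _ hh.ne'),
      side (fun y => b + y * Complex.I) (-h) h (by fun_prop)
        (fun y _ => by simpa using (hw.trans hb).le) (hv b hb.ne'),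
      side (fun y => δ + y * Complex.I) (-h) h (by fun_prop) (fun y _ => by simp) (hv δ hw.ne)]
    simp only [smul_eq_mul] at h0
    linear_combination h0 + F w * h1

end

/-! ### The poles of the Gamma function -/

/-- The sum of the principal parts of the Gamma function. -/
def gammaPolar (z : ℂ) : ℂ := ∑' k : ℕ, (-1) ^ k / (k ! : ℂ) / (z + k)

/-- The entire part `∫_1^∞ t^(z - 1) e^(-t) dt` of the Gamma function, as a Mellin transform. -/
def gammaEntire (z : ℂ) : ℂ :=
  mellin (Set.indicator (Set.Ioi 1) fun t : ℝ => ((Real.exp (-t) : ℝ) : ℂ)) z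

theorem gammaEntire_eq (z : ℂ) :
    gammaEntire z = ∫ t in Set.Ioi (1 : ℝ), ((Real.exp (-t) : ℝ) : ℂ) * (t : ℂ) ^ (z - 1) := by
  have h : ∀ t : ℝ, (t : ℂ) ^ (z - 1) • Set.indicator (Set.Ioi 1)
      (fun t : ℝ => ((Real.exp (-t) : ℝ) : ℂ)) t =
      Set.indicator (Set.Ioi 1) (fun t : ℝ => ((Real.exp (-t) : ℝ) : ℂ) * (t : ℂ) ^ (z - 1)) t :=
    fun t => by
      by_cases ht : t ∈ Set.Ioi (1 : ℝ)
      · rw [Set.indicator_of_mem ht, Set.indicator_of_mem ht, smul_eq_mul, mul_comm]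
      · rw [Set.indicator_of_notMem ht, Set.indicator_of_notMem ht, smul_zero]
  rw [gammaEntire, mellin]
  simp only [h]
  rw [setIntegral_indicator measurableSet_Ioi,
    Set.inter_eq_right.2 (Set.Ioi_subset_Ioi zero_le_one)]

theorem differentiable_gammaEntire : Differentiable ℂ gammaEntire := by
  intro z
  refine mellin_differentiableAt_of_isBigO_rpow_exp (a := 1) (b := z.re - 1) one_pos ?_ ?_ ?_
    (by linarith)
  · refine (Integrable.locallyIntegrable ?_).locallyIntegrableOn _
    rw [integrable_indicator_iff measurableSet_Ioi]
    have := (exp_neg_integrableOn_Ioi 1 one_pos).ofReal (𝕜 := ℂ)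
    simpa [IntegrableOn] using this
  · refine Asymptotics.IsBigO.of_bound 1 (Eventually.of_forall fun t => ?_)
    refine (norm_indicator_le_norm_self _ _).trans ?_
    rw [one_mul, Complex.norm_real, neg_one_mul]
  · refine Asymptotics.IsBigO.of_bound 1 ?_
    filter_upwards [Ioo_mem_nhdsGT (show (0 : ℝ) < 1 from one_pos)] with t ht
    rw [Set.indicator_of_notMem (by simpa using ht.2.le), norm_zero]
    positivity

theorem summable_gammaPolar {z : ℂ} {m : ℝ} (hm : 0 < m) (hz : ∀ k : ℕ, m ≤ ‖z + k‖) :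
    Summable fun k : ℕ => (-1) ^ k / (k ! : ℂ) / (z + k) := by
  refine Summable.of_norm_bounded ((Real.summable_pow_div_factorial 1).mul_right m⁻¹) fun k => ?_
  rw [norm_div, norm_div, norm_pow, norm_neg, norm_one, one_pow, Complex.norm_natCast,
    div_eq_mul_inv _ ‖z + k‖]
  exact mul_le_mul_of_nonneg_left (inv_anti₀ hm (hz k)) (by positivity)

theorem Gamma_eq_polar_add_entire_of_re_pos {z : ℂ} (hz : 0 < z.re) :
    Complex.Gamma z = gammaPolar z + gammaEntire z := by
  have hint := Complex.GammaIntegral_convergent hz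
  rw [Complex.Gamma_eq_integral hz, Complex.GammaIntegral,
    ← Set.Ioc_union_Ioi_eq_Ioi (zero_le_one (α := ℝ)),
    setIntegral_union (Set.Ioc_disjoint_Ioi le_rfl) measurableSet_Ioi
      (hint.mono_set Set.Ioc_subset_Ioi_self) (hint.mono_set (Set.Ioi_subset_Ioi zero_le_one)),
    gammaEntire_eq]
  congr 1
  -- expand the exponential on `(0, 1]` and integrate term by term
  have hterm : ∀ k : ℕ, IntegrableOn (fun t : ℝ => (-1) ^ k / (k ! : ℂ) * (t : ℂ) ^ (z + k - 1))
      (Set.Ioc 0 1) := fun k => by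
    have := (intervalIntegral.intervalIntegrable_cpow' (r := z + k - 1) (a := 0) (b := 1)
      (by simp; positivity)).const_mul ((-1) ^ k / (k ! : ℂ))
    rwa [intervalIntegrable_iff_integrableOn_Ioc_of_le zero_le_one] at this
  have hval : ∀ k : ℕ, ∫ t in Set.Ioc (0 : ℝ) 1, (-1) ^ k / (k ! : ℂ) * (t : ℂ) ^ (z + k - 1) =
      (-1) ^ k / (k ! : ℂ) / (z + k) := fun k => by
    have hzk : z + k ≠ 0 := fun h => by
      have := congrArg Complex.re h
      simp at this
      have : (0 : ℝ) ≤ k := by positivity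
      linarith
    rw [integral_const_mul, ← intervalIntegral.integral_of_le zero_le_one,
      integral_cpow (Or.inl (by simp; positivity)), sub_add_cancel, Complex.ofReal_one,
      Complex.one_cpow, Complex.ofReal_zero, Complex.zero_cpow hzk, sub_zero, mul_one_div]
  have hsum : Summable fun k : ℕ => ∫ t in Set.Ioc (0 : ℝ) 1,
      ‖(-1) ^ k / (k ! : ℂ) * (t : ℂ) ^ (z + k - 1)‖ := by
    refine Summable.of_nonneg_of_le (fun k => integral_nonneg fun _ => norm_nonneg _)
      (f := fun k => 1 ^ k / (k ! : ℝ) * ∫ t in Set.Ioc (0 : ℝ) 1, ‖(t : ℂ) ^ (z - 1)‖)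
      (fun k => ?_) ((Real.summable_pow_div_factorial 1).mul_right _)
    rw [← integral_const_mul]
    have hi : IntegrableOn (fun t : ℝ => (t : ℂ) ^ (z - 1)) (Set.Ioc 0 1) := by
      have := intervalIntegral.intervalIntegrable_cpow' (r := z - 1) (a := 0) (b := 1)
        (by simpa using hz)
      rwa [intervalIntegrable_iff_integrableOn_Ioc_of_le zero_le_one] at this
    refine setIntegral_mono_on (hterm k).norm (hi.norm.const_mul _) measurableSet_Ioc fun t ht => ?_
    rw [norm_mul, norm_div, norm_pow, norm_neg, norm_one, Complex.norm_natCast,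
      Complex.norm_cpow_eq_rpow_re_of_pos ht.1, Complex.norm_cpow_eq_rpow_re_of_pos ht.1]
    refine mul_le_mul_of_nonneg_left ?_ (by positivity)
    refine Real.rpow_le_rpow_of_exponent_ge ht.1 ht.2 ?_
    simp
  rw [gammaPolar, ← tsum_congr hval,
    integral_tsum_of_summable_integral_norm hterm hsum]
  refine setIntegral_congr_fun measurableSet_Ioc fun t ht => ?_
  have ht0 : (t : ℂ) ≠ 0 := by exact_mod_cast ht.1.ne'
  have he : ((Real.exp (-t) : ℝ) : ℂ) = ∑' k : ℕ, (-(t : ℂ)) ^ k / (k ! : ℂ) := by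
    rw [Complex.ofReal_exp, Complex.exp_eq_exp_ℂ, NormedSpace.exp_eq_tsum_div]
    simp
  rw [he, ← tsum_mul_right]
  refine tsum_congr fun k => ?_
  rw [show z + k - 1 = (k : ℂ) + (z - 1) by ring, Complex.cpow_add _ _ ht0, Complex.cpow_natCast,
    neg_pow]
  ring


theorem tsum_inv_factorial_alternating :
    ∑' k : ℕ, (-1 : ℂ) ^ k / (k ! : ℂ) = Complex.exp (-1) := by
  rw [Complex.exp_eq_exp_ℂ, NormedSpace.exp_eq_tsum_div]

theorem gammaPolar_add_one {z : ℂ} {m : ℝ} (hm : 0 < m) (hz : ∀ k : ℕ, m ≤ ‖z + k‖) :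
    gammaPolar (z + 1) = z * gammaPolar z - Complex.exp (-1) := by
  have hne : ∀ k : ℕ, z + k ≠ 0 := fun k => norm_pos_iff.1 (hm.trans_le (hz k))
  have hs : Summable fun k : ℕ => (-1 : ℂ) ^ k / (k ! : ℂ) := by
    have := NormedSpace.expSeries_div_summable (𝔸 := ℂ) (-1 : ℂ)
    exact this
  have h1 : ∀ k : ℕ, (-1 : ℂ) ^ k / (k ! : ℂ) - z * ((-1) ^ k / (k ! : ℂ) / (z + k)) =
      k * ((-1) ^ k / (k ! : ℂ)) / (z + k) := fun k => by
    have := hne k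
    have : (k ! : ℂ) ≠ 0 := by exact_mod_cast k.factorial_ne_zero
    field_simp
    ring
  have hP := (summable_gammaPolar hm hz).mul_left z
  have h2 : Complex.exp (-1) - z * gammaPolar z =
      ∑' k : ℕ, k * ((-1) ^ k / (k ! : ℂ)) / (z + k) := by
    rw [← tsum_inv_factorial_alternating, gammaPolar, ← tsum_mul_left, ← hs.tsum_sub hP]
    exact tsum_congr h1
  have h3 : Summable fun k : ℕ => k * ((-1) ^ k / (k ! : ℂ)) / (z + k) :=
    (hs.sub hP).congr h1
  rw [h3.tsum_eq_zero_add] at h2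
  simp only [Nat.cast_zero, zero_mul, zero_div, zero_add] at h2
  rw [← neg_sub, h2, gammaPolar, ← tsum_neg]
  refine tsum_congr fun k => ?_
  have : (k ! : ℂ) ≠ 0 := by exact_mod_cast k.factorial_ne_zero
  have h4 : (k : ℂ) + 1 ≠ 0 := by exact_mod_cast k.succ_ne_zero
  have h5 := hne (k + 1)
  push_cast at h5 ⊢
  have h6 : z + 1 + k ≠ 0 := by rwa [add_assoc, add_comm (1 : ℂ)]
  rw [Nat.factorial_succ, pow_succ]
  push_cast
  rw [add_assoc z 1, add_comm (1 : ℂ) k]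
  field_simp

theorem re_le_norm_add_natCast {z : ℂ} (k : ℕ) : z.re ≤ ‖z + k‖ := by
  refine le_trans ?_ (Complex.re_le_norm _)
  simp

theorem gammaEntire_add_one (z : ℂ) :
    gammaEntire (z + 1) = z * gammaEntire z + Complex.exp (-1) := by
  -- by the functional equation this holds in the right half plane
  have h : ∀ z : ℂ, 0 < z.re → gammaEntire (z + 1) = z * gammaEntire z + Complex.exp (-1) := by
    intro z hz
    have hz0 : z ≠ 0 := fun h => by rw [h] at hz; simp at hz
    have h1 := Complex.Gamma_add_one z hz0
    rw [Gamma_eq_polar_add_entire_of_re_pos hz,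
      Gamma_eq_polar_add_entire_of_re_pos (z := z + 1) (by simp; linarith),
      gammaPolar_add_one hz fun k => re_le_norm_add_natCast k] at h1
    linear_combination h1
  have hd := differentiable_gammaEntire
  have hL : AnalyticOnNhd ℂ (fun z => gammaEntire (z + 1)) Set.univ :=
    (Differentiable.differentiableOn (by fun_prop)).analyticOnNhd isOpen_univ
  have hR : AnalyticOnNhd ℂ (fun z => z * gammaEntire z + Complex.exp (-1)) Set.univ :=
    (Differentiable.differentiableOn (by fun_prop)).analyticOnNhd isOpen_univ
  have := hL.eq_of_eventuallyEq hR (z₀ := 1) (by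
    filter_upwards [(isOpen_lt continuous_const Complex.continuous_re).mem_nhds
      (show (0 : ℝ) < (1 : ℂ).re by simp)] with z hz
    exact h z hz)
  exact congrFun this z

/-- The decomposition of the Gamma function into its principal parts and an entire function. -/
theorem Gamma_eq_polar_add_entire {z : ℂ} {m : ℝ} (hm : 0 < m) (hz : ∀ k : ℕ, m ≤ ‖z + k‖) :
    Complex.Gamma z = gammaPolar z + gammaEntire z := by
  have key : ∀ n : ℕ, ∀ z : ℂ, -(n : ℝ) < z.re → (∀ k : ℕ, m ≤ ‖z + k‖) →
      Complex.Gamma z = gammaPolar z + gammaEntire z := by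
    intro n
    induction n with
    | zero => exact fun z hz _ => Gamma_eq_polar_add_entire_of_re_pos (by simpa using hz)
    | succ n ih =>
      intro z hre hz
      have hz0 : z ≠ 0 := norm_pos_iff.1 (hm.trans_le (by simpa using hz 0))
      have h1 := ih (z + 1) (by push_cast at hre; simp; linarith) fun k => by
        have := hz (k + 1)
        rwa [Nat.cast_succ, add_comm (k : ℂ), ← add_assoc] at this
      rw [Complex.Gamma_add_one z hz0, gammaPolar_add_one hm hz, gammaEntire_add_one] at h1
      refine mul_left_cancel₀ hz0 ?_
      linear_combination h1
  obtain ⟨n, hn⟩ := exists_nat_gt (-z.re)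
  exact key n z (by linarith) hz

theorem norm_gammaEntire_le {A : ℝ} (hA : 0 < A) {z : ℂ} (hz : z.re ≤ A) :
    ‖gammaEntire z‖ ≤ Real.Gamma A := by
  have hc := Real.GammaIntegral_convergent hA
  rw [gammaEntire_eq, Real.Gamma_eq_integral hA]
  refine (norm_integral_le_of_norm_le (hc.mono_set (Set.Ioi_subset_Ioi zero_le_one)) ?_).trans
    (setIntegral_mono_set hc ?_ (Set.Ioi_subset_Ioi zero_le_one).eventuallyLE)
  · filter_upwards [ae_restrict_mem measurableSet_Ioi] with t ht
    have ht : 1 < t := ht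
    rw [norm_mul, Complex.norm_real, Real.norm_of_nonneg (Real.exp_pos _).le,
      Complex.norm_cpow_eq_rpow_re_of_pos (one_pos.trans ht)]
    refine mul_le_mul_of_nonneg_left (Real.rpow_le_rpow_of_exponent_le ht.le ?_) (Real.exp_pos _).le
    simpa using hz
  · filter_upwards [ae_restrict_mem measurableSet_Ioi] with t ht
    have ht : 0 < t := ht
    simp only [Pi.zero_apply]
    positivity

theorem norm_gammaPolar_le {z : ℂ} {m : ℝ} (hm : 0 < m) (hz : ∀ k : ℕ, m ≤ ‖z + k‖) :
    ‖gammaPolar z‖ ≤ Real.exp 1 / m := by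
  have he : HasSum (fun k : ℕ => (1 : ℝ) ^ k / (k ! : ℝ)) (Real.exp 1) := by
    rw [Real.exp_eq_exp_ℝ]
    exact NormedSpace.expSeries_div_hasSum_exp (1 : ℝ)
  refine tsum_of_norm_bounded (he.div_const m) fun k => ?_
  rw [norm_div, norm_div, norm_pow, norm_neg, norm_one, one_pow, Complex.norm_natCast]
  exact div_le_div_of_nonneg_left (by positivity) hm (hz k)

/-! ### Integrals of Gamma functions by residues -/

section

variable {δ h : ℝ}

/-- The distance of the contour to the poles of `ζ ↦ Γ(A - ζ / η)`, rescaled by `η`. -/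
def poleGap (A η δ h : ℝ) : ℝ := min h (η * A - δ) / η

theorem poleGap_pos {A η : ℝ} (hh : 0 < h) (hη : 0 < η) (hδ : δ < η * A) :
    0 < poleGap A η δ h :=
  div_pos (lt_min hh (sub_pos.2 hδ)) hη

theorem poleGap_le {A η : ℝ} (hh : 0 < h) (hη : 0 < η) (t : ℝ) (k : ℕ) :
    poleGap A η δ h ≤ ‖(A : ℂ) - hankelRight δ h t / η + k‖ := by
  have h1 : (A : ℂ) - hankelRight δ h t / η + k =
      -(hankelRight δ h t - (η * (A + k) : ℝ)) / η := by
    have : (η : ℂ) ≠ 0 := by exact_mod_cast hη.ne'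
    push_cast
    field_simp
    ring
  rw [h1, norm_div, norm_neg, Complex.norm_real, Real.norm_of_nonneg hη.le, poleGap]
  refine div_le_div_of_nonneg_right ?_ hη.le
  refine le_trans (min_le_min_left _ ?_) (le_norm_hankelRight_sub hh t)
  have : 0 ≤ η * k := by positivity
  linarith [mul_add η A k]

/-- A bound on the Gamma function along the contour. -/
def hankelGammaBound (A η δ h : ℝ) : ℝ := Real.exp 1 / poleGap A η δ h + Real.Gamma A

/-- The Gamma factor is bounded on the contour, although it has poles inside. -/
theorem norm_Gamma_hankelRight_le {A η : ℝ} (hh : 0 < h) (hη : 0 < η) (hδ0 : 0 < δ)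
    (hδ : δ < η * A) (t : ℝ) :
    ‖Complex.Gamma (A - hankelRight δ h t / η)‖ ≤ hankelGammaBound A η δ h := by
  have hA : 0 < A := pos_of_mul_pos_right (hδ0.trans hδ) hη.le
  have hm := poleGap_pos hh hη hδ
  rw [Gamma_eq_polar_add_entire hm (poleGap_le hh hη t)]
  refine (norm_add_le _ _).trans (add_le_add (norm_gammaPolar_le hm (poleGap_le hh hη t))
    (norm_gammaEntire_le hA ?_))
  rw [Complex.sub_re, Complex.div_ofReal_re, Complex.ofReal_re]
  have := div_nonneg (hδ0.le.trans (le_hankelRight_re δ h t)) hη.le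
  linarith

theorem continuous_Gamma_hankelRight {A η : ℝ} (hh : 0 < h) (hη : 0 < η) (hδ : δ < η * A) :
    Continuous fun t => Complex.Gamma (A - hankelRight δ h t / η) := by
  refine continuous_iff_continuousAt.2 fun t => ?_
  have hd : DifferentiableAt ℂ Complex.Gamma (A - hankelRight δ h t / η) :=
    Complex.differentiableAt_Gamma _ fun m hm => by
      have := (poleGap_pos hh hη hδ).trans_le (poleGap_le (A := A) hh hη t m)
      rw [hm, neg_add_cancel, norm_zero] at this
      exact lt_irrefl _ this
  have hc : ContinuousAt (fun t => (A : ℂ) - hankelRight δ h t / η) t :=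
    (continuous_const.sub ((continuous_hankelRight δ h).div_const _)).continuousAt
  exact ContinuousAt.comp (g := Complex.Gamma) hd.continuousAt hc

/-- The integral over the contour against a Gamma function is the sum of the residues at the poles
of the Gamma function, since its entire part does not contribute. -/
theorem hasSum_integral_hankel_Gamma {A η : ℝ} (hh : 0 < h) (hη : 0 < η) (hδ0 : 0 < δ)
    (hδ : δ < η * A) {C : ℝ} {F : ℂ → ℂ} {U : Set ℂ} (hUo : IsOpen U)
    (hU : ∀ z : ℂ, δ ≤ z.re → z ∈ U) (hF : DifferentiableOn ℂ F U)
    (hC : ∀ z : ℂ, δ ≤ z.re → |z.im| ≤ h → ‖F z‖ ≤ C * Real.exp (-z.re)) :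
    HasSum (fun k : ℕ => (-1) ^ k / (k ! : ℂ) * η * F ((η * (A + k) : ℝ) : ℂ))
      (∫ t, Complex.Gamma (A - hankelRight δ h t / η) * F (hankelRight δ h t) *
        (hankelRightVel h t / (2 * Real.pi * Complex.I))) := by
  have hA : 0 < A := pos_of_mul_pos_right (hδ0.trans hδ) hη.le
  have hm := poleGap_pos hh hη hδ
  have hη' : (η : ℂ) ≠ 0 := by exact_mod_cast hη.ne'
  have hFc : Continuous fun t => F (hankelRight δ h t) :=
    hF.continuousOn.comp_continuous (continuous_hankelRight δ h) fun t =>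
      hU _ (le_hankelRight_re δ h t)
  have hFi := integrable_hankel hFc fun t =>
    hC _ (le_hankelRight_re δ h t) (abs_hankelRight_im_le hh t)
  have hC0 : 0 ≤ C := by
    have := (norm_nonneg _).trans (hC δ (by simp) (by simp [hh.le]))
    exact nonneg_of_mul_nonneg_left this (Real.exp_pos _)
  set G : ℕ → ℝ → ℂ := fun k t => (-1) ^ k / (k ! : ℂ) / (A - hankelRight δ h t / η + k) *
    (F (hankelRight δ h t) * hankelRightVel h t) with hG
  have hGn : ∀ k t, ‖G k t‖ ≤ 1 ^ k / (k ! : ℝ) * (poleGap A η δ h)⁻¹ *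
      ‖F (hankelRight δ h t) * hankelRightVel h t‖ := fun k t => by
    rw [hG, norm_mul, norm_div, norm_div, norm_pow, norm_neg, norm_one, Complex.norm_natCast]
    rw [← div_eq_mul_inv]
    exact mul_le_mul_of_nonneg_right
      (div_le_div_of_nonneg_left (by positivity) hm (poleGap_le hh hη t k)) (norm_nonneg _)
  have hGi : ∀ k, Integrable (G k) := fun k => by
    refine (hFi.norm.const_mul (1 ^ k / (k ! : ℝ) * (poleGap A η δ h)⁻¹)).mono'
      (Measurable.aestronglyMeasurable ?_) (Eventually.of_forall (hGn k))
    refine Measurable.mul (Continuous.measurable ?_)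
      (hFc.measurable.mul (measurable_hankelRightVel h))
    exact continuous_const.div ((continuous_const.sub
      ((continuous_hankelRight δ h).div_const _)).add continuous_const) fun t =>
      norm_pos_iff.1 (hm.trans_le (poleGap_le hh hη t k))
  have hsum : Summable fun k => ∫ t, ‖G k t‖ := by
    refine Summable.of_nonneg_of_le (fun k => integral_nonneg fun _ => norm_nonneg _) (fun k => ?_)
      (((Real.summable_pow_div_factorial 1).mul_right (poleGap A η δ h)⁻¹).mul_right
        (∫ t, ‖F (hankelRight δ h t) * hankelRightVel h t‖))
    rw [← integral_const_mul]
    exact integral_mono (hGi k).norm (hFi.norm.const_mul _) (hGn k)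
  have hval : ∀ k : ℕ, ∫ t, G k t =
      (-1) ^ k / (k ! : ℂ) * η * F ((η * (A + k) : ℝ) : ℂ) *
        (2 * Real.pi * Complex.I) := fun k => by
    have hw : δ < η * (A + k) := by
      have : 0 ≤ η * k := by positivity
      linarith [mul_add η A k]
    have hres := integral_hankel_div_sub hh hUo hU hF hC hw
    have : ∀ t, G k t = (-1) ^ k / (k ! : ℂ) * -η * (F (hankelRight δ h t) /
        (hankelRight δ h t - (η * (A + k) : ℝ)) * hankelRightVel h t) := fun t => by
      have h1 : (A : ℂ) - hankelRight δ h t / η + k =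
          (hankelRight δ h t - (η * (A + k) : ℝ)) / -η := by
        push_cast
        field_simp
        ring
      simp only [hG]
      rw [h1, div_div_eq_mul_div]
      ring
    simp only [this]
    rw [integral_const_mul, hres]
    ring
  -- the entire part contributes nothing
  have hE : ∫ t, gammaEntire (A - hankelRight δ h t / η) * F (hankelRight δ h t) *
      hankelRightVel h t = 0 := by
    refine integral_hankel_eq_zero (f := fun z => gammaEntire (A - z / η) * F z)
      (C := Real.Gamma A * C) hh hU ?_ fun z hz hz' => ?_
    · refine DifferentiableOn.mul (Differentiable.differentiableOn ?_) hF
      have := differentiable_gammaEntire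
      fun_prop
    · rw [norm_mul, mul_assoc]
      refine mul_le_mul (norm_gammaEntire_le hA ?_) (hC z hz hz') (norm_nonneg _)
        (Real.Gamma_pos_of_pos hA).le
      rw [Complex.sub_re, Complex.div_ofReal_re, Complex.ofReal_re]
      have := div_nonneg (hδ0.le.trans hz) hη.le
      linarith
  have hEi : Integrable fun t => gammaEntire (A - hankelRight δ h t / η) *
      F (hankelRight δ h t) * hankelRightVel h t := by
    refine integrable_hankel (f := fun z => gammaEntire (A - z / η) * F z)
      (C := Real.Gamma A * C) ?_ fun t => ?_
    · exact (differentiable_gammaEntire.continuous.comp (continuous_const.sub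
        ((continuous_hankelRight δ h).div_const _))).mul hFc
    · rw [norm_mul, mul_assoc]
      refine mul_le_mul (norm_gammaEntire_le hA ?_)
        (hC _ (le_hankelRight_re δ h t) (abs_hankelRight_im_le hh t)) (norm_nonneg _)
        (Real.Gamma_pos_of_pos hA).le
      rw [Complex.sub_re, Complex.div_ofReal_re, Complex.ofReal_re]
      have := div_nonneg (hδ0.le.trans (le_hankelRight_re δ h t)) hη.le
      linarith
  have hmain := hasSum_integral_of_summable_integral_norm hGi hsum
  have hpi : (2 * Real.pi * Complex.I : ℂ) ≠ 0 := Complex.two_pi_I_ne_zero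
  have heq : ∫ t, ∑' k, G k t = ∫ t, Complex.Gamma (A - hankelRight δ h t / η) *
      F (hankelRight δ h t) * hankelRightVel h t := by
    have hΓ : Integrable fun t => Complex.Gamma (A - hankelRight δ h t / η) *
        F (hankelRight δ h t) * hankelRightVel h t := by
      refine (hFi.norm.const_mul (hankelGammaBound A η δ h)).mono'
        (((continuous_Gamma_hankelRight hh hη hδ).mul hFc).measurable.mul
          (measurable_hankelRightVel h)).aestronglyMeasurable (Eventually.of_forall fun t => ?_)
      rw [mul_assoc, norm_mul]
      exact mul_le_mul_of_nonneg_right (norm_Gamma_hankelRight_le hh hη hδ0 hδ t) (norm_nonneg _)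
    rw [← sub_zero (∫ t, Complex.Gamma (A - hankelRight δ h t / η) *
      F (hankelRight δ h t) * hankelRightVel h t), ← hE, ← integral_sub hΓ hEi]
    refine integral_congr_ae (Eventually.of_forall fun t => ?_)
    simp only [hG]
    rw [tsum_mul_right, ← gammaPolar, Gamma_eq_polar_add_entire hm (poleGap_le hh hη t)]
    ring
  rw [heq] at hmain
  simp only [hval] at hmain
  have := hmain.div_const (2 * Real.pi * Complex.I)
  simp only [mul_div_cancel_right₀ _ hpi] at this
  rw [← integral_div] at this
  simpa only [mul_div_assoc] using this

end

/-- The reciprocal of the Gamma function decays faster than any exponential in half strips. -/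
theorem exists_norm_Gamma_inv_le {B : ℝ} (hB : 0 < B) (T : ℝ) {κ : ℝ} (hκ : 0 ≤ κ) :
    ∃ C, 0 ≤ C ∧ ∀ w : ℂ, B ≤ w.re → |w.im| ≤ T →
      ‖(Complex.Gamma w)⁻¹‖ ≤ C * Real.exp (-(κ * w.re)) := by
  have hK : IsCompact (Set.Icc B (B + 1) ×ℂ Set.Icc (-T) T) := isCompact_Icc.reProdIm isCompact_Icc
  obtain ⟨M, hM⟩ := hK.exists_bound_of_continuousOn
    (Complex.differentiable_one_div_Gamma.continuous.continuousOn)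
  have hM0 : 0 ≤ max M 0 := le_max_right _ _
  set a : ℕ → ℝ := fun n => ∏ j ∈ Finset.range n, (Real.exp κ / (B + j)) with ha
  have ha0 : ∀ n, 0 < a n := fun n => Finset.prod_pos fun j _ => by positivity
  obtain ⟨D, hD⟩ : ∃ D, ∀ n, a n ≤ D := by
    have hr : Tendsto (fun n => ‖a (n + 1)‖ / ‖a n‖) atTop (𝓝 0) := by
      have h1 : Tendsto (fun n : ℕ => Real.exp κ / (B + n)) atTop (𝓝 0) :=
        (tendsto_atTop_add_const_left _ B tendsto_natCast_atTop_atTop).const_div_atTop _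
      refine h1.congr fun n => ?_
      rw [Real.norm_of_nonneg (ha0 _).le, Real.norm_of_nonneg (ha0 _).le, ha]
      simp only
      rw [Finset.prod_range_succ, mul_div_cancel_left₀ _ (ha0 n).ne']
    have hs := summable_of_ratio_test_tendsto_lt_one zero_lt_one
      (Eventually.of_forall fun n => (ha0 n).ne') hr
    obtain ⟨D, hD⟩ := hs.tendsto_atTop_zero.bddAbove_range
    exact ⟨D, fun n => hD ⟨n, rfl⟩⟩
  have hD0 : 0 ≤ D := (ha0 0).le.trans (hD 0)
  have hind : ∀ n : ℕ, ∀ w : ℂ, w ∈ Set.Icc B (B + 1) ×ℂ Set.Icc (-T) T →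
      ‖(Complex.Gamma (w + n))⁻¹‖ ≤ max M 0 * (a n * Real.exp (-(κ * n))) := by
    intro n w hw
    induction n with
    | zero => simpa [ha] using Or.inl (hM w hw)
    | succ n ih =>
      have hre : B + n ≤ ‖w + n‖ := by
        refine le_trans ?_ (Complex.re_le_norm _)
        simpa using hw.1.1
      have hpos : 0 < B + n := by positivity
      have hne : w + n ≠ 0 := norm_pos_iff.1 (hpos.trans_le hre)
      have e : w + ((n + 1 : ℕ) : ℂ) = w + n + 1 := by push_cast; ring
      rw [e, Complex.Gamma_add_one _ hne, mul_inv, norm_mul, norm_inv]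
      have h1 : ‖w + n‖⁻¹ ≤ (B + n)⁻¹ := inv_anti₀ hpos hre
      refine (mul_le_mul h1 ih (norm_nonneg _) (by positivity)).trans_eq ?_
      have h2 : Real.exp (-(κ * (n + 1 : ℕ))) = Real.exp (-(κ * n)) * Real.exp (-κ) := by
        rw [← Real.exp_add]; congr 1; push_cast; ring
      have h3 : Real.exp κ * Real.exp (-κ) = 1 := by
        rw [← Real.exp_add, add_neg_cancel, Real.exp_zero]
      rw [h2, ha]
      simp only
      rw [Finset.prod_range_succ]
      field_simp
      linear_combination (-max M 0) * h3
  refine ⟨max M 0 * D * Real.exp (κ * (B + 1)), by positivity, fun w hw hT => ?_⟩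
  set n := ⌊w.re - B⌋₊ with hn
  have h1 := Nat.floor_le (sub_nonneg.2 hw)
  have h2 := Nat.lt_floor_add_one (w.re - B)
  have hmem : w - n ∈ Set.Icc B (B + 1) ×ℂ Set.Icc (-T) T := by
    refine ⟨?_, ?_⟩
    · simp only [Set.mem_preimage, Complex.sub_re, Complex.natCast_re, Set.mem_Icc]
      constructor <;> linarith
    · simpa [← abs_le] using hT
  have h3 := hind n (w - n) hmem
  rw [sub_add_cancel] at h3
  refine h3.trans ?_
  rw [mul_assoc, mul_assoc]
  refine mul_le_mul_of_nonneg_left (mul_le_mul (hD n) ?_ (Real.exp_pos _).le hD0) hM0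
  rw [← Real.exp_add, Real.exp_le_exp]
  nlinarith

/-! ### The hard-edge kernel as a series of residues -/

/-- The part `x^ζ / Γ(α / (2θ) + ζ / θ + 1 / 2)` of the integrand of the hard-edge kernel; it is an
entire function of `ζ`. -/
def powGammaInv (α θ x : ℝ) (ζ : ℂ) : ℂ :=
  (x : ℂ) ^ ζ * (Complex.Gamma (α / (2 * θ) + ζ / θ + 1 / 2))⁻¹

/-- One of the two factors, up to `1 / (ζ - ω)`, of the integrand of the hard-edge kernel. -/
def hankelWeight (α η θ δ h x t : ℝ) : ℂ :=
  hardEdgeF α η θ (hankelRight δ h t) * (x : ℂ) ^ hankelRight δ h t *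
    (hankelRightVel h t / (2 * Real.pi * Complex.I))

section

variable {α η θ δ h x y : ℝ}

theorem differentiable_powGammaInv (hx : 0 < x) : Differentiable ℂ (powGammaInv α θ x) := by
  have h1 := Complex.differentiable_one_div_Gamma
  have hx' : (x : ℂ) ≠ 0 := by exact_mod_cast hx.ne'
  have h2 : Differentiable ℂ fun ζ : ℂ => (x : ℂ) ^ ζ := fun ζ =>
    differentiableAt_id.const_cpow (Or.inl hx')
  have h3 : Differentiable ℂ fun ζ : ℂ => (α / (2 * θ) + ζ / θ + 1 / 2 : ℂ) := by fun_prop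
  exact h2.mul (h1.comp h3)

/-- The reciprocal of the Gamma function decays faster than any exponential, so that it absorbs the
power of `x`. -/
theorem exists_norm_powGammaInv_le (hα : 0 ≤ α) (hθ : 0 < θ) (hx : 0 < x) (h : ℝ) :
    ∃ C, 0 ≤ C ∧ ∀ ζ : ℂ, 0 ≤ ζ.re → |ζ.im| ≤ h →
      ‖powGammaInv α θ x ζ‖ ≤ C * Real.exp (-ζ.re) := by
  have hB : 0 < α / (2 * θ) + 1 / 2 := by positivity
  obtain ⟨C, hC0, hC⟩ := exists_norm_Gamma_inv_le hB (h / θ)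
    (κ := θ * (|Real.log x| + 1)) (by positivity)
  refine ⟨C, hC0, fun ζ hre him => ?_⟩
  have e1 : ((α : ℂ) / (2 * θ) + ζ / θ + 1 / 2) =
      ((α / (2 * θ) + 1 / 2 : ℝ) : ℂ) + ζ / (θ : ℂ) := by
    push_cast; ring
  have e2 : ((α : ℂ) / (2 * θ) + ζ / θ + 1 / 2).re = α / (2 * θ) + 1 / 2 + ζ.re / θ := by
    rw [e1, Complex.add_re, Complex.ofReal_re, Complex.div_ofReal_re]
  have e3 : ((α : ℂ) / (2 * θ) + ζ / θ + 1 / 2).im = ζ.im / θ := by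
    rw [e1, Complex.add_im, Complex.ofReal_im, Complex.div_ofReal_im, zero_add]
  have h1 := hC (α / (2 * θ) + ζ / θ + 1 / 2)
    (by rw [e2]; exact le_add_of_nonneg_right (by positivity))
    (by rw [e3, abs_div, abs_of_pos hθ]; exact div_le_div_of_nonneg_right him hθ.le)
  rw [e2] at h1
  rw [powGammaInv, norm_mul, Complex.norm_cpow_eq_rpow_re_of_pos hx, Real.rpow_def_of_pos hx]
  refine (mul_le_mul_of_nonneg_left h1 (Real.exp_pos _).le).trans ?_
  rw [mul_left_comm, ← Real.exp_add]
  refine mul_le_mul_of_nonneg_left (Real.exp_le_exp.2 ?_) hC0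
  have h2 : Real.log x * ζ.re ≤ |Real.log x| * ζ.re :=
    mul_le_mul_of_nonneg_right (le_abs_self _) hre
  have h3 : θ * (|Real.log x| + 1) * (α / (2 * θ) + 1 / 2 + ζ.re / θ) =
      θ * (|Real.log x| + 1) * (α / (2 * θ) + 1 / 2) + (|Real.log x| + 1) * ζ.re := by
    field_simp
  have h4 : 0 ≤ θ * (|Real.log x| + 1) * (α / (2 * θ) + 1 / 2) := by positivity
  rw [h3]
  linarith

theorem poleExp_eq (hη : 0 < η) (k : ℕ) : η * (α / (2 * η) + 1 / 2 + k) = poleExp α η k := by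
  rw [poleExp]
  field_simp

theorem hankelWeight_eq (α η θ δ h x t : ℝ) :
    hankelWeight α η θ δ h x t =
      Complex.Gamma ((α / (2 * η) + 1 / 2 : ℝ) - hankelRight δ h t / η) *
        powGammaInv α θ x (hankelRight δ h t) *
        (hankelRightVel h t / (2 * Real.pi * Complex.I)) := by
  rw [hankelWeight, hardEdgeF, powGammaInv, show (α : ℂ) / (2 * η) - hankelRight δ h t / η + 1 / 2 =
    ((α / (2 * η) + 1 / 2 : ℝ) : ℂ) - hankelRight δ h t / η by push_cast; ring, div_eq_mul_inv]
  ring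

theorem delta_lt_mul (hη : 0 < η) (hδη : δ < α / 2 + η / 2) :
    δ < η * (α / (2 * η) + 1 / 2) := by
  have : η * (α / (2 * η) + 1 / 2) = α / 2 + η / 2 := by field_simp
  rwa [this]

theorem integrable_hankelWeight (hα : 0 ≤ α) (hη : 0 < η) (hθ : 0 < θ) (hδ : 0 < δ)
    (hδη : δ < α / 2 + η / 2) (hh : 0 < h) (hx : 0 < x) :
    Integrable (hankelWeight α η θ δ h x) := by
  obtain ⟨C, hC0, hC⟩ := exists_norm_powGammaInv_le hα hθ hx h
  have hδA := delta_lt_mul hη hδη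
  have hc : Continuous fun t => powGammaInv α θ x (hankelRight δ h t) :=
    (differentiable_powGammaInv hx).continuous.comp (continuous_hankelRight δ h)
  have hi := integrable_hankel hc fun t =>
    hC _ (hδ.le.trans (le_hankelRight_re δ h t)) (abs_hankelRight_im_le hh t)
  refine ((hi.norm.const_mul (hankelGammaBound (α / (2 * η) + 1 / 2) η δ h)).mul_const
    ‖(2 * Real.pi * Complex.I : ℂ)‖⁻¹).mono' ?_ (Eventually.of_forall fun t => ?_)
  · rw [funext (hankelWeight_eq α η θ δ h x)]
    exact (((continuous_Gamma_hankelRight hh hη hδA).mul hc).measurable.mul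
      ((measurable_hankelRightVel h).div_const _)).aestronglyMeasurable
  · rw [hankelWeight_eq, norm_mul, norm_mul, norm_div, norm_mul (powGammaInv _ _ _ _)]
    refine le_trans (le_of_eq ?_) (mul_le_mul_of_nonneg_right (mul_le_mul_of_nonneg_right
      (norm_Gamma_hankelRight_le hh hη hδ hδA t) (by positivity)) (by positivity))
    ring

/-- The residue of `powGammaInv` times a Gamma function at its `k`-th pole. -/
def poleCoeff (α η θ x : ℝ) (k : ℕ) : ℂ :=
  (-1) ^ k / (k ! : ℂ) * η * powGammaInv α θ x (poleExp α η k)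

/-- The residue series of the integral over one contour. -/
theorem hasSum_integral_hankelWeight_div (hα : 0 ≤ α) (hη : 0 < η) (hθ : 0 < θ) (hδ : 0 < δ)
    (hδη : δ < α / 2 + η / 2) (hh : 0 < h) (hx : 0 < x) {w : ℂ} (hw : 0 < w.re) :
    HasSum (fun k : ℕ => poleCoeff α η θ x k / (poleExp α η k + w))
      (∫ t, hankelWeight α η θ δ h x t / (hankelRight δ h t + w)) := by
  obtain ⟨C, hC0, hC⟩ := exists_norm_powGammaInv_le hα hθ hx h
  have hre : ∀ z : ℂ, 0 ≤ z.re → w.re ≤ ‖z + w‖ := fun z hz =>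
    le_trans (by rw [Complex.add_re]; linarith) (Complex.re_le_norm _)
  have key := hasSum_integral_hankel_Gamma (A := α / (2 * η) + 1 / 2) (C := C / w.re)
    (F := fun z => powGammaInv α θ x z / (z + w)) (U := {z : ℂ | 0 < z.re}) hh hη hδ
    (delta_lt_mul hη hδη) (isOpen_lt continuous_const Complex.continuous_re)
    (fun z hz => hδ.trans_le hz) ?_ fun z hz hz' => ?_
  · simp only [poleExp_eq hη] at key
    have e1 : ∀ k : ℕ, (-1) ^ k / (k ! : ℂ) * η * (powGammaInv α θ x (poleExp α η k) /
        (poleExp α η k + w)) = poleCoeff α η θ x k / (poleExp α η k + w) := fun k => by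
      rw [poleCoeff]; ring
    simp only [e1] at key
    convert key using 1
    refine integral_congr_ae (Eventually.of_forall fun t => ?_)
    simp only [hankelWeight_eq]
    ring
  · refine (differentiable_powGammaInv hx).differentiableOn.div (by fun_prop) fun z hz => ?_
    exact norm_pos_iff.1 (hw.trans_le (hre z (le_of_lt hz)))
  · rw [norm_div, div_mul_eq_mul_div]
    have hz0 := hδ.le.trans hz
    exact div_le_div₀ (by positivity) (hC z hz0 hz') hw (hre z hz0)

theorem summable_norm_poleCoeff (hα : 0 ≤ α) (hη : 0 < η) (hθ : 0 < θ) (hx : 0 < x) :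
    Summable fun k => ‖poleCoeff α η θ x k‖ := by
  obtain ⟨C, hC0, hC⟩ := exists_norm_powGammaInv_le hα hθ hx 0
  refine Summable.of_nonneg_of_le (fun _ => norm_nonneg _) (fun k => ?_)
    (((Real.summable_pow_div_factorial 1).mul_right η).mul_right C)
  rw [poleCoeff, norm_mul, norm_mul, norm_div, norm_pow, norm_neg, norm_one, Complex.norm_natCast,
    Complex.norm_real, Real.norm_of_nonneg hη.le]
  refine mul_le_mul_of_nonneg_left ?_ (by positivity)
  have hp := (poleExp_pos hα hη k).le
  refine (hC _ (by simpa using hp) (by simp)).trans (mul_le_of_le_one_right hC0 ?_)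
  exact Real.exp_le_one_iff.2 (by simpa using hp)

theorem hankelLeft_eq (hh : 0 < h) (δ t : ℝ) : hankelLeft δ h t = -hankelRight δ h (-t) := by
  apply Complex.ext
  · simp only [hankelLeft, hankelRight, Complex.neg_re, abs_neg]
    ring
  · simp only [hankelLeft, hankelRight, Complex.neg_im]
    simp only [max_def, min_def]
    split_ifs <;> linarith

theorem hankelLeftVel_eq (hh : 0 < h) (t : ℝ) : hankelLeftVel h t = hankelRightVel h (-t) := by
  unfold hankelLeftVel hankelRightVel
  rw [abs_neg]
  by_cases h1 : |t| < h
  · rw [if_pos h1, if_pos h1]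
  · rw [if_neg h1, if_neg h1]
    rcases lt_trichotomy t 0 with h2 | h2 | h2
    · rw [if_neg h2.not_gt, if_pos (neg_pos.2 h2)]
    · rw [h2, abs_zero] at h1
      exact absurd hh h1
    · rw [if_pos h2, if_neg (by linarith)]

theorem inv_hardEdgeF_neg (α η θ : ℝ) (ζ : ℂ) :
    (hardEdgeF α η θ (-ζ))⁻¹ = hardEdgeF α θ η ζ := by
  rw [hardEdgeF, hardEdgeF, inv_div, neg_div, neg_div, sub_neg_eq_add, ← sub_eq_add_neg]

/-- The reflection of the contour of `ω` turns the integrand into a symmetric expression. -/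
theorem hardEdgeIntegrand_eq (α η θ δ : ℝ) (hh : 0 < h) (x y : ℝ) (p : ℝ × ℝ) :
    hardEdgeIntegrand α η θ δ h x y p = hankelWeight α η θ δ h x p.1 *
      hankelWeight α θ η δ h y (-p.2) * (hankelRight δ h p.1 + hankelRight δ h (-p.2))⁻¹ := by
  rw [hardEdgeIntegrand, hankelLeft_eq hh, hankelLeftVel_eq hh, div_eq_mul_inv (hardEdgeF _ _ _ _),
    inv_hardEdgeF_neg, Complex.cpow_neg, div_inv_eq_mul, sub_neg_eq_add, hankelWeight, hankelWeight,
    one_div]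
  ring

theorem le_norm_hankelRight_add (t : ℝ) {w : ℂ} (hw : 0 ≤ w.re) :
    δ ≤ ‖hankelRight δ h t + w‖ := by
  refine le_trans ?_ (Complex.re_le_norm _)
  rw [Complex.add_re]
  linarith [le_hankelRight_re δ h t]

/-- The double integral converges absolutely, as the contours stay at a distance `2 δ` from each
other. -/
theorem integrable_hardEdgeIntegrand (hα : 0 ≤ α) (hη : 0 < η) (hθ : 0 < θ) (hδ : 0 < δ)
    (hδη : δ < α / 2 + η / 2) (hδθ : δ < α / 2 + θ / 2) (hh : 0 < h) (hx : 0 < x) (hy : 0 < y) :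
    Integrable (hardEdgeIntegrand α η θ δ h x y) := by
  rw [funext (hardEdgeIntegrand_eq α η θ δ hh x y)]
  have h1 := (integrable_hankelWeight hα hη hθ hδ hδη hh hx).mul_prod
    (integrable_hankelWeight hα hθ hη hδ hδθ hh hy).comp_neg
  have hc := continuous_hankelRight δ h
  have hre : ∀ t, 0 ≤ (hankelRight δ h t).re := fun t => hδ.le.trans (le_hankelRight_re δ h t)
  have hne : ∀ p : ℝ × ℝ, hankelRight δ h p.1 + hankelRight δ h (-p.2) ≠ 0 := fun p =>
    norm_pos_iff.1 (hδ.trans_le (le_norm_hankelRight_add p.1 (hre _)))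
  have hcont : Continuous fun p : ℝ × ℝ => (hankelRight δ h p.1 + hankelRight δ h (-p.2))⁻¹ :=
    ((hc.comp continuous_fst).add (hc.comp continuous_snd.neg)).inv₀ hne
  refine (h1.norm.mul_const δ⁻¹).mono' (h1.aestronglyMeasurable.mul
    hcont.aestronglyMeasurable) (Eventually.of_forall fun p => ?_)
  rw [norm_mul, norm_inv]
  exact mul_le_mul_of_nonneg_left (inv_anti₀ hδ (le_norm_hankelRight_add p.1 (hre _)))
    (norm_nonneg _)

/-- The double contour integral as an iterated sum of residues. -/
theorem hasSum_integral_hardEdgeIntegrand (hα : 0 ≤ α) (hη : 0 < η) (hθ : 0 < θ) (hδ : 0 < δ)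
    (hδη : δ < α / 2 + η / 2) (hδθ : δ < α / 2 + θ / 2) (hh : 0 < h) (hx : 0 < x) (hy : 0 < y) :
    HasSum (fun m : ℕ => ∑' i : ℕ, poleCoeff α η θ x i * poleCoeff α θ η y m /
      (poleExp α η i + poleExp α θ m)) (∫ p, hardEdgeIntegrand α η θ δ h x y p) := by
  have hint := integrable_hardEdgeIntegrand hα hη hθ hδ hδη hδθ hh hx hy
  have hre : ∀ t, 0 < (hankelRight δ h t).re := fun t => hδ.trans_le (le_hankelRight_re δ h t)
  have hW := integrable_hankelWeight hα hη hθ hδ hδη hh hx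
  rw [Measure.volume_eq_prod, integral_prod _ hint]
  -- the inner integral, over the contour of `ω`
  have hinner : ∀ t, ∫ u, hardEdgeIntegrand α η θ δ h x y (t, u) =
      ∑' m : ℕ, hankelWeight α η θ δ h x t * (poleCoeff α θ η y m /
        (hankelRight δ h t + poleExp α θ m)) := fun t => by
    simp only [hardEdgeIntegrand_eq α η θ δ hh]
    rw [integral_neg_eq_self (fun u => hankelWeight α η θ δ h x t * hankelWeight α θ η δ h y u *
      (hankelRight δ h t + hankelRight δ h u)⁻¹) volume]
    have := (hasSum_integral_hankelWeight_div hα hθ hη hδ hδθ hh hy (hre t)).tsum_eq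
    rw [tsum_mul_left]
    simp only [add_comm (hankelRight δ h t)]
    rw [this, ← integral_const_mul]
    refine integral_congr_ae (Eventually.of_forall fun u => ?_)
    simp only
    ring
  simp only [hinner]
  set G : ℕ → ℝ → ℂ := fun m t => hankelWeight α η θ δ h x t * (poleCoeff α θ η y m /
        (hankelRight δ h t + poleExp α θ m)) with hG
  have hpos : ∀ m, 0 ≤ ((poleExp α θ m : ℝ) : ℂ).re := fun m => by
    simpa using (poleExp_pos hα hθ m).le
  have hGn : ∀ m t, ‖G m t‖ ≤ ‖poleCoeff α θ η y m‖ * δ⁻¹ * ‖hankelWeight α η θ δ h x t‖ :=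
    fun m t => by
    rw [hG, norm_mul, norm_div, mul_comm, div_eq_mul_inv]
    have := inv_anti₀ hδ (le_norm_hankelRight_add (h := h) t (hpos m))
    gcongr
  have hGi : ∀ m, Integrable (G m) := fun m => by
    refine (hW.norm.const_mul (‖poleCoeff α θ η y m‖ * δ⁻¹)).mono'
      (hW.aestronglyMeasurable.mul (Continuous.aestronglyMeasurable ?_))
      (Eventually.of_forall (hGn m))
    exact continuous_const.div ((continuous_hankelRight δ h).add continuous_const) fun t =>
      norm_pos_iff.1 (hδ.trans_le (le_norm_hankelRight_add t (hpos m)))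
  have hsum : Summable fun m => ∫ t, ‖G m t‖ := by
    refine Summable.of_nonneg_of_le (fun k => integral_nonneg fun _ => norm_nonneg _) (fun k => ?_)
      (((summable_norm_poleCoeff hα hθ hη hy).mul_right δ⁻¹).mul_right
        (∫ t, ‖hankelWeight α η θ δ h x t‖))
    rw [← integral_const_mul]
    exact integral_mono (hGi k).norm (hW.norm.const_mul _) (hGn k)
  have hmain := hasSum_integral_of_summable_integral_norm hGi hsum
  have hval : ∀ m, ∫ t, G m t = ∑' i : ℕ, poleCoeff α η θ x i * poleCoeff α θ η y m /
      (poleExp α η i + poleExp α θ m) := fun m => by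
    have := (hasSum_integral_hankelWeight_div hα hη hθ hδ hδη hh hx
      (w := ((poleExp α θ m : ℝ) : ℂ)) (by simpa using poleExp_pos hα hθ m)).tsum_eq
    have e : ∀ t, G m t = hankelWeight α η θ δ h x t / (hankelRight δ h t + poleExp α θ m) *
        poleCoeff α θ η y m := fun t => by
      simp only [hG]; ring
    simp only [e]
    rw [integral_mul_const, ← this, ← tsum_mul_right]
    exact tsum_congr fun i => by ring
  simp only [hval] at hmain
  exact hmain

theorem poleCoeff_exp (α η θ u : ℝ) (k : ℕ) :
    poleCoeff α η θ (Real.exp (-u)) k = (((-1) ^ k * (k ! : ℝ)⁻¹ * η *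
      (Real.exp (-(poleExp α η k * u)) * (Real.Gamma (poleArg α η θ k))⁻¹) : ℝ) : ℂ) := by
  have h1 : ((Real.exp (-u) : ℝ) : ℂ) ^ ((poleExp α η k : ℝ) : ℂ) =
      ((Real.exp (-(poleExp α η k * u)) : ℝ) : ℂ) := by
    rw [← Complex.ofReal_cpow (Real.exp_pos _).le, ← Real.exp_mul]
    congr 2
    ring
  have h2 : (α : ℂ) / (2 * θ) + (poleExp α η k : ℝ) / θ + 1 / 2 =
      ((poleArg α η θ k : ℝ) : ℂ) := by
    rw [poleArg]; push_cast; ring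
  rw [poleCoeff, powGammaInv, h1, h2, Complex.Gamma_ofReal]
  push_cast
  ring

/-- The hard-edge kernel is the double series of residues. -/
theorem hardEdgeKernelTilde_eq (hα : 0 ≤ α) (hη : 0 < η) (hθ : 0 < θ) (hδ : 0 < δ)
    (hδη : δ < α / 2 + η / 2) (hδθ : δ < α / 2 + θ / 2) (hh : 0 < h) (u v : ℝ) :
    hardEdgeKernelTilde α η θ δ h u v = (hardSeries α η θ u v : ℂ) := by
  have hI := (hasSum_integral_hardEdgeIntegrand hα hη hθ hδ hδη hδθ hh (Real.exp_pos (-u))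
    (Real.exp_pos (-v))).tsum_eq
  have hterm : ∀ i m : ℕ, poleCoeff α η θ (Real.exp (-u)) i * poleCoeff α θ η (Real.exp (-v)) m /
      (poleExp α η i + poleExp α θ m) = ((hardTerm α η θ u v (i, m) : ℝ) : ℂ) := fun i m => by
    rw [poleCoeff_exp, poleCoeff_exp, hardTerm, pow_add]
    push_cast
    ring
  have hS : ∫ p, hardEdgeIntegrand α η θ δ h (Real.exp (-u)) (Real.exp (-v)) p =
      (hardSeries α η θ u v : ℂ) := by
    rw [← hI]
    simp only [hterm, ← Complex.ofReal_tsum]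
    have hs := summable_hardTerm hα hη hθ u v
    rw [hardSeries, hs.tsum_prod, Summable.tsum_comm (f := fun i m => hardTerm α η θ u v (i, m)) hs]
  have hroot : Real.sqrt (Real.exp (-u) * Real.exp (-v)) = Real.exp (-u / 2 - v / 2) := by
    rw [← Real.exp_add, ← Real.sqrt_sq (Real.exp_pos (-u / 2 - v / 2)).le, ← Real.exp_nat_mul]
    congr 2
    push_cast
    ring
  rw [hardEdgeKernelTilde, hardEdgeKernel, hS, hroot, ← mul_assoc, mul_one_div_cancel, one_mul]
  exact_mod_cast (Real.exp_pos _).ne'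

end

end

theorem theorem7 :
    -- equality in distribution, and almost sure finiteness
    (∀ (a q η θ : ℝ), 0 ≤ a → a ≤ 1 → 0 ≤ q → q < 1 → 0 ≤ η → 0 ≤ θ →
      (∀ p, geoParam a q η θ p < 1) →
      ∀ (Ω : Type*) [MeasurableSpace Ω] (P : Measure Ω) [IsProbabilityMeasure P]
        (w : ℕ × ℕ → Ω → ℕ), IsGeoField P w a q η θ →
        IdentDistrib (fun ω => lppDownLeft fun p => w p ω)
          (fun ω => lppDownRight fun p => w p ω) P P ∧
        (0 < η → 0 < θ →
          ∀ᵐ ω ∂P, (lppDownLeft fun p => w p ω) ≠ ∞ ∧ (lppDownRight fun p => w p ω) ≠ ∞)) ∧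
    -- the limit law, for `q = e^(-ε)` and `a = e^(-α ε)`
    (∀ (α η θ : ℝ), 0 ≤ α → 0 < η → 0 < θ →
      ∀ (δ h : ℝ), 0 < δ → δ < α / 2 + η / 2 → δ < α / 2 + θ / 2 → 0 < h →
      (∀ x y : ℝ, 0 < x → 0 < y → Integrable (hardEdgeIntegrand α η θ δ h x y)) ∧
      ∀ s : ℝ,
        FredholmConverges (hardEdgeKernelTilde α η θ δ h) (Set.Ioi s) ∧
        ∀ (Ω : ℝ → Type*) [∀ ε, MeasurableSpace (Ω ε)] (P : ∀ ε, Measure (Ω ε))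
          [∀ ε, IsProbabilityMeasure (P ε)] (w : ∀ ε, ℕ × ℕ → Ω ε → ℕ),
          (∀ ε, 0 < ε →
            IsGeoField (P ε) (w ε) (Real.exp (-(α * ε))) (Real.exp (-ε)) η θ) →
          Tendsto (fun ε : ℝ => (scaledLppProb (P ε)
              (fun ω => lppDownLeft fun p => w ε p ω) ε η θ s : ℂ))
            (𝓝[>] 0) (𝓝 (fredholmDet (hardEdgeKernelTilde α η θ δ h) (Set.Ioi s))) ∧
          Tendsto (fun ε : ℝ => (scaledLppProb (P ε)
              (fun ω => lppDownRight fun p => w ε p ω) ε η θ s : ℂ))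
            (𝓝[>] 0) (𝓝 (fredholmDet (hardEdgeKernelTilde α η θ δ h) (Set.Ioi s)))) := by
  refine ⟨fun a q η θ ha ha1 hq hq1 _ _ hp Ω _ P _ w hw => ?_,
    fun α η θ hα hη hθ δ h hδ hδη hδθ hh => ⟨fun x y hx hy =>
      integrable_hardEdgeIntegrand hα hη hθ hδ hδη hδθ hh hx hy, fun s => ?_⟩⟩
  · have hP := hw.isProductGeoField ha
    have hid := identDistrib_lpp hP (rowParam_nonneg hq η) (rowParam_nonneg hq θ)
      fun i j => (geoParam_eq ha q η θ i j).symm.trans_lt (hp (i, j))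
    refine ⟨hid, fun hη hθ => ?_⟩
    have h1 := ae_lppDownLeft_ne_top hP (tsum_geoParam_ne_top ha1 hq hq1 hη hθ)
    have h2 := hid.ae_snd (p := fun x => x ≠ ∞) (measurableSet_singleton ∞).compl h1
    filter_upwards [h1, h2] with ω e1 e2 using ⟨e1, e2⟩
  · have hK : hardEdgeKernelTilde α η θ δ h = fun u v => (hardSeries α η θ u v : ℂ) := by
      funext u v
      exact hardEdgeKernelTilde_eq hα hη hθ hδ hδη hδθ hh u v
    rw [hK]
    refine ⟨fredholmConverges_hardSeries hα hη hθ s, fun Ω _ P _ w hw => ?_⟩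
    have hlim := tendsto_scaledLppProb hα hη hθ s Ω P w hw
    refine ⟨hlim, hlim.congr' ?_⟩
    filter_upwards [self_mem_nhdsWithin] with ε hε
    have hε' : 0 < ε := hε
    have hlt : ∀ (η : ℝ), 0 < η → ∀ i, rowParam (Real.exp (-(α * ε))) (Real.exp (-ε)) η i < 1 :=
      fun η hη i => by
        rw [rowParam_exp]
        exact mul_pow_lt_one (Real.exp_pos _).le
          (Real.exp_lt_one_iff.2 (neg_lt_zero.2 (mul_pos hε' (poleExp_pos hα hη 0))))
          (Real.exp_pos _).le (Real.exp_le_one_iff.2 (neg_nonpos.2 (mul_pos hε' hη).le)) i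
    have hid := identDistrib_lpp ((hw ε hε).isProductGeoField (Real.exp_pos _).le)
      (rowParam_nonneg (Real.exp_pos _).le η) (rowParam_nonneg (Real.exp_pos _).le θ)
      fun i j => mul_lt_one_of_nonneg_of_lt_one_left (rowParam_nonneg (Real.exp_pos _).le η i)
        (hlt η hη i) (hlt θ hθ j).le
    rw [scaledLppProb_congr hid]
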